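/- Let $n\ge 2$. Let $X_n$ be the spine of Outer space: the simplicial complex whose vertices are the equivalence classes of marked graphs $(\Gamma,g)$, where $\Gamma$ is a finite connected graph without separating edges and without vertices of valence less than $3$ and $g\colon R_n\to\Gamma$ is a homotopy equivalence from the standard rose with $n$ petals, two marked graphs being equivalent if they differ by a graph isomorphism compatible with the markings up to homotopy; a finite set of vertices spans a simplex if it can be ordered so that each marked graph is obtained from the preceding one by collapsing a forest. The group $\mathrm{Out}(F_n)$ acts on $X_n$ on the right by $(\Gamma,g)\cdot\varphi=(\Gamma,g\circ\varphi)$. Let $\mathcal T_n=\ker(\mathrm{Out}(F_n)\to \mathrm{GL}_n(\mathbb Z))$ be the Torelli subgroup and let $Y_n=X_n/\mathcal T_n$, with the quotient topology. A rose in $Y_n$ is the image of a vertex of $X_n$ represented by a marked graph with one vertex; its star in $Y_n$ is the image of the union of the closed simplices of $X_n$ that contain this vertex. The label of an oriented edge $a$ of $(\Gamma,g)$ is the row vector in $\mathbb Z^n$ whose $i$-th entry is the signed number of times $g(x_i)$ runs over $a$, where $x_1,\dots,x_n$ are the standard generators of $F_n=\pi_1(R_n)$. For $v=(a_1,\dots,a_n)\in\mathbb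 Z^n$ put $|v|=(|a_1|,\dots,|a_n|)$, ordered lexicographically. Number and orient the edges of a rose so that their labels $v_1,\dots,v_n$ satisfy $|v_n|<\cdots<|v_1|$; the norm of the rose is $(|v_n|,\dots,|v_1|)$, ordered lexicographically. The descending link of a rose in $Y_n$ is the intersection of its star with the union of the stars of all roses of strictly smaller norm, regarded as a subspace of $Y_n$. Then: (1) the descending link of a rose in $Y_n$ is nonempty if and only if the rose is not the rose with the identity marking; (2) the descending link of every rose in $Y_n$ is connected (where the empty space counts as connected). -/

import Mathlib

namespace TorelliSpine

/-! ### Finite graphs, edge paths and fundamental groups -/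

/-- A finite graph. `E` is the set of *oriented* edges, `inv` reverses the orientation, and
`src e` is the initial vertex of `e`. Loops and multiple edges are allowed. -/
structure FinGraph where
  V : Type
  E : Type
  finite_V : Finite V
  finite_E : Finite E
  src : E → V
  inv : E → E
  inv_inv : ∀ e, inv (inv e) = e
  inv_ne : ∀ e, inv e ≠ e

namespace FinGraph

/-- The terminal vertex of an oriented edge. -/
def tgt (Γ : FinGraph) (e : Γ.E) : Γ.V := Γ.src (Γ.inv e)

/-- `Γ.IsPath v l w`: the list `l` of oriented edges is an edge path from `v` to `w`. -/
def IsPath (Γ : FinGraph) : Γ.V → List Γ.E → Γ.V → Prop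
  | v, [], w => v = w
  | v, e :: l, w => Γ.src e = v ∧ Γ.IsPath (Γ.tgt e) l w

/-- A path is reduced if no edge is immediately followed by its inverse. -/
def IsReduced (Γ : FinGraph) (l : List Γ.E) : Prop :=
  l.IsChain (fun e f => f ≠ Γ.inv e)

/-- A set of oriented edges spans a forest if it contains no nontrivial reduced closed path. -/
def IsForest (Γ : FinGraph) (F : Set Γ.E) : Prop :=
  ∀ (v : Γ.V) (l : List Γ.E), (∀ e ∈ l, e ∈ F) → Γ.IsReduced l → Γ.IsPath v l v → l = []

/-- The path group of `Γ`: generated by the oriented edges, subject to `e * inv e = 1`.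
Two edge paths with the same endpoints are homotopic (rel endpoints) if and only if they
represent the same element of this group. -/
abbrev PathGroup (Γ : FinGraph) : Type :=
  PresentedGroup (Set.range fun e : Γ.E => FreeGroup.of e * FreeGroup.of (Γ.inv e))

/-- The element of the path group given by one oriented edge. -/
def edge (Γ : FinGraph) (e : Γ.E) : Γ.PathGroup := PresentedGroup.of e

/-- The homotopy class of a list of oriented edges. -/
def word (Γ : FinGraph) (l : List Γ.E) : Γ.PathGroup := (l.map Γ.edge).prod

theorem edge_mul_inv (Γ : FinGraph) (e : Γ.E) : Γ.edge e * Γ.edge (Γ.inv e) = 1 := by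
  have h : (PresentedGroup.mk (Set.range fun e : Γ.E => FreeGroup.of e * FreeGroup.of (Γ.inv e)))
      (FreeGroup.of e * FreeGroup.of (Γ.inv e)) = 1 :=
    (PresentedGroup.one_of_mem ⟨e, rfl⟩)
  simpa [edge, PresentedGroup.of] using h

theorem edge_inv (Γ : FinGraph) (e : Γ.E) : Γ.edge (Γ.inv e) = (Γ.edge e)⁻¹ :=
  (inv_eq_of_mul_eq_one_right (Γ.edge_mul_inv e)).symm

/-- The homomorphism out of the path group determined by the images of the edges. -/
def lift (Γ : FinGraph) {G : Type*} [Group G] (f : Γ.E → G)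
    (hf : ∀ e, f e * f (Γ.inv e) = 1) : Γ.PathGroup →* G :=
  PresentedGroup.toGroup (f := f) (by rintro _ ⟨e, rfl⟩; simpa using hf e)

@[simp] theorem lift_edge (Γ : FinGraph) {G : Type*} [Group G] (f : Γ.E → G)
    (hf : ∀ e, f e * f (Γ.inv e) = 1) (e : Γ.E) : Γ.lift f hf (Γ.edge e) = f e :=
  PresentedGroup.toGroup.of _

theorem hom_ext (Γ : FinGraph) {G : Type*} [Group G] {f g : Γ.PathGroup →* G}
    (h : ∀ e, f (Γ.edge e) = g (Γ.edge e)) : f = g :=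
  PresentedGroup.ext h

@[simp] theorem word_nil (Γ : FinGraph) : Γ.word [] = 1 := rfl

@[simp] theorem word_cons (Γ : FinGraph) (e : Γ.E) (l : List Γ.E) :
    Γ.word (e :: l) = Γ.edge e * Γ.word l := by simp [word]

@[simp] theorem word_append (Γ : FinGraph) (l m : List Γ.E) :
    Γ.word (l ++ m) = Γ.word l * Γ.word m := by simp [word]

theorem IsPath.append {Γ : FinGraph} {l m : List Γ.E} {u v w : Γ.V}
    (hl : Γ.IsPath u l v) (hm : Γ.IsPath v m w) : Γ.IsPath u (l ++ m) w := by
  induction l generalizing u with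
  | nil => cases hl; exact hm
  | cons e l ih => exact ⟨hl.1, ih hl.2⟩

theorem IsPath.exists_reverse {Γ : FinGraph} {l : List Γ.E} {v w : Γ.V}
    (hl : Γ.IsPath v l w) : ∃ m, Γ.IsPath w m v ∧ Γ.word m = (Γ.word l)⁻¹ := by
  induction l generalizing v with
  | nil => cases hl; exact ⟨[], rfl, by simp⟩
  | cons e l ih =>
    obtain ⟨m, hm, hw⟩ := ih hl.2
    refine ⟨m ++ [Γ.inv e], hm.append ⟨rfl, ?_⟩, ?_⟩
    · rw [← hl.1]; simp [tgt, Γ.inv_inv, IsPath]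
    · simp [hw, edge_inv]

/-- The fundamental group of `Γ` based at `v`: homotopy classes of closed edge paths at `v`. -/
def pi1 (Γ : FinGraph) (v : Γ.V) : Subgroup Γ.PathGroup where
  carrier := {γ | ∃ l, Γ.IsPath v l v ∧ Γ.word l = γ}
  one_mem' := ⟨[], rfl, rfl⟩
  mul_mem' := by
    rintro _ _ ⟨l, hl, rfl⟩ ⟨m, hm, rfl⟩
    exact ⟨l ++ m, hl.append hm, by simp⟩
  inv_mem' := by
    rintro _ ⟨l, hl, rfl⟩
    obtain ⟨m, hm, hw⟩ := hl.exists_reverse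
    exact ⟨m, hm, hw⟩

/-- The signed number of times that a path runs over the oriented edge `a`. -/
noncomputable def count (Γ : FinGraph) (a : Γ.E) : Γ.PathGroup →* Multiplicative ℤ := by
  classical
  exact Γ.lift (fun e => Multiplicative.ofAdd
      (if e = a then (1 : ℤ) else if e = Γ.inv a then -1 else 0)) (by
    intro e
    have h1 : Γ.inv e = Γ.inv a ↔ e = a :=
      ⟨fun h => by rw [← Γ.inv_inv e, h, Γ.inv_inv], fun h => by rw [h]⟩
    have h2 : Γ.inv e = a ↔ e = Γ.inv a :=
      ⟨fun h => by rw [← h, Γ.inv_inv], fun h => by rw [h, Γ.inv_inv]⟩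
    have h3 := Γ.inv_ne a
    rw [← ofAdd_add, ← ofAdd_zero]
    congr 1
    by_cases ha : e = a
    · subst ha; simp [h3]
    · by_cases hb : e = Γ.inv a
      · subst hb; simp [h3, Γ.inv_inv]
      · simp [h1, h2, ha, hb])

/-- An isomorphism (isometry, all edges having length one) of finite graphs. -/
structure Iso (Γ Δ : FinGraph) where
  onV : Γ.V ≃ Δ.V
  onE : Γ.E ≃ Δ.E
  src_onE : ∀ e, Δ.src (onE e) = onV (Γ.src e)
  inv_onE : ∀ e, Δ.inv (onE e) = onE (Γ.inv e)

/-- The homomorphism of path groups induced by an isomorphism. -/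
def Iso.map {Γ Δ : FinGraph} (h : Γ.Iso Δ) : Γ.PathGroup →* Δ.PathGroup :=
  Γ.lift (fun e => Δ.edge (h.onE e)) (fun e => by rw [← h.inv_onE, Δ.edge_mul_inv])

/-- The identity isomorphism. -/
def Iso.refl (Γ : FinGraph) : Γ.Iso Γ := ⟨Equiv.refl _, Equiv.refl _, fun _ => rfl, fun _ => rfl⟩

/-- The inverse isomorphism. -/
def Iso.symm {Γ Δ : FinGraph} (h : Γ.Iso Δ) : Δ.Iso Γ where
  onV := h.onV.symm
  onE := h.onE.symm
  src_onE e := by rw [Equiv.eq_symm_apply, ← h.src_onE, Equiv.apply_symm_apply]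
  inv_onE e := by rw [Equiv.eq_symm_apply, ← h.inv_onE, Equiv.apply_symm_apply]

/-- The composition of isomorphisms. -/
def Iso.trans {Γ Δ Θ : FinGraph} (h : Γ.Iso Δ) (k : Δ.Iso Θ) : Γ.Iso Θ where
  onV := h.onV.trans k.onV
  onE := h.onE.trans k.onE
  src_onE e := by simp [k.src_onE, h.src_onE]
  inv_onE e := by simp [k.inv_onE, h.inv_onE]

theorem Iso.map_refl {Γ : FinGraph} (x : Γ.PathGroup) : (Iso.refl Γ).map x = x := by
  have : (Iso.refl Γ).map = MonoidHom.id _ := Γ.hom_ext fun e => by simp [Iso.map, Iso.refl]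
  rw [this]; rfl

theorem Iso.map_trans {Γ Δ Θ : FinGraph} (h : Γ.Iso Δ) (k : Δ.Iso Θ) (x : Γ.PathGroup) :
    (h.trans k).map x = k.map (h.map x) := by
  have : (h.trans k).map = k.map.comp h.map :=
    Γ.hom_ext fun e => by simp [Iso.map, Iso.trans]
  rw [this]; rfl

theorem Iso.map_symm_map {Γ Δ : FinGraph} (h : Γ.Iso Δ) (x : Γ.PathGroup) :
    h.symm.map (h.map x) = x := by
  have : h.symm.map.comp h.map = MonoidHom.id _ :=
    Γ.hom_ext fun e => by simp [Iso.map, Iso.symm]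
  exact DFunLike.congr_fun this x

theorem Iso.tgt_onE {Γ Δ : FinGraph} (h : Γ.Iso Δ) (e : Γ.E) :
    Δ.tgt (h.onE e) = h.onV (Γ.tgt e) := by
  rw [tgt, tgt, h.inv_onE, h.src_onE]

theorem Iso.isPath {Γ Δ : FinGraph} (h : Γ.Iso Δ) {l : List Γ.E} {v w : Γ.V}
    (hl : Γ.IsPath v l w) : Δ.IsPath (h.onV v) (l.map h.onE) (h.onV w) := by
  induction l generalizing v with
  | nil => cases hl; rfl
  | cons e l ih =>
    refine ⟨by rw [h.src_onE, hl.1], ?_⟩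
    rw [h.tgt_onE]; exact ih hl.2

theorem Iso.word_map {Γ Δ : FinGraph} (h : Γ.Iso Δ) (l : List Γ.E) :
    Δ.word (l.map h.onE) = h.map (Γ.word l) := by
  induction l with
  | nil => simp
  | cons e l ih => simp [ih, Iso.map]

/-- A collapse of a forest in `Γ`, with result `Δ`: the edges of the forest are removed, each
component of the forest is shrunk to a vertex, and the other edges are kept. In other words,
an identification of `Δ` with the quotient graph of `Γ` by the forest. -/
structure Collapse (Γ Δ : FinGraph) where
  forest : Set Γ.E
  inv_mem : ∀ e ∈ forest, Γ.inv e ∈ forest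
  isForest : Γ.IsForest forest
  onV : Γ.V → Δ.V
  onE : {e : Γ.E // e ∉ forest} ≃ Δ.E
  onV_surjective : Function.Surjective onV
  onV_eq_iff : ∀ v w, onV v = onV w ↔ ∃ l, (∀ e ∈ l, e ∈ forest) ∧ Γ.IsPath v l w
  src_onE : ∀ e, Δ.src (onE e) = onV (Γ.src e.1)
  inv_onE : ∀ e f : {e : Γ.E // e ∉ forest}, f.1 = Γ.inv e.1 → Δ.inv (onE e) = onE f

/-- The homomorphism of path groups induced by a collapse. -/
noncomputable def Collapse.map {Γ Δ : FinGraph} (c : Γ.Collapse Δ) :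
    Γ.PathGroup →* Δ.PathGroup := by
  classical
  exact Γ.lift (fun e => if h : e ∈ c.forest then 1 else Δ.edge (c.onE ⟨e, h⟩)) (by
    intro e
    have key : Γ.inv e ∈ c.forest ↔ e ∈ c.forest :=
      ⟨fun h => by simpa [Γ.inv_inv] using c.inv_mem _ h, c.inv_mem e⟩
    by_cases h : e ∈ c.forest
    · simp [h, c.inv_mem e h]
    · have h' : Γ.inv e ∉ c.forest := fun h' => h (key.1 h')
      rw [dif_neg h, dif_neg h', ← c.inv_onE ⟨e, h⟩ ⟨Γ.inv e, h'⟩ rfl, Δ.edge_mul_inv])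

end FinGraph

/-! ### Marked graphs and the spine of Outer space -/

/-- The free group of rank `n`, the fundamental group of the standard rose. -/
abbrev F (n : ℕ) : Type := FreeGroup (Fin n)

/-- A marked graph of rank `n` (all edges of length one): a finite connected graph without
separating edges and without vertices of valence less than three, together with a homotopy
equivalence from the standard rose, given as an isomorphism from `F n` onto the fundamental
group at some vertex. -/
structure MarkedGraph (n : ℕ) extends FinGraph where
  connected : ∀ v w, ∃ l, toFinGraph.IsPath v l w
  no_separating : ∀ e, ∃ l, (∀ f ∈ l, f ≠ e ∧ f ≠ inv e) ∧
    toFinGraph.IsPath (src e) l (toFinGraph.tgt e)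
  valence : ∀ v, 3 ≤ Nat.card {e // src e = v}
  base : V
  marking : F n ≃* toFinGraph.pi1 base

namespace MarkedGraph

variable {n : ℕ}

/-- Equivalence of marked graphs: an isomorphism which is compatible with the markings up to
free homotopy, the path `l` recording the motion of the base point. -/
def Equivalent (Γ Δ : MarkedGraph n) : Prop :=
  ∃ (h : Γ.toFinGraph.Iso Δ.toFinGraph) (l : List Δ.E),
    Δ.IsPath (h.onV Γ.base) l Δ.base ∧
    ∀ x, h.map (Γ.marking x) = Δ.word l * Δ.marking x * (Δ.word l)⁻¹

/-- `Δ` is obtained from `Γ` by collapsing a forest, and the marking of `Δ` is obtained from that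
of `Γ` by this operation (again up to free homotopy). -/
def CollapsesTo (Γ Δ : MarkedGraph n) : Prop :=
  ∃ (c : Γ.toFinGraph.Collapse Δ.toFinGraph) (l : List Δ.E),
    Δ.IsPath (c.onV Γ.base) l Δ.base ∧
    ∀ x, c.map (Γ.marking x) = Δ.word l * Δ.marking x * (Δ.word l)⁻¹

theorem Equivalent.refl (Γ : MarkedGraph n) : Γ.Equivalent Γ :=
  ⟨FinGraph.Iso.refl _, [], rfl, fun x => by simp [FinGraph.Iso.map_refl]⟩

theorem Equivalent.symm {Γ Δ : MarkedGraph n} (h : Γ.Equivalent Δ) : Δ.Equivalent Γ := by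
  obtain ⟨h, l, hl, hx⟩ := h
  obtain ⟨m, hm, hw⟩ := hl.exists_reverse
  refine ⟨h.symm, m.map h.symm.onE, ?_, fun x => ?_⟩
  · have := h.symm.isPath hm
    simpa [FinGraph.Iso.symm] using this
  · rw [h.symm.word_map, hw]
    have := congrArg h.symm.map (hx x)
    rw [h.map_symm_map] at this
    rw [this]
    simp only [map_mul, map_inv]
    group

theorem Equivalent.trans {Γ Δ Θ : MarkedGraph n} (h : Γ.Equivalent Δ) (k : Δ.Equivalent Θ) :
    Γ.Equivalent Θ := by
  obtain ⟨h, l, hl, hx⟩ := h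
  obtain ⟨k, m, hm, hy⟩ := k
  refine ⟨h.trans k, l.map k.onE ++ m, (k.isPath hl).append hm, fun x => ?_⟩
  rw [h.map_trans, hx, map_mul, map_mul, map_inv, hy, Θ.word_append, k.word_map]
  group

instance setoid (n : ℕ) : Setoid (MarkedGraph n) where
  r := Equivalent
  iseqv := ⟨Equivalent.refl, Equivalent.symm, Equivalent.trans⟩

/-- A rose: a graph with one vertex. -/
def IsRose (Γ : MarkedGraph n) : Prop := Subsingleton Γ.V

/-- Precomposition of the marking with an automorphism of the free group. -/
def act (Γ : MarkedGraph n) (φ : MulAut (F n)) : MarkedGraph n :=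
  { Γ with marking := φ.trans Γ.marking }

theorem act_equivalent {Γ Δ : MarkedGraph n} (h : Γ.Equivalent Δ) (φ : MulAut (F n)) :
    (Γ.act φ).Equivalent (Δ.act φ) := by
  obtain ⟨h, l, hl, hx⟩ := h
  exact ⟨h, l, hl, fun x => hx (φ x)⟩

theorem act_collapsesTo {Γ Δ : MarkedGraph n} (h : Γ.CollapsesTo Δ) (φ : MulAut (F n)) :
    (Γ.act φ).CollapsesTo (Δ.act φ) := by
  obtain ⟨c, l, hl, hx⟩ := h
  exact ⟨c, l, hl, fun x => hx (φ x)⟩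

theorem act_conj (Γ : MarkedGraph n) (w : F n) : (Γ.act (MulAut.conj w)).Equivalent Γ := by
  obtain ⟨l, hl, hw⟩ := (Γ.marking w).2
  refine ⟨FinGraph.Iso.refl _, l, hl, fun x => ?_⟩
  have h2 : (Γ.word l : Γ.PathGroup) = (Γ.marking w : Γ.PathGroup) := hw
  refine (FinGraph.Iso.map_refl (Γ := Γ.toFinGraph) (Γ.marking (w * x * w⁻¹))).trans ?_
  rw [h2]
  simp

/-- The label of the oriented edge `a`: the row vector `(a(g(x_1)), …, a(g(x_n)))`. -/
noncomputable def label (Γ : MarkedGraph n) (a : Γ.E) : Fin n → ℤ :=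
  fun i => Multiplicative.toAdd (Γ.count a (Γ.marking (FreeGroup.of i)))

/-- `M` is a marking matrix of the rose `Γ`: its rows are the labels of the edges of `Γ`, for some
enumeration `a` of the edges and some choice of orientations. -/
def IsMarkingMatrix (Γ : MarkedGraph n) (M : Matrix (Fin n) (Fin n) ℤ) : Prop :=
  ∃ a : Fin n → Γ.E,
    Function.Bijective (fun p : Fin n × Bool => if p.2 then a p.1 else Γ.inv (a p.1)) ∧
    ∀ i, M i = Γ.label (a i)

end MarkedGraph

instance normal_inner (G : Type*) [Group G] : (MulAut.conj (G := G)).range.Normal where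
  conj_mem := by
    rintro _ ⟨g, rfl⟩ φ
    exact ⟨φ g, by ext x; simp⟩

/-- The group `Out(F_n)`: automorphisms modulo inner automorphisms. -/
abbrev Out (n : ℕ) : Type := MulAut (F n) ⧸ (MulAut.conj (G := F n)).range

/-- The action of automorphisms on the abelianization. -/
def autAb (n : ℕ) : MulAut (F n) →* MulAut (Abelianization (F n)) where
  toFun φ := MulEquiv.abelianizationCongr φ
  map_one' := abelianizationCongr_refl
  map_mul' φ ψ := (abelianizationCongr_trans ψ φ).symm

/-- The natural homomorphism from `Out(F_n)` to the automorphism group of the abelianization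
of `F_n`, that is, to `GL_n(ℤ)`. -/
def outAb (n : ℕ) : Out n →* MulAut (Abelianization (F n)) :=
  QuotientGroup.lift _ (autAb n) (by
    rintro _ ⟨g, rfl⟩
    ext x
    obtain ⟨x, rfl⟩ := QuotientGroup.mk_surjective x
    change Abelianization.of (g * x * g⁻¹) = Abelianization.of x
    simp)

/-- The Torelli subgroup of `Out(F_n)`. -/
def Torelli (n : ℕ) : Subgroup (Out n) := (outAb n).ker

/-- The vertices of the spine: equivalence classes of marked graphs. -/
abbrev Vertex (n : ℕ) : Type 1 := Quotient (MarkedGraph.setoid n)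

namespace Vertex

variable {n : ℕ}

/-- The class `B` is obtained from the class `A` by collapsing a forest. -/
def CollapsesTo (A B : Vertex n) : Prop :=
  ∃ Γ Δ : MarkedGraph n, ⟦Γ⟧ = A ∧ ⟦Δ⟧ = B ∧ Γ.CollapsesTo Δ

/-- The right action of automorphisms on vertices, `(Γ, g) · φ = (Γ, g ∘ φ)`. -/
def actAut (A : Vertex n) (φ : MulAut (F n)) : Vertex n :=
  Quotient.map (fun Γ : MarkedGraph n => Γ.act φ) (fun _ _ h => MarkedGraph.act_equivalent h φ) A

/-- The right action of `Out(F_n)` on vertices. -/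
def act (A : Vertex n) (φ : Out n) : Vertex n :=
  Quotient.liftOn' φ (fun φ => A.actAut φ) (by
    intro φ ψ h
    obtain ⟨w, hw⟩ := QuotientGroup.leftRel_apply.1 h
    obtain rfl : ψ = φ * MulAut.conj w := by rw [hw]; group
    induction A using Quotient.inductionOn with
    | h Γ => exact (Quotient.sound ((Γ.act φ).act_conj w)).symm)

instance : MulAction (Out n)ᵐᵒᵖ (Vertex n) where
  smul φ A := A.act φ.unop
  one_smul A := by
    induction A using Quotient.inductionOn with
    | h Γ => rfl
  mul_smul φ ψ A := by
    induction φ using MulOpposite.rec' with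
    | _ φ =>
    induction ψ using MulOpposite.rec' with
    | _ ψ =>
    induction φ using QuotientGroup.induction_on with
    | H φ =>
    induction ψ using QuotientGroup.induction_on with
    | H ψ =>
    induction A using Quotient.inductionOn with
    | h Γ => rfl

theorem CollapsesTo.smul {A B : Vertex n} (h : A.CollapsesTo B) (φ : (Out n)ᵐᵒᵖ) :
    (φ • A).CollapsesTo (φ • B) := by
  obtain ⟨Γ, Δ, rfl, rfl, h⟩ := h
  induction φ using MulOpposite.rec' with
  | _ φ =>
  induction φ using QuotientGroup.induction_on with
  | H φ => exact ⟨Γ.act φ, Δ.act φ, rfl, rfl, MarkedGraph.act_collapsesTo h φ⟩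

end Vertex

/-- A set of vertices spans a simplex of the spine if it is totally ordered by forest collapse. -/
def IsSimplex {n : ℕ} (s : Set (Vertex n)) : Prop := IsChain Vertex.CollapsesTo s

/-- The spine of Outer space: the simplicial complex with these vertices and simplices, its
points being given by barycentric coordinates. -/
@[ext] structure Spine (n : ℕ) : Type 1 where
  coord : Vertex n →₀ ℝ
  nonneg : ∀ A, 0 ≤ coord A
  sum_eq_one : (coord.sum fun _ t => t) = 1
  isSimplex : IsSimplex (coord.support : Set (Vertex n))

namespace Spine

variable {n : ℕ}

/-- The closed simplex spanned by a finite set `s` of vertices. -/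
def closedSimplex (s : Finset (Vertex n)) : Set (Spine n) := {x | x.coord.support ⊆ s}

/-- The weak topology: a set is open if and only if its intersection with each closed
simplex is open in that simplex, which carries the topology of the barycentric coordinates. -/
instance : TopologicalSpace (Spine n) :=
  ⨆ s : {s : Finset (Vertex n) // IsSimplex (s : Set (Vertex n))},
    TopologicalSpace.coinduced (fun x : closedSimplex s.1 => x.1)
      (TopologicalSpace.induced (fun x A => x.1.coord A : closedSimplex s.1 → Vertex n → ℝ)
        inferInstance)

/-- A vertex, as a point of the spine. -/
noncomputable def ofVertex (A : Vertex n) : Spine n where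
  coord := Finsupp.single A 1
  nonneg B := by
    classical
    rw [Finsupp.single_apply]; split_ifs <;> norm_num
  sum_eq_one := by simp
  isSimplex := by
    classical
    have h : ((Finsupp.single A (1 : ℝ)).support : Set (Vertex n)) ⊆ {A} := by
      intro B hB
      have := Finsupp.support_single_subset (Finset.mem_coe.1 hB)
      simpa using this
    exact (Set.subsingleton_singleton.anti h).isChain

/-- The (simplicial) action of `Out(F_n)` on the spine. -/
noncomputable instance : MulAction (Out n)ᵐᵒᵖ (Spine n) where
  smul φ x :=
    { coord := Finsupp.equivMapDomain (MulAction.toPerm φ) x.coord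
      nonneg := fun A => x.nonneg _
      sum_eq_one := by rw [Finsupp.sum_equivMapDomain]; exact x.sum_eq_one
      isSimplex := by
        intro A hA B hB hne
        have hA' : φ⁻¹ • A ∈ (x.coord.support : Set (Vertex n)) := by
          simpa [Finsupp.equivMapDomain_apply] using hA
        have hB' : φ⁻¹ • B ∈ (x.coord.support : Set (Vertex n)) := by
          simpa [Finsupp.equivMapDomain_apply] using hB
        have := x.isSimplex hA' hB' (fun h => hne (MulAction.injective _ h))
        rcases this with h | h
        · left; simpa using h.smul φ
        · right; simpa using h.smul φ }
  one_smul x := by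
    apply Spine.ext
    ext A
    change x.coord ((MulAction.toPerm (1 : (Out n)ᵐᵒᵖ)).symm A) = x.coord A
    simp
  mul_smul φ ψ x := by
    apply Spine.ext
    ext A
    change x.coord ((MulAction.toPerm (φ * ψ)).symm A) =
      x.coord ((MulAction.toPerm ψ).symm ((MulAction.toPerm φ).symm A))
    simp [mul_smul]

/-- The star of a vertex `A` of the spine: the union of the closed simplices containing `A`. -/
def star (A : Vertex n) : Set (Spine n) :=
  ⋃ (s : Finset (Vertex n)) (_ : IsSimplex (s : Set (Vertex n))) (_ : A ∈ s), closedSimplex s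

end Spine

/-! ### The quotient by the Torelli group -/

/-- The quotient of the spine of Outer space by the Torelli group, with the quotient topology. -/
abbrev Y (n : ℕ) : Type 1 := MulAction.orbitRel.Quotient (Torelli n).op (Spine n)

/-- The projection from the spine. -/
noncomputable def Y.mk {n : ℕ} (x : Spine n) : Y n := Quotient.mk _ x

/-- The point of the quotient represented by a marked graph. -/
noncomputable def Y.ofGraph {n : ℕ} (Γ : MarkedGraph n) : Y n := Y.mk (Spine.ofVertex ⟦Γ⟧)

/-- The norm of a vector: its entries in absolute value, in lexicographic order. -/
def vecNorm {n : ℕ} (v : Fin n → ℤ) : Lex (Fin n → ℕ) := toLex fun j => (v j).natAbs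

/-- The norm `(|v_n|, …, |v_1|)` of a matrix with rows `v_1, …, v_n`, in lexicographic order. -/
def matNorm {n : ℕ} (M : Matrix (Fin n) (Fin n) ℤ) : Lex (Fin n → Lex (Fin n → ℕ)) :=
  toLex fun i => vecNorm (M i.rev)

/-- `M` is a standard representative: `|v_n| < ⋯ < |v_1|`. -/
def IsStandard {n : ℕ} (M : Matrix (Fin n) (Fin n) ℤ) : Prop :=
  StrictAnti fun i => vecNorm (M i)

/-- A rose in `Y n`. -/
structure Rose (n : ℕ) : Type 1 where
  point : Y n
  isRose : ∃ Γ : MarkedGraph n, Γ.IsRose ∧ Y.ofGraph Γ = point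

namespace Rose

variable {n : ℕ}

/-- `N` is the norm of the rose `ρ`: the norm of a marking matrix of `ρ` that is a standard
representative. -/
def HasNorm (ρ : Rose n) (N : Lex (Fin n → Lex (Fin n → ℕ))) : Prop :=
  ∃ (Γ : MarkedGraph n) (M : Matrix (Fin n) (Fin n) ℤ), Γ.IsRose ∧ Y.ofGraph Γ = ρ.point ∧
    Γ.IsMarkingMatrix M ∧ IsStandard M ∧ matNorm M = N

/-- The rose `σ` has strictly smaller norm than the rose `ρ`. -/
def NormLT (σ ρ : Rose n) : Prop := ∃ N N', σ.HasNorm N ∧ ρ.HasNorm N' ∧ N < N'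

/-- The star of a rose in `Y n`: the image of the star of a rose in the spine. -/
def star (ρ : Rose n) : Set (Y n) :=
  ⋃ (Γ : MarkedGraph n) (_ : Γ.IsRose ∧ Y.ofGraph Γ = ρ.point), Y.mk '' Spine.star ⟦Γ⟧

/-- The descending link of a rose: the intersection of its star with the union of the stars
of all roses of strictly smaller norm. -/
def descendingLink (ρ : Rose n) : Set (Y n) := ρ.star ∩ ⋃ (σ : Rose n) (_ : σ.NormLT ρ), σ.star

end Rose

/-! ### The rose with the identity marking -/

/-- The standard rose, with oriented edges `(i, true)` and their inverses `(i, false)`. -/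
abbrev stdGraph (n : ℕ) : FinGraph where
  V := Unit
  E := Fin n × Bool
  finite_V := inferInstance
  finite_E := inferInstance
  src _ := ()
  inv e := (e.1, !e.2)
  inv_inv e := by simp
  inv_ne e h := by simpa using congrArg Prod.snd h

theorem stdGraph_isPath (n : ℕ) (l : List (stdGraph n).E) :
    (stdGraph n).IsPath () l () := by
  induction l with
  | nil => rfl
  | cons e l ih => exact ⟨rfl, ih⟩

/-- The path group of the standard rose is the free group on the `x_i`. -/
def stdPathEquiv (n : ℕ) : F n ≃* (stdGraph n).PathGroup :=
  MonoidHom.toMulEquiv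
    (FreeGroup.lift fun i => (stdGraph n).edge (i, true))
    ((stdGraph n).lift
      (fun e : Fin n × Bool => if e.2 then FreeGroup.of e.1 else (FreeGroup.of e.1)⁻¹)
      (by rintro ⟨i, b⟩; cases b <;> simp))
    (by
      ext i
      have h := (stdGraph n).lift_edge
        (fun e : Fin n × Bool => if e.2 then FreeGroup.of e.1 else (FreeGroup.of e.1)⁻¹)
        (by rintro ⟨i, b⟩; cases b <;> simp) (i, true)
      simp [h])
    (by
      apply (stdGraph n).hom_ext
      rintro ⟨i, b⟩
      rw [MonoidHom.comp_apply, FinGraph.lift_edge]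
      cases b
      · have h : (stdGraph n).edge (i, false) = ((stdGraph n).edge (i, true))⁻¹ :=
          (stdGraph n).edge_inv (i, true)
        simp [h]
      · simp)

theorem stdGraph_pi1 (n : ℕ) : (stdGraph n).pi1 () = ⊤ := by
  rw [eq_top_iff]
  intro x _
  obtain ⟨x, rfl⟩ := (stdPathEquiv n).surjective x
  induction x using FreeGroup.induction_on with
  | C1 => rw [map_one]; exact one_mem _
  | of i =>
    refine ⟨[(i, true)], stdGraph_isPath n _, ?_⟩
    rw [FinGraph.word_cons, FinGraph.word_nil, mul_one]
    simp [stdPathEquiv]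
  | inv_of i h => rw [map_inv]; exact inv_mem (h trivial)
  | mul x y hx hy => rw [map_mul]; exact mul_mem (hx trivial) (hy trivial)

/-- The standard rose with the identity marking. -/
def idGraph (n : ℕ) (hn : 2 ≤ n) : MarkedGraph n where
  toFinGraph := stdGraph n
  connected _ _ := ⟨[], rfl⟩
  no_separating _ := ⟨[], by simp, rfl⟩
  valence v := by
    have h : Nat.card {e : (stdGraph n).E // (stdGraph n).src e = v} = n * 2 := by
      have : Nat.card {e : Fin n × Bool // (() : Unit) = v} = n * 2 := by
        cases v; simp
      exact this
    rw [h]; omega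
  base := ()
  marking := (stdPathEquiv n).trans
    (Subgroup.topEquiv.symm.trans (MulEquiv.subgroupCongr (stdGraph_pi1 n).symm))

/-- The rose in `Y n` with the identity marking. -/
noncomputable def idRose (n : ℕ) (hn : 2 ≤ n) : Rose n where
  point := Y.ofGraph (idGraph n hn)
  isRose := ⟨idGraph n hn, (inferInstance : Subsingleton Unit), rfl⟩

end TorelliSpine

/-! The question is lifted to the spine. For a rose Γ representing the given point,
`Spine.descending Γ` consists of the points whose vertices all collapse to Γ and to one common rose
of smaller norm. Labels depend only on homology, so norms are Torelli invariant, and moving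
representatives by Torelli elements shows that the descending link is the image of this set
(`Rose.descendingLink_eq`). It remains to connect the set upstairs and to decide when it is empty.

A forest edge of a graph collapsing to Γ cuts the oriented petals of Γ into a set α and its
complement, and by conservation of flow its label is the sum of the labels over α
(`Collapse.cnt_eq_sum_cut`). The set α is descending if this sum has smaller norm than some petal
with exactly one end in α. Collapsing that petal instead of the new edge yields a rose of smaller
norm (`IsDescending.exists_normLT`). Conversely, by linear independence of the rows of a marking
matrix, a graph collapsing to Γ and to a smaller rose has a descending forest edge
(`exists_isDescending_cut`). Hence each point of the descending set is joined to the one-edge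
blow-up of some descending α, and the blow-ups of two disjoint descending sets are joined, since
they coincide or have a common blow-up with two edges.

The rest concerns integer matrices. Petals with both ends in α contribute nothing, so α may be
replaced by a sign vector ε on the petals. Two descending sign vectors ε, δ are joined unless the
products ε_i δ_i take both values 1 and -1 (`Spine.joined_signSet`). A pair of rows p, σq is
opposite if the rows have opposite signs in the later of their two leading columns. The rows p, q
determine σ (`IsOpposite.sign_unique`), so any two opposite pairs are compatible in this sense. By
`exists_opposite`, every descending sign vector is compatible with a descending opposite pair, and
connectedness follows.

If nothing descends, no opposite pair does, which forces a signed permutation matrix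
(`exists_row_eq_single`), and a rose with such labels differs from the identity rose by a Torelli
element. For the identity rose the sum of labels is ε itself, whose norm cannot lie below that of a
basis vector in the support of ε. -/

namespace TorelliSpine

/-! ### Signed edge counts, path surgery and composition of collapses. -/

namespace FinGraph

instance (Γ : FinGraph) : Finite Γ.E := Γ.finite_E

theorem tgt_inv (Γ : FinGraph) (e : Γ.E) : Γ.tgt (Γ.inv e) = Γ.src e := by
  rw [tgt, Γ.inv_inv]

theorem inv_injective (Γ : FinGraph) : Function.Injective Γ.inv :=
  Function.LeftInverse.injective Γ.inv_inv

theorem inv_eq_comm (Γ : FinGraph) {e f : Γ.E} : Γ.inv e = f ↔ e = Γ.inv f :=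
  ⟨fun h => by rw [← h, Γ.inv_inv], fun h => by rw [h, Γ.inv_inv]⟩

/-- The signed number of passages over `a`, as an integer. -/
noncomputable def cnt (Γ : FinGraph) (a : Γ.E) (x : Γ.PathGroup) : ℤ :=
  Multiplicative.toAdd (Γ.count a x)

theorem cnt_one (Γ : FinGraph) (a : Γ.E) : Γ.cnt a 1 = 0 := by simp [cnt]

theorem cnt_mul (Γ : FinGraph) (a : Γ.E) (x y : Γ.PathGroup) :
    Γ.cnt a (x * y) = Γ.cnt a x + Γ.cnt a y := by simp [cnt]

theorem cnt_inv (Γ : FinGraph) (a : Γ.E) (x : Γ.PathGroup) :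
    Γ.cnt a x⁻¹ = - Γ.cnt a x := by simp [cnt]

theorem cnt_conj (Γ : FinGraph) (a : Γ.E) (x y : Γ.PathGroup) :
    Γ.cnt a (x * y * x⁻¹) = Γ.cnt a y := by simp [cnt_mul, cnt_inv]

open Classical in
theorem cnt_edge (Γ : FinGraph) (a e : Γ.E) :
    Γ.cnt a (Γ.edge e) = (if e = a then 1 else 0) - (if e = Γ.inv a then 1 else 0) := by
  rw [cnt, count, lift_edge]
  have := Γ.inv_ne a
  by_cases h : e = a
  · subst h; simp [this.symm]
  · simp only [h, if_false]; split_ifs <;> simp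

/-- Additive functions are homomorphisms to `Multiplicative ℤ`, and the edges generate the path
group. Identities between counts can thus be checked on single edges. -/
theorem hom_eq_of_edge (Γ : FinGraph) {f g : Γ.PathGroup → ℤ}
    (hf : ∀ x y, f (x * y) = f x + f y) (hg : ∀ x y, g (x * y) = g x + g y)
    (h : ∀ e, f (Γ.edge e) = g (Γ.edge e)) (x : Γ.PathGroup) : f x = g x := by
  have h1 : ∀ f : Γ.PathGroup → ℤ, (∀ x y, f (x * y) = f x + f y) → f 1 = 0 := by
    intro f hf
    have := hf 1 1
    rw [mul_one] at this; omega
  let F : Γ.PathGroup →* Multiplicative ℤ :=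
    ⟨⟨fun x => Multiplicative.ofAdd (f x), by simp [h1 f hf]⟩, fun x y => by simp [hf]⟩
  let G : Γ.PathGroup →* Multiplicative ℤ :=
    ⟨⟨fun x => Multiplicative.ofAdd (g x), by simp [h1 g hg]⟩, fun x y => by simp [hg]⟩
  have : F = G := Γ.hom_ext fun e => by
    change Multiplicative.ofAdd (f _) = Multiplicative.ofAdd (g _)
    rw [h]
  exact Multiplicative.ofAdd.injective (DFunLike.congr_fun this x)

theorem cnt_inv_left (Γ : FinGraph) (a : Γ.E) (x : Γ.PathGroup) :
    Γ.cnt (Γ.inv a) x = - Γ.cnt a x := by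
  classical
  refine Γ.hom_eq_of_edge (f := Γ.cnt (Γ.inv a)) (g := fun x => - Γ.cnt a x)
    (Γ.cnt_mul _) (fun x y => by rw [cnt_mul]; ring) (fun e => ?_) x
  rw [cnt_edge, cnt_edge, Γ.inv_inv]; ring

-- Kirchhoff's law: each passage through `u` enters and leaves once, so the net flow out of `u`
-- comes only from the endpoints of the path.
open Classical in
theorem sum_cnt_of_isPath (Γ : FinGraph) [Fintype Γ.E] (u : Γ.V) {l : List Γ.E} {v w : Γ.V}
    (hl : Γ.IsPath v l w) :
    ∑ e : Γ.E, (if Γ.src e = u then Γ.cnt e (Γ.word l) else 0) =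
      (if v = u then 1 else 0) - (if w = u then 1 else 0) := by
  induction l generalizing v with
  | nil => cases hl; simp [cnt_one]
  | cons f l ih =>
    have := ih hl.2
    have key : ∀ e : Γ.E, (if Γ.src e = u then Γ.cnt e (Γ.word (f :: l)) else 0) =
        ((if f = e then (if Γ.src e = u then 1 else 0) else 0)
        - (if Γ.inv f = e then (if Γ.src e = u then 1 else 0) else 0))
        + (if Γ.src e = u then Γ.cnt e (Γ.word l) else 0) := by
      intro e
      rw [word_cons, cnt_mul, cnt_edge, ← Γ.inv_eq_comm]
      split_ifs <;> simp
    rw [Finset.sum_congr rfl fun e _ => key e, Finset.sum_add_distrib, this,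
      Finset.sum_sub_distrib, Finset.sum_ite_eq, Finset.sum_ite_eq]
    have h1 : Γ.src (Γ.inv f) = Γ.tgt f := rfl
    simp [hl.1, h1]

/-- Prepending an edge to a reduced path either keeps it reduced or cancels its first edge; no new
edges are introduced, so `P` survives. -/
theorem exists_isReduced (Γ : FinGraph) {P : Γ.E → Prop} {l : List Γ.E} {v w : Γ.V}
    (hP : ∀ e ∈ l, P e) (hl : Γ.IsPath v l w) :
    ∃ m, (∀ e ∈ m, P e) ∧ Γ.IsReduced m ∧ Γ.IsPath v m w := by
  induction l generalizing v with
  | nil => exact ⟨[], by simp, by simp [IsReduced], hl⟩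
  | cons e l ih =>
    obtain ⟨m, hm, hr, hp⟩ := ih (fun f hf => hP f (by simp [hf])) hl.2
    cases m with
    | nil => exact ⟨[e], by simpa using hP e (by simp), by simp [IsReduced], hl.1, hp⟩
    | cons f m =>
      by_cases hf : f = Γ.inv e
      · refine ⟨m, fun x hx => hm x (by simp [hx]), (List.isChain_cons.1 hr).2, ?_⟩
        have := hp.2
        rwa [hf, Γ.tgt_inv, hl.1] at this
      · refine ⟨e :: f :: m, ?_, ?_, hl.1, hp⟩
        · intro x hx
          rcases List.mem_cons.1 hx with rfl | hx
          · exact hP _ (by simp)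
          · exact hm x hx
        · exact List.isChain_cons_cons.2 ⟨hf, hr⟩

theorem IsPath.append_iff {Γ : FinGraph} {l m : List Γ.E} {u w : Γ.V} :
    Γ.IsPath u (l ++ m) w ↔ ∃ v, Γ.IsPath u l v ∧ Γ.IsPath v m w := by
  refine ⟨fun h => ?_, fun ⟨v, h1, h2⟩ => h1.append h2⟩
  induction l generalizing u with
  | nil => exact ⟨u, rfl, h⟩
  | cons e l ih =>
    obtain ⟨v, h1, h2⟩ := ih h.2
    exact ⟨v, ⟨h.1, h1⟩, h2⟩

theorem IsPath.exists_reverse_of_inv_mem {Γ : FinGraph} {F : Set Γ.E}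
    (hF : ∀ e ∈ F, Γ.inv e ∈ F) {l : List Γ.E} {v w : Γ.V}
    (hl : Γ.IsPath v l w) (h : ∀ e ∈ l, e ∈ F) :
    ∃ m, (∀ e ∈ m, e ∈ F) ∧ Γ.IsPath w m v := by
  induction l generalizing v with
  | nil => cases hl; exact ⟨[], by simp, rfl⟩
  | cons e l ih =>
    obtain ⟨m, hm, hw⟩ := ih hl.2 fun f hf => h f (by simp [hf])
    refine ⟨m ++ [Γ.inv e], ?_, hw.append ⟨rfl, ?_⟩⟩
    · intro x hx
      rcases List.mem_append.1 hx with hx | hx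
      · exact hm x hx
      · rw [List.mem_singleton.1 hx]; exact hF _ (h e (by simp))
    · rw [← hl.1]; exact Γ.tgt_inv e

/-- An isomorphism, as the collapse of the empty forest. -/
def Iso.toCollapse {Γ Δ : FinGraph} (h : Γ.Iso Δ) : Γ.Collapse Δ where
  forest := ∅
  inv_mem := by simp
  isForest v l hl _ _ := List.eq_nil_iff_forall_not_mem.2 fun e he => hl e he
  onV := h.onV
  onE := (Equiv.subtypeUnivEquiv (by simp)).trans h.onE
  onV_surjective := h.onV.surjective
  onV_eq_iff v w := by
    rw [h.onV.injective.eq_iff]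
    constructor
    · rintro rfl; exact ⟨[], by simp, rfl⟩
    · rintro ⟨l, hl, hp⟩
      obtain rfl : l = [] := List.eq_nil_iff_forall_not_mem.2 fun e he => hl e he
      exact hp
  src_onE e := h.src_onE _
  inv_onE e f hf := by
    change Δ.inv (h.onE e.1) = h.onE f.1
    rw [hf, h.inv_onE]

namespace Collapse

variable {Γ Δ Θ : FinGraph}

theorem map_edge_of_mem (c : Γ.Collapse Δ) {e : Γ.E} (h : e ∈ c.forest) :
    c.map (Γ.edge e) = 1 := by
  rw [map, lift_edge, dif_pos h]

theorem map_edge (c : Γ.Collapse Δ) (e : {e : Γ.E // e ∉ c.forest}) :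
    c.map (Γ.edge e.1) = Δ.edge (c.onE e) := by
  rw [map, lift_edge, dif_neg e.2]

theorem inv_mem_iff (c : Γ.Collapse Δ) {e : Γ.E} : Γ.inv e ∈ c.forest ↔ e ∈ c.forest :=
  ⟨fun h => by simpa [Γ.inv_inv] using c.inv_mem _ h, c.inv_mem e⟩

theorem onV_src_eq_tgt (c : Γ.Collapse Δ) {e : Γ.E} (h : e ∈ c.forest) :
    c.onV (Γ.src e) = c.onV (Γ.tgt e) :=
  (c.onV_eq_iff _ _).2 ⟨[e], by simpa using h, rfl, rfl⟩

theorem inv_onE' (c : Γ.Collapse Δ) (e : {e : Γ.E // e ∉ c.forest}) :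
    Δ.inv (c.onE e) = c.onE ⟨Γ.inv e.1, fun h => e.2 (c.inv_mem_iff.1 h)⟩ :=
  c.inv_onE _ _ rfl

theorem tgt_onE (c : Γ.Collapse Δ) (e : {e : Γ.E // e ∉ c.forest}) :
    Δ.tgt (c.onE e) = c.onV (Γ.tgt e.1) := by
  rw [tgt, inv_onE', c.src_onE]; rfl

theorem exists_path (c : Γ.Collapse Δ) {l : List Γ.E} {v w : Γ.V} (hl : Γ.IsPath v l w) :
    ∃ m, Δ.IsPath (c.onV v) m (c.onV w) ∧ Δ.word m = c.map (Γ.word l) := by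
  induction l generalizing v with
  | nil => cases hl; exact ⟨[], rfl, by simp⟩
  | cons e l ih =>
    obtain ⟨m, hm, hw⟩ := ih hl.2
    by_cases he : e ∈ c.forest
    · refine ⟨m, ?_, ?_⟩
      · rw [← hl.1, c.onV_src_eq_tgt he]; exact hm
      · rw [hw, word_cons, map_mul, c.map_edge_of_mem he, one_mul]
    · refine ⟨c.onE ⟨e, he⟩ :: m, ⟨?_, ?_⟩, ?_⟩
      · rw [c.src_onE, ← hl.1]
      · rw [c.tgt_onE]; exact hm
      · rw [word_cons, word_cons, map_mul, hw, ← c.map_edge]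

/-- A collapse erases forest edges and relabels the others bijectively. Consequently surviving edges
keep their labels. -/
theorem cnt_map (c : Γ.Collapse Δ) (e : {e : Γ.E // e ∉ c.forest}) (x : Γ.PathGroup) :
    Δ.cnt (c.onE e) (c.map x) = Γ.cnt e.1 x := by
  classical
  refine Γ.hom_eq_of_edge (f := fun x => Δ.cnt (c.onE e) (c.map x)) (g := Γ.cnt e.1)
    (fun x y => by simp only [map_mul, cnt_mul]) (Γ.cnt_mul _) (fun f => ?_) x
  by_cases hf : f ∈ c.forest
  · rw [c.map_edge_of_mem hf, cnt_one, cnt_edge, if_neg, if_neg, sub_zero]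
    · rintro rfl; exact e.2 (c.inv_mem_iff.1 hf)
    · rintro rfl; exact e.2 hf
  · rw [c.map_edge ⟨f, hf⟩, cnt_edge, cnt_edge, c.inv_onE', c.onE.injective.eq_iff,
      c.onE.injective.eq_iff, Subtype.ext_iff, Subtype.ext_iff]

/-- The forest of a composition of collapses. -/
def compForest (c : Γ.Collapse Δ) (d : Δ.Collapse Θ) : Set Γ.E :=
  {e | ∀ h : e ∉ c.forest, c.onE ⟨e, h⟩ ∈ d.forest}

theorem mem_compForest_of_mem (c : Γ.Collapse Δ) (d : Δ.Collapse Θ) {e : Γ.E}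
    (h : e ∈ c.forest) : e ∈ c.compForest d := fun h' => absurd h h'

/-- This is what makes the composed forest a forest: a backtrack in the image could only come from
an edge and its inverse separated by a closed reduced path in a forest. The last clause, locating
the first surviving edge of the path, is there to carry the induction. -/
theorem exists_reduced_image (c : Γ.Collapse Δ) (d : Δ.Collapse Θ) {l : List Γ.E} {v w : Γ.V}
    (hl : Γ.IsPath v l w) (hr : Γ.IsReduced l) (hF : ∀ e ∈ l, e ∈ c.compForest d) :
    ∃ m, Δ.IsPath (c.onV v) m (c.onV w) ∧ Δ.IsReduced m ∧ (∀ e ∈ m, e ∈ d.forest) ∧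
      (m = [] → ∀ e ∈ l, e ∈ c.forest) ∧
      ∀ f m', m = f :: m' → ∃ l₁ l₂ f', l = l₁ ++ f'.1 :: l₂ ∧ c.onE f' = f ∧
        ∀ e ∈ l₁, e ∈ c.forest := by
  induction l generalizing v with
  | nil => cases hl; exact ⟨[], rfl, by simp [IsReduced], by simp, by simp, by simp⟩
  | cons e l ih =>
    have hr' : Γ.IsReduced l := (List.isChain_cons.1 hr).2
    obtain ⟨m, hm, hmr, hmF, hnil, hcons⟩ := ih hl.2 hr' fun f hf => hF f (by simp [hf])
    by_cases he : e ∈ c.forest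
    · refine ⟨m, ?_, hmr, hmF, ?_, ?_⟩
      · rw [← hl.1, c.onV_src_eq_tgt he]; exact hm
      · intro h x hx
        rcases List.mem_cons.1 hx with rfl | hx
        · exact he
        · exact hnil h x hx
      · intro f m' h
        obtain ⟨l₁, l₂, f', h1, h2, h3⟩ := hcons f m' h
        refine ⟨e :: l₁, l₂, f', by rw [h1]; rfl, h2, ?_⟩
        intro x hx
        rcases List.mem_cons.1 hx with rfl | hx
        · exact he
        · exact h3 x hx
    · refine ⟨c.onE ⟨e, he⟩ :: m, ⟨?_, ?_⟩, ?_, ?_, by simp, ?_⟩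
      · rw [c.src_onE, ← hl.1]
      · rw [c.tgt_onE]; exact hm
      · cases m with
        | nil => simp [IsReduced]
        | cons f m' =>
          refine List.isChain_cons_cons.2 ⟨?_, hmr⟩
          intro hf
          obtain ⟨l₁, l₂, f', h1, h2, h3⟩ := hcons f m' rfl
          rw [← h2, c.inv_onE', c.onE.injective.eq_iff] at hf
          have hf' : f'.1 = Γ.inv e := congrArg Subtype.val hf
          have hp := hl.2
          rw [h1, IsPath.append_iff] at hp
          obtain ⟨u, hp1, hp2, -⟩ := hp
          rw [hf'] at hp2
          have hp2' : Γ.tgt e = u := hp2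
          rw [← hp2'] at hp1
          -- The erased stretch between `e` and its inverse is closed at `tgt e`, reduced and inside
          -- the forest, so it is empty and `l` would backtrack.
          have hl1 : l₁ = [] := by
            refine c.isForest _ _ h3 ?_ hp1
            rw [h1] at hr'
            exact (List.isChain_append.1 hr').1
          rw [h1, hl1, hf'] at hr
          exact (List.isChain_cons_cons.1 hr).1 rfl
      · intro x hx
        rcases List.mem_cons.1 hx with rfl | hx
        · exact hF e (by simp) he
        · exact hmF x hx
      · intro f m' h
        refine ⟨[], l, ⟨e, he⟩, rfl, ?_, by simp⟩
        exact (List.cons.inj h).1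

/-- Each edge lifts uniquely; ends of consecutive lifts have the same image, so the gaps are bridged
inside the forest of `c`. -/
theorem exists_lift_path (c : Γ.Collapse Δ) (d : Δ.Collapse Θ) {m : List Δ.E} {a b : Δ.V}
    (hm : Δ.IsPath a m b) (hF : ∀ e ∈ m, e ∈ d.forest) (v w : Γ.V) (hv : c.onV v = a)
    (hw : c.onV w = b) : ∃ l, (∀ e ∈ l, e ∈ c.compForest d) ∧ Γ.IsPath v l w := by
  induction m generalizing a v with
  | nil =>
    cases hm
    obtain ⟨l, hl, hp⟩ := (c.onV_eq_iff v w).1 (hv.trans hw.symm)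
    exact ⟨l, fun e he => c.mem_compForest_of_mem d (hl e he), hp⟩
  | cons e m ih =>
    obtain ⟨e', rfl⟩ := c.onE.surjective e
    obtain ⟨l, hl, hp⟩ := ih hm.2 (fun f hf => hF f (by simp [hf])) (Γ.tgt e'.1)
      (c.tgt_onE e').symm
    have h1 := hm.1
    rw [c.src_onE, ← hv] at h1
    obtain ⟨k, hk, hkp⟩ := (c.onV_eq_iff _ _).1 h1.symm
    refine ⟨k ++ e'.1 :: l, ?_, hkp.append ⟨rfl, hp⟩⟩
    intro x hx
    rcases List.mem_append.1 hx with hx | hx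
    · exact c.mem_compForest_of_mem d (hk x hx)
    rcases List.mem_cons.1 hx with rfl | hx
    · exact fun _ => hF _ (by simp)
    · exact hl x hx

/-- The action of a composition of collapses on edges. -/
def compOnE (c : Γ.Collapse Δ) (d : Δ.Collapse Θ) (e : {e : Γ.E // e ∉ c.compForest d}) : Θ.E :=
  d.onE ⟨c.onE ⟨e.1, fun h => e.2 (c.mem_compForest_of_mem d h)⟩, fun h => e.2 fun _ => h⟩

theorem compOnE_bijective (c : Γ.Collapse Δ) (d : Δ.Collapse Θ) :
    Function.Bijective (c.compOnE d) := by
  constructor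
  · intro e f h
    have h1 := congrArg Subtype.val (d.onE.injective h)
    have h2 := congrArg Subtype.val (c.onE.injective h1)
    exact Subtype.ext h2
  · intro f
    obtain ⟨⟨e, he⟩, rfl⟩ := d.onE.surjective f
    obtain ⟨e', rfl⟩ := c.onE.surjective e
    exact ⟨⟨e'.1, fun h => he (h e'.2)⟩, rfl⟩

/-- The composition of two collapses. -/
noncomputable def trans (c : Γ.Collapse Δ) (d : Δ.Collapse Θ) : Γ.Collapse Θ where
  forest := c.compForest d
  inv_mem e he h := by
    have h' : e ∉ c.forest := fun h'' => h (c.inv_mem _ h'')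
    have := d.inv_mem _ (he h')
    rwa [c.inv_onE'] at this
  isForest v l hF hr hl := by
    obtain ⟨m, hm, hmr, hmF, hnil, -⟩ := c.exists_reduced_image d hl hr hF
    exact c.isForest v l (hnil (d.isForest _ _ hmF hmr hm)) hr hl
  onV := d.onV ∘ c.onV
  onE := Equiv.ofBijective (c.compOnE d) (c.compOnE_bijective d)
  onV_surjective := d.onV_surjective.comp c.onV_surjective
  onV_eq_iff v w := by
    constructor
    · intro h
      obtain ⟨m, hm, hp⟩ := (d.onV_eq_iff _ _).1 h
      exact c.exists_lift_path d hp hm v w rfl rfl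
    · rintro ⟨l, hl, hp⟩
      induction l generalizing v with
      | nil => cases hp; rfl
      | cons e l ih =>
        have h2 := ih (Γ.tgt e) (fun f hf => hl f (by simp [hf])) hp.2
        refine Eq.trans ?_ h2
        rw [← hp.1]
        by_cases he : e ∈ c.forest
        · exact congrArg d.onV (c.onV_src_eq_tgt he)
        · have := d.onV_src_eq_tgt (hl e (by simp) he)
          rwa [c.src_onE, c.tgt_onE] at this
  src_onE e := (d.src_onE _).trans (congrArg d.onV (c.src_onE _))
  inv_onE e f h := d.inv_onE _ _ (c.inv_onE _ _ h).symm

theorem trans_map (c : Γ.Collapse Δ) (d : Δ.Collapse Θ) (x : Γ.PathGroup) :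
    (c.trans d).map x = d.map (c.map x) := by
  have : (c.trans d).map = d.map.comp c.map := by
    refine Γ.hom_ext fun e => ?_
    rw [MonoidHom.comp_apply]
    by_cases he : e ∈ c.forest
    · rw [c.map_edge_of_mem he, map_one, map_edge_of_mem]
      exact c.mem_compForest_of_mem d he
    · rw [c.map_edge ⟨e, he⟩]
      by_cases hd : c.onE ⟨e, he⟩ ∈ d.forest
      · rw [d.map_edge_of_mem hd, map_edge_of_mem]
        exact fun _ => hd
      · rw [d.map_edge ⟨_, hd⟩]
        exact (c.trans d).map_edge ⟨e, fun h => hd (h he)⟩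
  rw [this]; rfl

end Collapse

theorem Iso.toCollapse_map {Γ Δ : FinGraph} (h : Γ.Iso Δ) (x : Γ.PathGroup) :
    h.toCollapse.map x = h.map x := by
  have : h.toCollapse.map = h.map := by
    refine Γ.hom_ext fun e => ?_
    have h1 : e ∉ h.toCollapse.forest := fun h => h
    rw [h.toCollapse.map_edge ⟨e, h1⟩, Iso.map, lift_edge]
    rfl
  rw [this]

/-- A collapse of the empty forest, as an isomorphism. -/
noncomputable def Collapse.toIso {Γ Δ : FinGraph} (c : Γ.Collapse Δ) (hc : c.forest = ∅) :
    Γ.Iso Δ where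
  onV := Equiv.ofBijective c.onV ⟨fun v w h => by
    obtain ⟨l, hl, hp⟩ := (c.onV_eq_iff v w).1 h
    obtain rfl : l = [] := List.eq_nil_iff_forall_not_mem.2 fun e he => by
      have := hl e he; rw [hc] at this; exact this
    exact hp, c.onV_surjective⟩
  onE := (Equiv.subtypeUnivEquiv (by simp [hc])).symm.trans c.onE
  src_onE e := c.src_onE _
  inv_onE e := c.inv_onE _ _ rfl

theorem Collapse.toIso_map {Γ Δ : FinGraph} (c : Γ.Collapse Δ) (hc : c.forest = ∅)
    (x : Γ.PathGroup) : (c.toIso hc).map x = c.map x := by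
  have : (c.toIso hc).map = c.map := by
    refine Γ.hom_ext fun e => ?_
    have h1 : e ∉ c.forest := by simp [hc]
    rw [c.map_edge ⟨e, h1⟩, Iso.map, lift_edge]
    rfl
  rw [this]

theorem IsForest.src_ne_tgt {Γ : FinGraph} {F : Set Γ.E} (hF : Γ.IsForest F) {e : Γ.E}
    (he : e ∈ F) : Γ.src e ≠ Γ.tgt e := fun h => by
  have := hF (Γ.src e) [e] (by simpa using he) (by simp [IsReduced]) ⟨rfl, h.symm⟩
  simp at this

end FinGraph

/-! ### The collapse relation on marked graphs and on vertices of the spine. -/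

namespace MarkedGraph

variable {n : ℕ}

theorem CollapsesTo.trans {Γ Δ Θ : MarkedGraph n} (h : Γ.CollapsesTo Δ) (k : Δ.CollapsesTo Θ) :
    Γ.CollapsesTo Θ := by
  obtain ⟨c, l, hl, hx⟩ := h
  obtain ⟨d, m, hm, hy⟩ := k
  obtain ⟨l', hl', hw⟩ := d.exists_path hl
  refine ⟨c.trans d, l' ++ m, hl'.append hm, fun x => ?_⟩
  rw [c.trans_map, hx, map_mul, map_mul, map_inv, hy, Θ.word_append, hw]
  group

theorem Equivalent.collapsesTo {Γ Δ : MarkedGraph n} (h : Γ.Equivalent Δ) : Γ.CollapsesTo Δ := by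
  obtain ⟨h, l, hl, hx⟩ := h
  exact ⟨h.toCollapse, l, hl, fun x => by rw [h.toCollapse_map, hx]⟩

/-- All edges of a rose are loops, and a loop cannot belong to a forest. -/
theorem CollapsesTo.equivalent_of_isRose {Γ Δ : MarkedGraph n} (h : Γ.CollapsesTo Δ)
    (hΓ : Γ.IsRose) : Γ.Equivalent Δ := by
  obtain ⟨c, l, hl, hx⟩ := h
  have hc : c.forest = ∅ := Set.eq_empty_iff_forall_notMem.2 fun e he =>
    c.isForest.src_ne_tgt he (hΓ.elim _ _)
  exact ⟨c.toIso hc, l, hl, fun x => by rw [c.toIso_map, hx]⟩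

end MarkedGraph

namespace Vertex

variable {n : ℕ}

/-- An equivalence is a collapse of the empty forest, so changes of representative are absorbed by
transitivity. -/
theorem collapsesTo_mk {Γ Δ : MarkedGraph n} :
    CollapsesTo (⟦Γ⟧ : Vertex n) ⟦Δ⟧ ↔ Γ.CollapsesTo Δ := by
  constructor
  · rintro ⟨Γ', Δ', h1, h2, h⟩
    exact ((Quotient.exact h1).symm.collapsesTo.trans h).trans (Quotient.exact h2).collapsesTo
  · exact fun h => ⟨Γ, Δ, rfl, rfl, h⟩

theorem CollapsesTo.trans {A B C : Vertex n} (h : A.CollapsesTo B) (k : B.CollapsesTo C) :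
    A.CollapsesTo C := by
  induction A using Quotient.inductionOn with | _ A
  induction B using Quotient.inductionOn with | _ B
  induction C using Quotient.inductionOn with | _ C
  rw [collapsesTo_mk] at *
  exact MarkedGraph.CollapsesTo.trans h k

theorem CollapsesTo.refl (A : Vertex n) : A.CollapsesTo A := by
  induction A using Quotient.inductionOn with | _ A
  exact collapsesTo_mk.2 (MarkedGraph.Equivalent.refl A).collapsesTo

end Vertex

/-! ### Homotopy inverses of collapses. -/

namespace FinGraph

section TreePaths

variable {Γ Δ : FinGraph}

/-- Paths in the forest of a collapse, from the vertex `b` to each vertex, such that the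
forest edges are compatible with these paths up to homotopy. -/
structure Collapse.TreePaths (c : Γ.Collapse Δ) (b : Γ.V) where
  path : Γ.V → List Γ.E
  isPath : ∀ v, Γ.IsPath b (path v) v
  mem_forest : ∀ v, ∀ e ∈ path v, e ∈ c.forest
  word_mul_edge : ∀ e ∈ c.forest,
    Γ.word (path (Γ.src e)) * Γ.edge e = Γ.word (path (Γ.tgt e))
  path_base : path b = []

namespace Collapse.TreePaths

variable {c : Γ.Collapse Δ} {b : Γ.V} (τ : c.TreePaths b)

theorem map_word {l : List Γ.E} (h : ∀ e ∈ l, e ∈ c.forest) : c.map (Γ.word l) = 1 := by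
  induction l with
  | nil => simp
  | cons e l ih =>
    rw [word_cons, map_mul, c.map_edge_of_mem (h e (by simp)),
      ih fun f hf => h f (by simp [hf]), one_mul]

/-- The image of an edge under the homotopy inverse of a collapse. -/
noncomputable def edgeImage (f : Δ.E) : Γ.PathGroup :=
  Γ.word (τ.path (Γ.src (c.onE.symm f).1)) * Γ.edge (c.onE.symm f).1 *
    (Γ.word (τ.path (Γ.tgt (c.onE.symm f).1)))⁻¹

theorem onE_symm_inv (f : Δ.E) : (c.onE.symm (Δ.inv f)).1 = Γ.inv (c.onE.symm f).1 := by
  obtain ⟨e, rfl⟩ := c.onE.surjective f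
  rw [c.inv_onE', Equiv.symm_apply_apply, Equiv.symm_apply_apply]

/-- The homotopy inverse of a collapse, on path groups. -/
noncomputable def homotopyInv : Δ.PathGroup →* Γ.PathGroup :=
  Δ.lift τ.edgeImage (by
    intro f
    have h : Γ.src (Γ.inv (c.onE.symm f).1) = Γ.tgt (c.onE.symm f).1 := rfl
    rw [edgeImage, edgeImage, onE_symm_inv, Γ.tgt_inv, Γ.edge_inv, h]
    group)

theorem homotopyInv_map_edge (e : Γ.E) : τ.homotopyInv (c.map (Γ.edge e)) =
    Γ.word (τ.path (Γ.src e)) * Γ.edge e * (Γ.word (τ.path (Γ.tgt e)))⁻¹ := by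
  by_cases he : e ∈ c.forest
  · rw [c.map_edge_of_mem he, map_one, τ.word_mul_edge e he, mul_inv_cancel]
  · rw [c.map_edge ⟨e, he⟩, homotopyInv, lift_edge, edgeImage, Equiv.symm_apply_apply]

/-- The tree paths at intermediate vertices telescope. For loops at `b` both outer factors are
trivial, which gives the inverse on fundamental groups. -/
theorem homotopyInv_map_word {l : List Γ.E} {v w : Γ.V} (hl : Γ.IsPath v l w) :
    τ.homotopyInv (c.map (Γ.word l)) =
      Γ.word (τ.path v) * Γ.word l * (Γ.word (τ.path w))⁻¹ := by
  induction l generalizing v with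
  | nil => cases hl; simp
  | cons e l ih =>
    rw [word_cons, map_mul, map_mul, ih hl.2, homotopyInv_map_edge, hl.1]
    group

theorem map_homotopyInv (y : Δ.PathGroup) : c.map (τ.homotopyInv y) = y := by
  have : c.map.comp τ.homotopyInv = MonoidHom.id _ := by
    refine Δ.hom_ext fun f => ?_
    rw [MonoidHom.comp_apply, homotopyInv, lift_edge, edgeImage, map_mul, map_mul, map_inv,
      map_word (τ.mem_forest _), map_word (τ.mem_forest _), c.map_edge,
      Equiv.apply_symm_apply]
    simp
  exact DFunLike.congr_fun this y

theorem homotopyInv_mem (y : Δ.PathGroup) {d : Δ.V} (hy : y ∈ Δ.pi1 d) :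
    τ.homotopyInv y ∈ Γ.pi1 b := by
  obtain ⟨l, -, rfl⟩ := hy
  induction l with
  | nil => simp [one_mem]
  | cons f l ih =>
    rw [word_cons, map_mul]
    refine mul_mem ?_ ih
    obtain ⟨m, hm, hw⟩ := (τ.isPath (Γ.tgt (c.onE.symm f).1)).exists_reverse
    refine ⟨τ.path (Γ.src (c.onE.symm f).1) ++ (c.onE.symm f).1 :: m,
      (τ.isPath _).append ⟨rfl, hm⟩, ?_⟩
    rw [homotopyInv, lift_edge, edgeImage, word_append, word_cons, hw]
    group

/-- A collapse to a graph with one vertex induces an isomorphism of fundamental groups. -/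
noncomputable def pi1Equiv [Subsingleton Δ.V] (d : Δ.V) : Γ.pi1 b ≃* Δ.pi1 d where
  toFun x := ⟨c.map x, by
    obtain ⟨l, hl, hx⟩ := x.2
    obtain ⟨m, hm, hw⟩ := c.exists_path hl
    refine ⟨m, ?_, by rw [hw, hx]⟩
    rwa [Subsingleton.elim d (c.onV b)]⟩
  invFun y := ⟨τ.homotopyInv y, τ.homotopyInv_mem _ y.2⟩
  left_inv x := by
    obtain ⟨l, hl, hx⟩ := x.2
    refine Subtype.ext ?_
    change τ.homotopyInv (c.map x.1) = x.1
    rw [← hx, τ.homotopyInv_map_word hl, τ.path_base]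
    simp
  right_inv y := Subtype.ext (τ.map_homotopyInv y.1)
  map_mul' x y := Subtype.ext (map_mul c.map _ _)

theorem map_pi1Equiv_symm [Subsingleton Δ.V] (d : Δ.V) (y : Δ.pi1 d) :
    c.map ((τ.pi1Equiv d).symm y : Γ.pi1 b) = y := τ.map_homotopyInv y.1

end Collapse.TreePaths

end TreePaths

/-! ### Blow-ups of roses along stars -/

section Star

/-- The path from the centre of the star to a vertex. -/
def starPath (R : FinGraph) (K : Type) : Option K → List (R.E ⊕ K × Bool)
  | none => []
  | some k => [Sum.inr (k, true)]

theorem starPath_mem (R : FinGraph) (K : Type) (v : Option K) :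
    ∀ e ∈ starPath R K v, e ∈ Set.range Sum.inr := by
  cases v <;> simp [starPath]

variable (R : FinGraph) (K : Type) [Finite K] (g : R.E → Option K)

/-- The blow-up of a one-vertex graph: a star with central vertex `none`, leaves `some k` and
edges `(k, true)` from the centre to `some k`, to which the petals are attached through `g`. -/
abbrev starGraph : FinGraph where
  V := Option K
  E := R.E ⊕ K × Bool
  finite_V := inferInstance
  finite_E := inferInstance
  src := Sum.elim g fun p => if p.2 then none else some p.1
  inv := Sum.map R.inv fun p => (p.1, !p.2)
  inv_inv e := by rcases e with e | ⟨k, b⟩ <;> simp [R.inv_inv]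
  inv_ne e := by rcases e with e | ⟨k, b⟩ <;> simp [R.inv_ne]

/-- A reduced path in a star has at most two edges, since it cannot return from a leaf; a closed one
of length two would backtrack. -/
theorem starGraph_isForest : (starGraph R K g).IsForest (Set.range Sum.inr) := by
  intro v l hF hr hl
  have key : ∀ l : List (K × Bool), (starGraph R K g).IsReduced (l.map Sum.inr) →
      (starGraph R K g).IsPath v (l.map Sum.inr) v → l = [] := by
    intro l hr hl
    rcases l with _ | ⟨⟨k, b⟩, _ | ⟨⟨k', b'⟩, _ | ⟨⟨k'', b''⟩, l⟩⟩⟩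
    · rfl
    · exfalso
      cases b <;> simp [IsPath, tgt] at hl <;> simp [← hl.1] at hl
    · cases b <;> cases b' <;> simp_all [IsPath, tgt, IsReduced]
      exact hr (Option.some.inj (hl.2.trans hl.1.symm))
    · cases b <;> cases b' <;> cases b'' <;> simp_all [IsPath, tgt, IsReduced]
  obtain ⟨m, rfl⟩ : ∃ m : List (K × Bool), m.map Sum.inr = l := by
    clear hr hl
    induction l with
    | nil => exact ⟨[], rfl⟩
    | cons e l ih =>
      obtain ⟨m, rfl⟩ := ih fun f hf => hF f (by simp [hf])
      obtain ⟨p, rfl⟩ := hF e (by simp)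
      exact ⟨p :: m, rfl⟩
  rw [key m hr hl, List.map_nil]

theorem starPath_isPath (v : Option K) :
    (starGraph R K g).IsPath none (starPath R K v) v := by
  cases v <;> simp [starPath, IsPath, tgt]

variable [Subsingleton R.V] (r : R.V)

/-- The collapse of the star in a blow-up. -/
noncomputable def starCollapse : (starGraph R K g).Collapse R where
  forest := Set.range Sum.inr
  inv_mem := by rintro _ ⟨p, rfl⟩; exact ⟨_, rfl⟩
  isForest := starGraph_isForest R K g
  onV _ := r
  onE := (Equiv.ofBijective (fun e : R.E => (⟨Sum.inl e, by simp⟩ :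
      {e : R.E ⊕ K × Bool // e ∉ Set.range Sum.inr})) ⟨fun e f h => by simpa using h, fun e => by
        rcases e with ⟨e | p, h⟩
        · exact ⟨e, rfl⟩
        · exact absurd ⟨p, rfl⟩ h⟩).symm
  onV_surjective v := ⟨none, Subsingleton.elim _ _⟩
  onV_eq_iff v w := by
    refine ⟨fun _ => ?_, fun _ => rfl⟩
    obtain ⟨m, hm, hp⟩ := (starPath_isPath R K g v).exists_reverse_of_inv_mem
      (F := Set.range Sum.inr) (by rintro _ ⟨p, rfl⟩; exact ⟨_, rfl⟩) (starPath_mem R K v)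
    refine ⟨m ++ starPath R K w, fun e he => ?_, hp.append (starPath_isPath R K g w)⟩
    rcases List.mem_append.1 he with he | he
    · exact hm e he
    · exact starPath_mem R K w e he
  src_onE _ := Subsingleton.elim _ _
  inv_onE e f h := by
    rw [Equiv.eq_symm_apply]
    refine Subtype.ext (Eq.trans ?_ h.symm)
    rcases e with ⟨e | p, he⟩
    · have h1 := Equiv.symm_apply_apply (Equiv.ofBijective (fun e : R.E => (⟨Sum.inl e, by simp⟩ :
        {e : R.E ⊕ K × Bool // e ∉ Set.range Sum.inr})) ⟨fun e f h => by simpa using h, fun e => by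
        rcases e with ⟨e | p, h⟩
        · exact ⟨e, rfl⟩
        · exact absurd ⟨p, rfl⟩ h⟩) e
      exact congrArg (fun x => (Sum.inl (R.inv x) : R.E ⊕ K × Bool)) h1
    · exact absurd ⟨p, rfl⟩ he

theorem starCollapse_onE_symm (e : R.E) :
    ((starCollapse R K g r).onE.symm e).1 = Sum.inl e := rfl

theorem inl_notMem (e : R.E) : (Sum.inl e : (starGraph R K g).E) ∉ (starCollapse R K g r).forest :=
  ((starCollapse R K g r).onE.symm e).2

theorem starCollapse_onE (e : R.E) (h) :
    (starCollapse R K g r).onE ⟨Sum.inl e, h⟩ = e := by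
  rw [← Equiv.eq_symm_apply]
  rfl

theorem starCollapse_map_inl (e : R.E) :
    (starCollapse R K g r).map ((starGraph R K g).edge (Sum.inl e)) = R.edge e := by
  rw [(starCollapse R K g r).map_edge ⟨Sum.inl e, inl_notMem R K g r e⟩, starCollapse_onE]

/-- The tree paths of the collapse of a star. -/
def starTreePaths : (starCollapse R K g r).TreePaths none where
  path := starPath R K
  isPath := starPath_isPath R K g
  mem_forest v := starPath_mem R K v
  word_mul_edge := by
    rintro _ ⟨⟨k, b⟩, rfl⟩
    cases b
    · have : (starGraph R K g).edge (Sum.inr (k, false)) =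
        ((starGraph R K g).edge (Sum.inr (k, true)))⁻¹ :=
        (starGraph R K g).edge_inv (Sum.inr (k, true))
      simp [starPath, tgt, word, this]
    · simp [starPath, tgt, word]
  path_base := rfl

end Star

/-! ### Splitting along one edge of a forest -/

section Split

open Classical in
/-- The indicator of a set, as a map to the vertices of a star with one leaf. -/
noncomputable def sideMap {R : FinGraph} (α : Set R.E) : R.E → Option Unit :=
  fun h => if h ∈ α then some () else none

theorem sideMap_eq_some {R : FinGraph} {α : Set R.E} {h : R.E} :
    sideMap α h = some () ↔ h ∈ α := by
  unfold sideMap; split_ifs <;> simp [*]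

theorem sideMap_eq_none {R : FinGraph} {α : Set R.E} {h : R.E} :
    sideMap α h = none ↔ h ∉ α := by
  unfold sideMap; split_ifs <;> simp [*]

/-- The blow-up of a rose with one new edge. -/
noncomputable abbrev splitGraph (R : FinGraph) (α : Set R.E) : FinGraph :=
  starGraph R Unit (sideMap α)

namespace Collapse

variable {A R : FinGraph} (c : A.Collapse R) (e₀ : A.E)

/-- The vertices on the terminal side of the edge `e₀` of a forest. -/
def side : Set A.V :=
  {v | ∃ l, (∀ e ∈ l, e ∈ c.forest ∧ e ≠ e₀ ∧ e ≠ A.inv e₀) ∧ A.IsPath (A.tgt e₀) l v}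

/-- The oriented petals starting on the terminal side of the edge `e₀` of a forest. -/
def cut : Set R.E := {h | A.src (c.onE.symm h).1 ∈ c.side e₀}

variable {c e₀}

theorem tgt_mem_side : A.tgt e₀ ∈ c.side e₀ := ⟨[], by simp, rfl⟩

/-- A path back from the terminal to the initial vertex avoiding `e₀` would close up with `e₀` to a
nontrivial reduced closed path in the forest. -/
theorem src_notMem_side (he₀ : e₀ ∈ c.forest) : A.src e₀ ∉ c.side e₀ := by
  rintro ⟨l, hl, hp⟩
  obtain ⟨m, hm, hr, hp⟩ := A.exists_isReduced hl hp
  have h := c.isForest (A.src e₀) (e₀ :: m) ?_ ?_ ⟨rfl, hp⟩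
  · simp at h
  · intro e he
    rcases List.mem_cons.1 he with rfl | he
    · exact he₀
    · exact (hm e he).1
  · cases m with
    | nil => simp [IsReduced]
    | cons f m => exact List.isChain_cons_cons.2 ⟨(hm f (by simp)).2.2, hr⟩

theorem tgt_mem_side_of_src {e : A.E} (he : e ∈ c.forest ∧ e ≠ e₀ ∧ e ≠ A.inv e₀)
    (h : A.src e ∈ c.side e₀) : A.tgt e ∈ c.side e₀ := by
  obtain ⟨l, hl, hp⟩ := h
  refine ⟨l ++ [e], fun f hf => ?_, hp.append ⟨rfl, rfl⟩⟩
  rcases List.mem_append.1 hf with hf | hf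
  · exact hl f hf
  · rw [List.mem_singleton.1 hf]; exact he

theorem src_mem_side_iff {e : A.E} (he : e ∈ c.forest ∧ e ≠ e₀ ∧ e ≠ A.inv e₀) :
    A.src e ∈ c.side e₀ ↔ A.tgt e ∈ c.side e₀ := by
  refine ⟨tgt_mem_side_of_src he, fun h => ?_⟩
  have := tgt_mem_side_of_src (e := A.inv e) (c := c) (e₀ := e₀)
    ⟨c.inv_mem _ he.1, fun h => he.2.2 (A.inv_eq_comm.1 h), fun h => he.2.1 (A.inv_injective h)⟩ h
  rwa [A.tgt_inv] at this

/-- As the target has one vertex, the forest is a spanning tree, and deleting `e₀` leaves only two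
components. -/
theorem exists_path_of_notMem_side [Subsingleton R.V] (v : A.V) (hv : v ∉ c.side e₀) :
    ∃ l, (∀ e ∈ l, e ∈ c.forest ∧ e ≠ e₀ ∧ e ≠ A.inv e₀) ∧ A.IsPath v l (A.src e₀) := by
  obtain ⟨l, hl, hp⟩ := (c.onV_eq_iff v (A.src e₀)).1 (Subsingleton.elim _ _)
  induction l generalizing v with
  | nil => exact ⟨[], by simp, hp⟩
  | cons e l ih =>
    have hec := hl e (by simp)
    -- Meeting `e₀` means that its initial vertex is already reached; meeting its inverse would put
    -- the current vertex on the terminal side.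
    by_cases h1 : e = e₀
    · subst h1; exact ⟨[], by simp, hp.1.symm⟩
    by_cases h2 : e = A.inv e₀
    · subst h2; exact absurd tgt_mem_side (hp.1 ▸ hv)
    have he : e ∈ c.forest ∧ e ≠ e₀ ∧ e ≠ A.inv e₀ := ⟨hec, h1, h2⟩
    obtain ⟨m, hm, hmp⟩ := ih (A.tgt e)
      (fun h => hv (hp.1 ▸ (src_mem_side_iff he).2 h)) (fun f hf => hl f (by simp [hf])) hp.2
    refine ⟨e :: m, fun f hf => ?_, hp.1, hmp⟩
    rcases List.mem_cons.1 hf with rfl | hf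
    · exact he
    · exact hm f hf

variable (c e₀)

open Classical in
/-- The action on vertices of the collapse of all the edges of a forest but one. -/
noncomputable def splitOnV (v : A.V) : Option Unit := if v ∈ c.side e₀ then some () else none

theorem splitOnV_eq_some {v : A.V} : c.splitOnV e₀ v = some () ↔ v ∈ c.side e₀ := by
  unfold splitOnV; split_ifs <;> simp [*]

theorem splitOnV_eq_none {v : A.V} : c.splitOnV e₀ v = none ↔ v ∉ c.side e₀ := by
  unfold splitOnV; split_ifs <;> simp [*]

theorem splitOnV_eq_iff {v w : A.V} :
    c.splitOnV e₀ v = c.splitOnV e₀ w ↔ (v ∈ c.side e₀ ↔ w ∈ c.side e₀) := by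
  unfold splitOnV; split_ifs <;> simp [*]

/-- The forest without the edge `e₀`. -/
def splitForest : Set A.E := {e | e ∈ c.forest ∧ e ≠ e₀ ∧ e ≠ A.inv e₀}

theorem splitForest_inv_mem (e : A.E) (he : e ∈ c.splitForest e₀) :
    A.inv e ∈ c.splitForest e₀ :=
  ⟨c.inv_mem _ he.1, fun h => he.2.2 (A.inv_eq_comm.1 h), fun h => he.2.1 (A.inv_injective h)⟩

open Classical in
/-- The action on edges of the collapse of all the edges of a forest but one. -/
noncomputable def splitOnE (e : {e // e ∉ c.splitForest e₀}) : R.E ⊕ Unit × Bool :=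
  if h : e.1 ∈ c.forest then (if e.1 = e₀ then Sum.inr ((), true) else Sum.inr ((), false))
  else Sum.inl (c.onE ⟨e.1, h⟩)

theorem splitOnE_bijective (he₀ : e₀ ∈ c.forest) : Function.Bijective (c.splitOnE e₀) := by
  have key : ∀ e : {e // e ∉ c.splitForest e₀}, e.1 ∈ c.forest → e.1 ≠ e₀ → e.1 = A.inv e₀ :=
    fun e h1 h2 => by_contra fun h3 => e.2 ⟨h1, h2, h3⟩
  constructor
  · intro e f h
    have he := key e
    have hf := key f
    unfold splitOnE at h
    apply Subtype.ext
    split_ifs at h with h1 h2 h3 h4 h5 h6 h7 h8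
    · rw [h2, h4]
    · simp at h
    · simp at h
    · rw [he h1 h2, hf h5 h6]
    · have h1 := congrArg Subtype.val (c.onE.injective (Sum.inl.inj h))
      exact h1
  · rintro (e | ⟨⟨⟩, b⟩)
    · obtain ⟨e, rfl⟩ := c.onE.surjective e
      refine ⟨⟨e.1, fun h => e.2 h.1⟩, ?_⟩
      rw [splitOnE, dif_neg e.2]
    · cases b
      · refine ⟨⟨A.inv e₀, fun h => h.2.2 rfl⟩, ?_⟩
        rw [splitOnE, dif_pos (c.inv_mem _ he₀), if_neg (A.inv_ne _)]
      · refine ⟨⟨e₀, fun h => h.2.1 rfl⟩, ?_⟩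
        rw [splitOnE, dif_pos he₀, if_pos rfl]

/-- The collapse of all the edges of a forest but one. -/
noncomputable def toSplit [Subsingleton R.V] (he₀ : e₀ ∈ c.forest) :
    A.Collapse (splitGraph R (c.cut e₀)) where
  forest := c.splitForest e₀
  inv_mem := c.splitForest_inv_mem e₀
  isForest v l hl := c.isForest v l fun e he => (hl e he).1
  onV := c.splitOnV e₀
  onE := Equiv.ofBijective _ (c.splitOnE_bijective e₀ he₀)
  onV_surjective v := by
    rcases v with _ | ⟨⟩
    · exact ⟨A.src e₀, (c.splitOnV_eq_none e₀).2 (src_notMem_side he₀)⟩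
    · exact ⟨A.tgt e₀, (c.splitOnV_eq_some e₀).2 tgt_mem_side⟩
  onV_eq_iff v w := by
    rw [splitOnV_eq_iff]
    constructor
    · intro h
      by_cases hv : v ∈ c.side e₀
      · obtain ⟨l, hl, hp⟩ := hv
        obtain ⟨l', hl', hp'⟩ := h.1 ⟨l, hl, hp⟩
        obtain ⟨m, hm, hq⟩ := hp.exists_reverse_of_inv_mem (c.splitForest_inv_mem e₀) hl
        exact ⟨m ++ l', fun e he => (List.mem_append.1 he).elim (hm e) (hl' e), hq.append hp'⟩
      · obtain ⟨l, hl, hp⟩ := exists_path_of_notMem_side v hv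
        obtain ⟨l', hl', hp'⟩ := exists_path_of_notMem_side w fun hw => hv (h.2 hw)
        obtain ⟨m, hm, hq⟩ := hp'.exists_reverse_of_inv_mem (c.splitForest_inv_mem e₀) hl'
        exact ⟨l ++ m, fun e he => (List.mem_append.1 he).elim (hl e) (hm e), hp.append hq⟩
    · rintro ⟨l, hl, hp⟩
      induction l generalizing v with
      | nil => cases hp; rfl
      | cons e l ih =>
        rw [← hp.1, src_mem_side_iff (hl e (by simp))]
        exact ih (A.tgt e) (fun f hf => hl f (by simp [hf])) hp.2
  src_onE e := by
    rw [Equiv.ofBijective_apply, splitOnE]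
    split_ifs with h1 h2
    · rw [h2]
      exact ((c.splitOnV_eq_none e₀).2 (src_notMem_side he₀)).symm
    · have h3 : e.1 = A.inv e₀ := by_contra fun h3 => e.2 ⟨h1, h2, h3⟩
      rw [h3]
      exact ((c.splitOnV_eq_some e₀).2 tgt_mem_side).symm
    · change sideMap _ _ = _
      have : c.onE ⟨e.1, h1⟩ ∈ c.cut e₀ ↔ A.src e.1 ∈ c.side e₀ := by
        rw [cut, Set.mem_ofPred_eq, Equiv.symm_apply_apply]
      by_cases hs : A.src e.1 ∈ c.side e₀
      · rw [(c.splitOnV_eq_some e₀).2 hs, sideMap_eq_some.2 (this.2 hs)]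
      · rw [(c.splitOnV_eq_none e₀).2 hs, sideMap_eq_none.2 fun h => hs (this.1 h)]
  inv_onE e f h := by
    rw [Equiv.ofBijective_apply, Equiv.ofBijective_apply, splitOnE, splitOnE]
    have hc : f.1 ∈ c.forest ↔ e.1 ∈ c.forest := by rw [h, c.inv_mem_iff]
    by_cases h1 : e.1 ∈ c.forest
    · rw [dif_pos h1, dif_pos (hc.2 h1)]
      by_cases h2 : e.1 = e₀
      · rw [if_pos h2, if_neg]
        · rfl
        · rw [h, h2]; exact A.inv_ne _
      · have h3 : e.1 = A.inv e₀ := by_contra fun h3 => e.2 ⟨h1, h2, h3⟩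
        rw [if_neg h2, if_pos]
        · rfl
        · rw [h, h3, A.inv_inv]
    · rw [dif_neg h1, dif_neg fun h' => h1 (hc.1 h')]
      change Sum.inl _ = _
      rw [c.inv_onE _ ⟨f.1, _⟩ h]

/-- The collapse `c` factors through the two-vertex graph in which only `e₀` of the forest survives.
-/
theorem starCollapse_toSplit_map [Subsingleton R.V] (he₀ : e₀ ∈ c.forest) (r : R.V)
    (x : A.PathGroup) :
    (starCollapse R Unit (sideMap (c.cut e₀)) r).map ((c.toSplit e₀ he₀).map x) = c.map x := by
  have : (starCollapse R Unit (sideMap (c.cut e₀)) r).map.comp (c.toSplit e₀ he₀).map = c.map := by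
    refine A.hom_ext fun e => ?_
    rw [MonoidHom.comp_apply]
    by_cases he : e ∈ c.splitForest e₀
    · rw [(c.toSplit e₀ he₀).map_edge_of_mem he, map_one, c.map_edge_of_mem he.1]
    · rw [(c.toSplit e₀ he₀).map_edge ⟨e, he⟩]
      change (starCollapse R Unit (sideMap (c.cut e₀)) r).map
        ((splitGraph R (c.cut e₀)).edge (c.splitOnE e₀ ⟨e, he⟩)) = _
      by_cases h1 : e ∈ c.forest
      · have h2 : c.splitOnE e₀ ⟨e, he⟩ ∈
            (starCollapse R Unit (sideMap (c.cut e₀)) r).forest := by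
          unfold splitOnE
          rw [dif_pos h1]
          split_ifs <;> exact ⟨_, rfl⟩
        rw [c.map_edge_of_mem h1, Collapse.map_edge_of_mem _ h2]
      · have h2 : c.splitOnE e₀ ⟨e, he⟩ = Sum.inl (c.onE ⟨e, h1⟩) := by
          unfold splitOnE
          rw [dif_neg h1]
        rw [h2, starCollapse_map_inl, c.map_edge ⟨e, h1⟩]
  exact DFunLike.congr_fun this x

theorem toSplit_onE_self [Subsingleton R.V] (he₀ : e₀ ∈ c.forest) :
    (c.toSplit e₀ he₀).onE ⟨e₀, fun h => h.2.1 rfl⟩ = Sum.inr ((), true) := by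
  change c.splitOnE e₀ ⟨e₀, fun h => h.2.1 rfl⟩ = _
  unfold splitOnE
  rw [dif_pos he₀, if_pos rfl]

end Collapse

end Split

end FinGraph

/-! ### Exponent sums and the abelianization of the free group. -/

/-- The exponent sum of the `l`-th generator. -/
noncomputable def expo {n : ℕ} (l : Fin n) (x : F n) : ℤ :=
  Multiplicative.toAdd (FreeGroup.lift (fun i => Multiplicative.ofAdd (if i = l then (1 : ℤ) else 0)) x)

theorem expo_of {n : ℕ} (l i : Fin n) : expo l (FreeGroup.of i) = if i = l then 1 else 0 := by
  simp [expo]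

theorem expo_mul {n : ℕ} (l : Fin n) (x y : F n) : expo l (x * y) = expo l x + expo l y := by
  simp [expo]

theorem map_eq_sum_expo {n : ℕ} (f : F n → ℤ) (hf : ∀ x y, f (x * y) = f x + f y) (x : F n) :
    f x = ∑ l, f (FreeGroup.of l) * expo l x := by
  have h1 : f 1 = 0 := by
    have := hf 1 1
    rw [mul_one] at this; omega
  let G : F n →* Multiplicative ℤ :=
    ⟨⟨fun x => Multiplicative.ofAdd (f x), by simp [h1]⟩, fun x y => by simp [hf]⟩
  let H : F n →* Multiplicative ℤ :=
    ⟨⟨fun x => Multiplicative.ofAdd (∑ l, f (FreeGroup.of l) * expo l x), by simp [expo]⟩,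
      fun x y => by simp only [expo_mul, mul_add, Finset.sum_add_distrib, ofAdd_add]⟩
  have : G = H := by
    ext i
    change f _ = ∑ l, f (FreeGroup.of l) * expo l (FreeGroup.of i)
    simp [expo_of]
  exact Multiplicative.ofAdd.injective (DFunLike.congr_fun this x)

theorem expo_eq_of_abelianization {n : ℕ} {x y : F n}
    (h : Abelianization.of x = Abelianization.of y) (l : Fin n) : expo l x = expo l y := by
  have := congrArg (Abelianization.lift
    (FreeGroup.lift (fun i => Multiplicative.ofAdd (if i = l then (1 : ℤ) else 0)))) h
  rw [Abelianization.lift_apply_of, Abelianization.lift_apply_of] at this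
  exact congrArg Multiplicative.toAdd this

/-- Exponent sums are coordinates on the abelianization. This serves to recognise automorphisms
acting trivially on it. -/
theorem abelianization_eq_of_expo {n : ℕ} {x y : F n} (h : ∀ l, expo l x = expo l y) :
    Abelianization.of x = Abelianization.of y := by
  have key : ∀ x : F n, Abelianization.of x =
      ∏ l, (Abelianization.of (FreeGroup.of l)) ^ expo l x := by
    let G : F n →* Abelianization (F n) := Abelianization.of
    let H : F n →* Abelianization (F n) :=
      ⟨⟨fun x => ∏ l, (Abelianization.of (FreeGroup.of l)) ^ expo l x, by simp [expo]⟩,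
        fun x y => by simp only [expo_mul, zpow_add, Finset.prod_mul_distrib]⟩
    have : G = H := by
      ext i
      change Abelianization.of _ = ∏ l, (Abelianization.of (FreeGroup.of l)) ^ expo l (FreeGroup.of i)
      simp [expo_of, Finset.prod_ite_eq]
    exact fun x => DFunLike.congr_fun this x
  rw [key x, key y]
  simp only [h]

/-! ### Labels of forest edges as sums of labels of petals. -/

namespace FinGraph

-- In the two-vertex graph keeping only `e₀`, the edges leaving its terminal vertex are the reverse
-- of `e₀` and the petals of the cut. The flow of a closed path through that vertex is zero.
open Classical in
theorem Collapse.cnt_eq_sum_cut {A R : FinGraph} [Subsingleton R.V] [Fintype R.E]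
    (c : A.Collapse R) {e₀ : A.E} (he₀ : e₀ ∈ c.forest) {l : List A.E} {v : A.V}
    (hl : A.IsPath v l v) :
    A.cnt e₀ (A.word l) = ∑ h, if h ∈ c.cut e₀ then R.cnt h (c.map (A.word l)) else 0 := by
  obtain ⟨m, hm, hw⟩ := (c.toSplit e₀ he₀).exists_path hl
  have h1 := (splitGraph R (c.cut e₀)).sum_cnt_of_isPath (some ()) hm
  rw [sub_self, Fintype.sum_sum_type, Fintype.sum_prod_type, Finset.univ_unique (α := Unit),
    Finset.sum_singleton, Fintype.sum_bool] at h1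
  have h2 : ∀ h : R.E, (splitGraph R (c.cut e₀)).cnt (Sum.inl h)
      ((splitGraph R (c.cut e₀)).word m) = R.cnt h (c.map (A.word l)) := by
    intro h
    rw [← c.starCollapse_toSplit_map e₀ he₀ (c.onV v), ← hw]
    have := (starCollapse R Unit (sideMap (c.cut e₀)) (c.onV v)).cnt_map
      ⟨Sum.inl h, inl_notMem _ _ _ _ h⟩ ((splitGraph R (c.cut e₀)).word m)
    rw [starCollapse_onE] at this
    exact this.symm
  have h3 : (splitGraph R (c.cut e₀)).cnt (Sum.inr ((), true))
      ((splitGraph R (c.cut e₀)).word m) = A.cnt e₀ (A.word l) := by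
    rw [hw, ← c.toSplit_onE_self e₀ he₀, (c.toSplit e₀ he₀).cnt_map]
  have h4 := (splitGraph R (c.cut e₀)).cnt_inv_left (Sum.inr ((), true))
      ((splitGraph R (c.cut e₀)).word m)
  have h5 : (splitGraph R (c.cut e₀)).cnt (Sum.inr ((), false))
      ((splitGraph R (c.cut e₀)).word m) = - A.cnt e₀ (A.word l) := by
    rw [← h3, ← h4]; rfl
  simp only [Sum.elim_inl, Sum.elim_inr, sideMap_eq_some, h2] at h1
  simp only [if_true, reduceCtorEq, if_false, Bool.false_eq_true] at h1
  erw [h5] at h1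
  linarith

end FinGraph

theorem eq_inv_mul_mul_of_eq_mul_mul_inv {G : Type*} [Group G] {a b x : G}
    (h : b = a * x * a⁻¹) : x = a⁻¹ * b * a := by
  rw [h]; group

namespace MarkedGraph

open FinGraph

variable {n : ℕ}

theorem label_apply (Γ : MarkedGraph n) (a : Γ.E) (i : Fin n) :
    Γ.label a i = Γ.cnt a (Γ.marking (FreeGroup.of i)) := rfl

theorem cnt_marking (Γ : MarkedGraph n) (a : Γ.E) (x : F n) :
    Γ.cnt a (Γ.marking x) = ∑ l, Γ.label a l * expo l x :=
  map_eq_sum_expo (fun x => Γ.cnt a (Γ.marking x))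
    (fun x y => by rw [map_mul, Subgroup.coe_mul, cnt_mul]) x

theorem label_inv (Γ : MarkedGraph n) (a : Γ.E) : Γ.label (Γ.inv a) = - Γ.label a := by
  funext i
  rw [label_apply, cnt_inv_left]; rfl

theorem exists_isPath_marking (Γ : MarkedGraph n) (x : F n) :
    ∃ l, Γ.IsPath Γ.base l Γ.base ∧ Γ.word l = Γ.marking x := (Γ.marking x).2

section

variable {Γ Δ : MarkedGraph n} {c : Γ.toFinGraph.Collapse Δ.toFinGraph} {l : List Δ.E}

theorem label_onE (hx : ∀ x, c.map (Γ.marking x) = Δ.word l * Δ.marking x * (Δ.word l)⁻¹)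
    (e : {e // e ∉ c.forest}) : Δ.label (c.onE e) = Γ.label e.1 := by
  funext i
  rw [label_apply, label_apply, ← c.cnt_map, hx, cnt_conj]

open Classical in
theorem label_eq_sum_cut [Fintype Δ.E] (hΔ : Δ.IsRose)
    (hx : ∀ x, c.map (Γ.marking x) = Δ.word l * Δ.marking x * (Δ.word l)⁻¹)
    {e₀ : Γ.E} (he₀ : e₀ ∈ c.forest) :
    Γ.label e₀ = ∑ h, if h ∈ c.cut e₀ then Δ.label h else 0 := by
  have : Subsingleton Δ.V := hΔ
  funext i
  obtain ⟨m, hm, hw⟩ := Γ.exists_isPath_marking (FreeGroup.of i)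
  have := c.cnt_eq_sum_cut he₀ hm
  rw [label_apply, ← hw, this, Finset.sum_apply]
  refine Finset.sum_congr rfl fun h _ => ?_
  split_ifs
  · rw [hw, hx, cnt_conj, label_apply]
  · rfl

end

/-- Every edge of the collapsed graph comes from an edge with the same label. -/
theorem CollapsesTo.range_label {Γ Δ : MarkedGraph n} (h : Γ.CollapsesTo Δ) :
    Set.range Δ.label ⊆ Set.range Γ.label := by
  obtain ⟨c, l, -, hx⟩ := h
  rintro _ ⟨f, rfl⟩
  obtain ⟨e, rfl⟩ := c.onE.surjective f
  exact ⟨e.1, (label_onE hx e).symm⟩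

theorem Equivalent.range_label {Γ Δ : MarkedGraph n} (h : Γ.Equivalent Δ) :
    Set.range Γ.label = Set.range Δ.label :=
  (h.symm.collapsesTo.range_label).antisymm h.collapsesTo.range_label

/-- Counts factor through the abelianization, so labels, and with them norms, descend to the Torelli
quotient. -/
theorem label_act (Γ : MarkedGraph n) {φ : MulAut (F n)} (hφ : autAb n φ = 1) :
    (Γ.act φ).label = Γ.label := by
  funext a i
  refine (Γ.cnt_marking a (φ (FreeGroup.of i))).trans ?_
  have : ∀ l, expo l (φ (FreeGroup.of i)) = expo l (FreeGroup.of i) := by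
    refine fun l => expo_eq_of_abelianization ?_ l
    exact DFunLike.congr_fun hφ (Abelianization.of (FreeGroup.of i))
  simp [this, expo_of]

/-! ### Blow-ups of roses as marked graphs -/

section Star

variable (Γ : MarkedGraph n) (hΓ : Γ.IsRose) (K : Type) [Finite K] (g : Γ.E → Option K)

/-- The conditions under which the blow-up of a rose along a star is a marked graph. -/
structure IsValidStar : Prop where
  two_le : ∀ k, 2 ≤ Nat.card {h // g h = some k}
  three_le : 3 ≤ Nat.card K + Nat.card {h // g h = none}
  exists_crossing : ∀ k, ∃ h, g h = some k ∧ g (Γ.inv h) ≠ some k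

variable {K} {g}

/-- The blow-up of a rose along a star, as a marked graph. -/
noncomputable def star (hg : Γ.IsValidStar K g) : MarkedGraph n :=
  haveI : Subsingleton Γ.V := hΓ
  { starGraph Γ.toFinGraph K g with
    connected := by
      intro v w
      obtain ⟨m, hm, -⟩ := (starPath_isPath Γ.toFinGraph K g v).exists_reverse
      exact ⟨_, hm.append (starPath_isPath Γ.toFinGraph K g w)⟩
    no_separating := by
      rintro (e | ⟨k, b⟩)
      · obtain ⟨m, hm, hp⟩ := (starPath_isPath Γ.toFinGraph K g (g e)).exists_reverse_of_inv_mem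
          (F := Set.range Sum.inr) (by rintro _ ⟨p, rfl⟩; exact ⟨_, rfl⟩) (starPath_mem _ K _)
        refine ⟨m ++ starPath Γ.toFinGraph K (g (Γ.inv e)), fun f hf => ?_,
          hp.append (starPath_isPath _ _ _ _)⟩
        have : f ∈ Set.range Sum.inr := (List.mem_append.1 hf).elim (hm f) (starPath_mem _ K _ f)
        obtain ⟨p, rfl⟩ := this
        simp
      -- The detour around a star edge runs along a petal with one end at the leaf `k` and the other
      -- end elsewhere, then through the rest of the star.
      · obtain ⟨h, h1, h2⟩ := hg.exists_crossing k
        cases b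
        · refine ⟨Sum.inl h :: (match g (Γ.inv h) with
            | none => []
            | some k' => [Sum.inr (k', false)]), ?_, h1, ?_⟩
          · rcases h3 : g (Γ.inv h) with _ | k'
            · simp
            · have : k' ≠ k := fun h4 => h2 (by rw [h3, h4])
              simp [this]
          · change (starGraph Γ.toFinGraph K g).IsPath (g (Γ.inv h)) _ none
            rcases g (Γ.inv h) with _ | k' <;> simp [IsPath, tgt]
        · refine ⟨starPath Γ.toFinGraph K (g (Γ.inv h)) ++ [Sum.inl (Γ.inv h)], fun f hf => ?_,
            (starPath_isPath Γ.toFinGraph K g _).append ⟨rfl, ?_⟩⟩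
          · rcases List.mem_append.1 hf with hf | hf
            · rcases h3 : g (Γ.inv h) with _ | k'
              · rw [h3] at hf; simp [starPath] at hf
              · have : k' ≠ k := fun h4 => h2 (by rw [h3, h4])
                rw [h3] at hf
                simp [starPath] at hf
                simp [hf, this]
            · rw [List.mem_singleton.1 hf]; simp
          · change g (Γ.inv (Γ.inv h)) = some k
            rw [Γ.inv_inv, h1]
    valence := by
      rintro (_ | k)
      · refine hg.three_le.trans ?_
        rw [← Nat.card_sum]
        refine Nat.card_le_card_of_injective (fun x : K ⊕ {h // g h = none} =>
          (⟨x.elim (fun k => Sum.inr (k, true)) (fun h => Sum.inl h.1), ?_⟩ :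
            {e : (starGraph Γ.toFinGraph K g).E // (starGraph Γ.toFinGraph K g).src e = none})) ?_
        · rcases x with k | ⟨h, hh⟩ <;> simp [*]
        · rintro (k | ⟨h, hh⟩) (k' | ⟨h', hh'⟩) h <;> simp_all
      · refine (Nat.succ_le_succ (hg.two_le k)).trans ?_
        rw [Nat.succ_eq_add_one, ← Nat.card_unique (α := Unit), ← Nat.card_sum]
        refine Nat.card_le_card_of_injective (fun x : {h // g h = some k} ⊕ Unit =>
          (⟨x.elim (fun h => Sum.inl h.1) (fun _ => Sum.inr (k, false)), ?_⟩ :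
            {e : (starGraph Γ.toFinGraph K g).E // (starGraph Γ.toFinGraph K g).src e = some k})) ?_
        · rcases x with ⟨h, hh⟩ | _ <;> simp [*]
        · rintro (⟨h, hh⟩ | _) (⟨h', hh'⟩ | _) h <;> simp_all
    base := none
    marking := Γ.marking.trans ((starTreePaths Γ.toFinGraph K g Γ.base).pi1Equiv Γ.base).symm }

theorem star_collapsesTo (hg : Γ.IsValidStar K g) : (Γ.star hΓ hg).CollapsesTo Γ := by
  have : Subsingleton Γ.V := hΓ
  exact ⟨starCollapse Γ.toFinGraph K g Γ.base, [], rfl, fun x => by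
    rw [word_nil, one_mul, inv_one, mul_one]
    exact (starTreePaths Γ.toFinGraph K g Γ.base).map_pi1Equiv_symm Γ.base (Γ.marking x)⟩

end Star

/-- Only the markings need care. Both agree after collapsing the last edge to Γ, and the homotopy
inverse recovers them upstairs up to conjugation by a tree path and the image of `l`. -/
theorem collapsesTo_star {A Γ : MarkedGraph n} (hΓ : Γ.IsRose)
    {c : A.toFinGraph.Collapse Γ.toFinGraph} {l : List Γ.E}
    (hl : Γ.IsPath (c.onV A.base) l Γ.base)
    (hx : ∀ x, c.map (A.marking x) = Γ.word l * Γ.marking x * (Γ.word l)⁻¹)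
    {e₀ : A.E} (he₀ : e₀ ∈ c.forest) (hg : Γ.IsValidStar Unit (sideMap (c.cut e₀))) :
    A.CollapsesTo (Γ.star hΓ hg) := by
  have : Subsingleton Γ.V := hΓ
  let S := splitGraph Γ.toFinGraph (c.cut e₀)
  let s := starCollapse Γ.toFinGraph Unit (sideMap (c.cut e₀)) Γ.base
  let τ := starTreePaths Γ.toFinGraph Unit (sideMap (c.cut e₀)) Γ.base
  let d := c.toSplit e₀ he₀
  have hlb : Γ.word l ∈ Γ.pi1 Γ.base :=
    ⟨l, by rwa [Subsingleton.elim Γ.base (c.onV A.base), Subsingleton.elim (c.onV A.base) Γ.base]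
      at hl ⊢, rfl⟩
  obtain ⟨k, hk, hkw⟩ := τ.homotopyInv_mem _ hlb
  obtain ⟨k', hk', hkw'⟩ := (τ.isPath (d.onV A.base)).exists_reverse
  refine ⟨d, k' ++ k, hk'.append hk, fun x => ?_⟩
  obtain ⟨m, hm, hw⟩ := A.exists_isPath_marking x
  obtain ⟨m', hm', hw'⟩ := d.exists_path hm
  have h1 := τ.homotopyInv_map_word hm'
  have h2 : s.map (S.word m') = Γ.word l * Γ.marking x * (Γ.word l)⁻¹ := by
    rw [← hx, hw', hw]
    exact c.starCollapse_toSplit_map e₀ he₀ Γ.base _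
  have h3 : ((Γ.star hΓ hg).marking x).1 = τ.homotopyInv (Γ.marking x) := rfl
  have h4 : (Γ.star hΓ hg).word (k' ++ k) =
      (S.word (τ.path (d.onV A.base)))⁻¹ * τ.homotopyInv (Γ.word l) := by
    rw [← hkw', ← hkw]; exact S.word_append k' k
  change τ.homotopyInv (s.map (S.word m')) = _ at h1
  rw [h2, map_mul, map_mul, map_inv] at h1
  have h5 : d.map (A.marking x).1 =
      (S.word (τ.path (d.onV A.base)))⁻¹ * τ.homotopyInv (Γ.word l) *
      τ.homotopyInv (Γ.marking x) *
      ((S.word (τ.path (d.onV A.base)))⁻¹ * τ.homotopyInv (Γ.word l))⁻¹ := by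
    have h6 : S.word m' = (S.word (τ.path (d.onV A.base)))⁻¹ * (τ.homotopyInv (Γ.word l) *
      τ.homotopyInv (Γ.marking x) * (τ.homotopyInv (Γ.word l))⁻¹) *
      S.word (τ.path (d.onV A.base)) := by
      exact eq_inv_mul_mul_of_eq_mul_mul_inv h1
    rw [← hw, ← hw', h6]
    group
  rw [h4]
  exact h5

end MarkedGraph

/-! ### Path groups of one-vertex graphs, and comparison of vector norms. -/

namespace FinGraph

theorem isPath_of_subsingleton (Γ : FinGraph) [Subsingleton Γ.V] (v w : Γ.V) (l : List Γ.E) :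
    Γ.IsPath v l w := by
  induction l generalizing v with
  | nil => exact Subsingleton.elim _ _
  | cons e l ih => exact ⟨Subsingleton.elim _ _, ih _⟩

theorem exists_word_eq (Γ : FinGraph) (x : Γ.PathGroup) : ∃ l, Γ.word l = x := by
  induction x using PresentedGroup.induction_on with | _ y
  induction y using FreeGroup.induction_on with
  | C1 => exact ⟨[], by rw [map_one]; rfl⟩
  | of e => exact ⟨[e], by simp [word]; rfl⟩
  | inv_of e h => exact ⟨[Γ.inv e], by rw [map_inv, word_cons, word_nil, mul_one, edge_inv]; rfl⟩
  | mul x y hx hy =>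
    obtain ⟨l, hl⟩ := hx
    obtain ⟨m, hm⟩ := hy
    exact ⟨l ++ m, by rw [word_append, hl, hm, map_mul]⟩

theorem pi1_eq_top (Γ : FinGraph) [Subsingleton Γ.V] (v : Γ.V) : Γ.pi1 v = ⊤ := by
  rw [eq_top_iff]
  intro x _
  obtain ⟨l, rfl⟩ := Γ.exists_word_eq x
  exact ⟨l, Γ.isPath_of_subsingleton v v l, rfl⟩

end FinGraph

theorem vecNorm_neg {n : ℕ} (v : Fin n → ℤ) : vecNorm (-v) = vecNorm v := by
  unfold vecNorm; simp

theorem vecNorm_eq_iff {n : ℕ} {v w : Fin n → ℤ} :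
    vecNorm v = vecNorm w ↔ ∀ i, (v i).natAbs = (w i).natAbs := by
  unfold vecNorm
  rw [toLex_inj, funext_iff]

theorem vecNorm_lt_iff {n : ℕ} {v w : Fin n → ℤ} :
    vecNorm v < vecNorm w ↔ ∃ i, (∀ j < i, (v j).natAbs = (w j).natAbs) ∧
      (v i).natAbs < (w i).natAbs := Iff.rfl

/-! ### Marking matrices and standard representatives. -/

namespace MarkedGraph

open FinGraph

variable {n : ℕ}

/-- The marking of a rose, as an isomorphism onto the path group. -/
noncomputable def pathEquiv (Γ : MarkedGraph n) (hΓ : Γ.IsRose) : F n ≃* Γ.PathGroup :=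
  haveI : Subsingleton Γ.V := hΓ
  Γ.marking.trans ((MulEquiv.subgroupCongr (Γ.pi1_eq_top Γ.base)).trans Subgroup.topEquiv)

theorem pathEquiv_apply (Γ : MarkedGraph n) (hΓ : Γ.IsRose) (x : F n) :
    Γ.pathEquiv hΓ x = Γ.marking x := rfl

theorem sum_label_mul_expo (Γ : MarkedGraph n) (hΓ : Γ.IsRose) (a : Γ.E) (y : Γ.PathGroup) :
    ∑ l, Γ.label a l * expo l ((Γ.pathEquiv hΓ).symm y) = Γ.cnt a y := by
  rw [← cnt_marking, ← Γ.pathEquiv_apply hΓ, MulEquiv.apply_symm_apply]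

/-- Equal absolute values mean equality modulo 2, whereas the labels of different petals are
independent modulo 2. This is why the strict ordering of norms required in a standard representative
can be achieved. -/
theorem eq_or_eq_inv_of_vecNorm_label_eq (Γ : MarkedGraph n) (hΓ : Γ.IsRose) {a b : Γ.E}
    (h : vecNorm (Γ.label a) = vecNorm (Γ.label b)) : a = b ∨ a = Γ.inv b := by
  classical
  by_contra! hab
  have h1 := Γ.sum_label_mul_expo hΓ a (Γ.edge a)
  have h2 := Γ.sum_label_mul_expo hΓ b (Γ.edge a)
  rw [cnt_edge, if_pos rfl, if_neg (Γ.inv_ne a).symm] at h1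
  rw [cnt_edge, if_neg hab.1, if_neg hab.2] at h2
  rw [vecNorm_eq_iff] at h
  -- Both labels are evaluated on the homology class of the petal `a`: the values are 1 and 0, yet
  -- they agree modulo 2.
  have h3 : (2 : ℤ) ∣ ∑ l, Γ.label a l * expo l ((Γ.pathEquiv hΓ).symm (Γ.edge a)) -
      ∑ l, Γ.label b l * expo l ((Γ.pathEquiv hΓ).symm (Γ.edge a)) := by
    rw [← Finset.sum_sub_distrib]
    refine Finset.dvd_sum fun l _ => ?_
    rw [← sub_mul]
    refine Dvd.dvd.mul_right ?_ _
    have := h l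
    omega
  rw [h1, h2] at h3
  omega

/-- An enumeration of the petals of a graph, up to orientation. -/
def IsEnumeration (Γ : MarkedGraph n) {m : ℕ} (a : Fin m → Γ.E) : Prop :=
  Function.Bijective (fun p : Fin m × Bool => if p.2 then a p.1 else Γ.inv (a p.1))

theorem IsEnumeration.eq_iff {Γ : MarkedGraph n} {m : ℕ} {a : Fin m → Γ.E}
    (ha : Γ.IsEnumeration a) {i j : Fin m} : a i = a j ↔ i = j :=
  ⟨fun h => congrArg Prod.fst (@ha.1 (i, true) (j, true) (by simpa using h)), fun h => by rw [h]⟩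

theorem IsEnumeration.ne_inv {Γ : MarkedGraph n} {m : ℕ} {a : Fin m → Γ.E}
    (ha : Γ.IsEnumeration a) (i j : Fin m) : a i ≠ Γ.inv (a j) :=
  fun h => by simpa using congrArg Prod.snd (@ha.1 (i, true) (j, false) (by simpa using h))

theorem IsEnumeration.exists_eq {Γ : MarkedGraph n} {m : ℕ} {a : Fin m → Γ.E}
    (ha : Γ.IsEnumeration a) (e : Γ.E) : ∃ i, e = a i ∨ e = Γ.inv (a i) := by
  obtain ⟨⟨i, b⟩, rfl⟩ := ha.2 e
  refine ⟨i, ?_⟩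
  cases b <;> simp

theorem IsEnumeration.cnt_edge {Γ : MarkedGraph n} {m : ℕ} {a : Fin m → Γ.E}
    (ha : Γ.IsEnumeration a) (i j : Fin m) :
    Γ.cnt (a i) (Γ.edge (a j)) = if i = j then 1 else 0 := by
  rw [FinGraph.cnt_edge, if_neg (ha.ne_inv j i), sub_zero]
  simp only [ha.eq_iff, eq_comm]

/-- Coordinates of the petals with respect to the marking, in homology. -/
noncomputable def petalMatrix (Γ : MarkedGraph n) (hΓ : Γ.IsRose) {m : ℕ} (a : Fin m → Γ.E) :
    Matrix (Fin n) (Fin m) ℤ :=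
  fun l j => expo l ((Γ.pathEquiv hΓ).symm (Γ.edge (a j)))

/-- Labels and homology classes of petals are dual bases. The number `m` of petals is left free
because `m = n` is derived from the two inverse relations. -/
theorem label_mul_petalMatrix (Γ : MarkedGraph n) (hΓ : Γ.IsRose) {m : ℕ} {a : Fin m → Γ.E}
    (ha : Γ.IsEnumeration a) :
    (Matrix.of fun i => Γ.label (a i)) * Γ.petalMatrix hΓ a = 1 := by
  ext i j
  rw [Matrix.mul_apply, Matrix.one_apply, ← ha.cnt_edge]
  exact Γ.sum_label_mul_expo hΓ _ _

theorem petalMatrix_mul_label (Γ : MarkedGraph n) (hΓ : Γ.IsRose) {m : ℕ} {a : Fin m → Γ.E}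
    (ha : Γ.IsEnumeration a) :
    Γ.petalMatrix hΓ a * (Matrix.of fun i => Γ.label (a i)) = 1 := by
  ext l i
  have key : ∀ y : Γ.PathGroup, ∑ j, Γ.petalMatrix hΓ a l j * Γ.cnt (a j) y =
      expo l ((Γ.pathEquiv hΓ).symm y) := by
    refine Γ.hom_eq_of_edge (fun x y => ?_) (fun x y => by rw [map_mul, expo_mul]) fun e => ?_
    · simp only [cnt_mul, mul_add, Finset.sum_add_distrib]
    · obtain ⟨j, rfl | rfl⟩ := ha.exists_eq e
      · simp [ha.cnt_edge, petalMatrix]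
      · simp only [edge_inv, cnt_inv, map_inv, ha.cnt_edge]
        have : ∀ x : F n, expo l x⁻¹ = - expo l x := fun x => by simp [expo]
        simp [this, petalMatrix]
  rw [Matrix.mul_apply, Matrix.one_apply]
  refine (key (Γ.marking (FreeGroup.of i))).trans ?_
  rw [← Γ.pathEquiv_apply hΓ, MulEquiv.symm_apply_apply, expo_of]
  simp only [eq_comm]

theorem exists_standard (Γ : MarkedGraph n) (hΓ : Γ.IsRose) :
    ∃ a : Fin n → Γ.E, Γ.IsEnumeration a ∧ IsStandard (Matrix.of fun i => Γ.label (a i)) := by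
  classical
  have hfin : (Set.range fun e => vecNorm (Γ.label e)).Finite := Set.finite_range _
  let s := hfin.toFinset
  obtain ⟨m, hm⟩ : ∃ m, s.card = m := ⟨_, rfl⟩
  -- The set of norms is listed increasingly, while standard representatives have decreasing rows;
  -- hence `i.rev`.
  have hs : ∀ i : Fin m, ∃ e, vecNorm (Γ.label e) = s.orderEmbOfFin hm i.rev := fun i => by
    have := s.orderEmbOfFin_mem hm i.rev
    rwa [Set.Finite.mem_toFinset] at this
  choose a ha using hs
  have hanti : StrictAnti fun i => vecNorm (Γ.label (a i)) := by
    intro i j hij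
    simp only [ha]
    exact (s.orderEmbOfFin hm).strictMono (Fin.rev_lt_rev.2 hij)
  have henum : Γ.IsEnumeration a := by
    constructor
    · rintro ⟨i, b⟩ ⟨j, b'⟩ h
      have h1 : vecNorm (Γ.label (a i)) = vecNorm (Γ.label (a j)) := by
        have := congrArg (fun e => vecNorm (Γ.label e)) h
        cases b <;> cases b' <;> simpa [label_inv, vecNorm_neg] using this
      obtain rfl := hanti.injective h1
      have h2 := Γ.inv_ne (a i)
      cases b <;> cases b' <;> simp_all [eq_comm]
    · intro e
      have he : vecNorm (Γ.label e) ∈ s := by simp [s]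
      have : vecNorm (Γ.label e) ∈ Set.range (s.orderEmbOfFin hm) := by
        rw [Finset.range_orderEmbOfFin]; exact he
      obtain ⟨i, hi⟩ := this
      have h1 : vecNorm (Γ.label e) = vecNorm (Γ.label (a i.rev)) := by
        rw [ha, Fin.rev_rev, hi]
      rcases Γ.eq_or_eq_inv_of_vecNorm_label_eq hΓ h1 with h | h
      · exact ⟨(i.rev, true), by simp [h]⟩
      · exact ⟨(i.rev, false), by simp [h]⟩
  have hcard : m = n := by
    have := (Matrix.toLin'OfInv (Γ.petalMatrix_mul_label hΓ henum)
      (Γ.label_mul_petalMatrix hΓ henum)).finrank_eq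
    simpa using this.symm
  subst hcard
  exact ⟨a, henum, hanti⟩

/-- The norms of the labels of the edges. -/
def normSet (Γ : MarkedGraph n) : Set (Lex (Fin n → ℕ)) := Set.range fun e => vecNorm (Γ.label e)

theorem IsMarkingMatrix.range_vecNorm {Γ : MarkedGraph n} {M : Matrix (Fin n) (Fin n) ℤ}
    (h : Γ.IsMarkingMatrix M) : (Set.range fun i => vecNorm (M i)) = Γ.normSet := by
  obtain ⟨a, ha, hM⟩ := h
  ext w
  constructor
  · rintro ⟨i, rfl⟩
    exact ⟨a i, by simp only [hM]⟩
  · rintro ⟨e, rfl⟩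
    obtain ⟨i, rfl | rfl⟩ := IsEnumeration.exists_eq ha e
    · exact ⟨i, by simp only [hM]⟩
    · exact ⟨i, by simp only [hM, label_inv, vecNorm_neg]⟩

end MarkedGraph

/-! ### Norms of matrices as determined by the set of row norms. -/

theorem IsStandard.strictMono {n : ℕ} {M : Matrix (Fin n) (Fin n) ℤ} (hM : IsStandard M) :
    StrictMono fun i : Fin n => vecNorm (M i.rev) :=
  fun _ _ h => hM (Fin.rev_lt_rev.2 h)

theorem range_vecNorm_rev {n : ℕ} (M : Matrix (Fin n) (Fin n) ℤ) :
    (Set.range fun i : Fin n => vecNorm (M i.rev)) = Set.range fun i => vecNorm (M i) :=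
  Fin.revPerm.surjective.range_comp fun i => vecNorm (M i)

/-- A strictly increasing enumeration is determined by its range, so the norm of a rose does not
depend on choices. -/
theorem IsStandard.matNorm_eq {n : ℕ} {M N : Matrix (Fin n) (Fin n) ℤ} (hM : IsStandard M)
    (hN : IsStandard N)
    (h : (Set.range fun i => vecNorm (M i)) = Set.range fun i => vecNorm (N i)) :
    matNorm M = matNorm N := by
  rw [← range_vecNorm_rev M, ← range_vecNorm_rev N] at h
  exact congrArg toLex ((hM.strictMono.range_inj hN.strictMono).1 h)

theorem matNorm_lt_iff {n : ℕ} {M N : Matrix (Fin n) (Fin n) ℤ} :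
    matNorm M < matNorm N ↔ ∃ i : Fin n, (∀ j < i, vecNorm (M j.rev) = vecNorm (N j.rev)) ∧
      vecNorm (M i.rev) < vecNorm (N i.rev) := Iff.rfl

/-- The lexicographic order compares the smallest rows first, so the least norm `w` at which the two
sets differ decides: the matrix possessing it is smaller. -/
theorem IsStandard.matNorm_lt {n : ℕ} {M N : Matrix (Fin n) (Fin n) ℤ} (hM : IsStandard M)
    (hN : IsStandard N) {w : Lex (Fin n → ℕ)} (hwM : w ∈ Set.range fun i => vecNorm (M i))
    (hwN : w ∉ Set.range fun i => vecNorm (N i))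
    (h : ∀ u < w, u ∈ (Set.range fun i => vecNorm (M i)) ↔
      u ∈ Set.range fun i => vecNorm (N i)) :
    matNorm M < matNorm N := by
  rw [← range_vecNorm_rev M, ← range_vecNorm_rev N] at *
  refine lt_of_not_ge fun hle => ?_
  rcases hle.lt_or_eq with hlt | heq
  · obtain ⟨i, hi, hlt⟩ := matNorm_lt_iff.1 hlt
    obtain ⟨k, rfl⟩ := hwM
    -- At the first difference `i` the row of `N` would be smaller. Before `i` the rows agree, so
    -- the row of norm `w`, missing from `N`, comes no earlier than `i`; and `i = k` is excluded by
    -- agreement below `w`.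
    have h1 : i < k := by
      rcases lt_trichotomy i k with h | rfl | h
      · exact h
      · refine absurd ⟨i, ?_⟩ fun hmem => hwN hmem
        exact absurd ((h _ hlt).2 ⟨i, rfl⟩) (by
          rintro ⟨j, hj⟩
          simp only at hj
          rcases lt_trichotomy j i with h2 | rfl | h2
          · rw [← hi j h2] at hj
            exact h2.ne (hN.strictMono.injective hj)
          · rw [hj] at hlt; exact lt_irrefl _ hlt
          · exact absurd (hM.strictMono h2) (by simp only [hj]; exact hlt.le.not_gt))
      · exact absurd ⟨k, hi k h⟩ hwN
    obtain ⟨j, hj⟩ := (h _ (hlt.trans (hM.strictMono h1))).2 ⟨i, rfl⟩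
    simp only at hj
    rcases lt_trichotomy j i with h2 | rfl | h2
    · rw [← hi j h2] at hj
      exact h2.ne (hN.strictMono.injective hj)
    · rw [hj] at hlt; exact lt_irrefl _ hlt
    · exact absurd (hM.strictMono h2) (by simp only [hj]; exact hlt.le.not_gt)
  · obtain ⟨k, rfl⟩ := hwM
    exact hwN ⟨k, congrFun (toLex_inj.1 heq) k⟩

namespace MarkedGraph

variable {n : ℕ}

/-- The rose `Δ` has smaller norm than the rose `Γ`. -/
def NormLT (Δ Γ : MarkedGraph n) : Prop :=
  ∃ M N, Δ.IsMarkingMatrix M ∧ IsStandard M ∧ Γ.IsMarkingMatrix N ∧ IsStandard N ∧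
    matNorm M < matNorm N

theorem normLT_of_normSet {Δ Γ : MarkedGraph n} (hΔ : Δ.IsRose) (hΓ : Γ.IsRose)
    {w : Lex (Fin n → ℕ)} (h1 : w ∈ Δ.normSet) (h2 : w ∉ Γ.normSet)
    (h : ∀ u < w, u ∈ Δ.normSet ↔ u ∈ Γ.normSet) : Δ.NormLT Γ := by
  obtain ⟨a, ha, has⟩ := Δ.exists_standard hΔ
  obtain ⟨b, hb, hbs⟩ := Γ.exists_standard hΓ
  have hM : Δ.IsMarkingMatrix (Matrix.of fun i => Δ.label (a i)) := ⟨a, ha, fun _ => rfl⟩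
  have hN : Γ.IsMarkingMatrix (Matrix.of fun i => Γ.label (b i)) := ⟨b, hb, fun _ => rfl⟩
  refine ⟨_, _, hM, has, hN, hbs, has.matNorm_lt hbs (w := w) ?_ ?_ ?_⟩
  · rwa [hM.range_vecNorm]
  · rwa [hN.range_vecNorm]
  · rwa [hM.range_vecNorm, hN.range_vecNorm]

end MarkedGraph

namespace FinGraph

/-! ### Contracting a single edge joining the two vertices of a graph -/

section Contract

variable (S : FinGraph) (x₀ : S.E)

/-- The one-vertex graph obtained by contracting `x₀`. -/
def contract : FinGraph where
  V := Unit
  E := {x : S.E // x ≠ x₀ ∧ x ≠ S.inv x₀}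
  finite_V := inferInstance
  finite_E := inferInstance
  src _ := ()
  inv x := ⟨S.inv x.1, fun h => x.2.2 (S.inv_eq_comm.1 h), fun h => x.2.1 (S.inv_injective h)⟩
  inv_inv _ := Subtype.ext (S.inv_inv _)
  inv_ne _ h := S.inv_ne _ (congrArg Subtype.val h)

instance : Subsingleton (S.contract x₀).V := inferInstanceAs (Subsingleton Unit)

variable {S x₀}

theorem pair_isForest (hne : S.src x₀ ≠ S.tgt x₀) : S.IsForest {x₀, S.inv x₀} := by
  intro v l hF hr hl
  rcases l with _ | ⟨e, _ | ⟨f, l⟩⟩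
  · rfl
  · rcases hF e (by simp) with rfl | rfl
    · exact absurd (hl.1.trans hl.2.symm) hne
    · have h1 : S.tgt x₀ = v := hl.1
      have h2 : S.tgt (S.inv x₀) = v := hl.2
      rw [S.tgt_inv] at h2
      exact absurd (h2.trans h1.symm) hne
  · have hef : f ≠ S.inv e := (List.isChain_cons_cons.1 hr).1
    have h1 : S.src f = S.tgt e := hl.2.1
    rcases hF e (by simp) with rfl | rfl <;> rcases hF f (by simp) with rfl | rfl
    · exact absurd h1 hne
    · exact absurd rfl hef
    · exact absurd (S.inv_inv f).symm hef
    · rw [S.tgt_inv] at h1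
      exact absurd h1.symm hne

/-- The collapse of a single edge joining the two vertices of a graph. -/
def contractCollapse (hne : S.src x₀ ≠ S.tgt x₀) (hV : ∀ v, v = S.src x₀ ∨ v = S.tgt x₀) :
    S.Collapse (S.contract x₀) where
  forest := {x₀, S.inv x₀}
  inv_mem := by
    rintro e (rfl | rfl)
    · exact Or.inr rfl
    · exact Or.inl (S.inv_inv _)
  isForest := pair_isForest hne
  onV _ := ()
  onE := Equiv.subtypeEquivRight fun x => by simp
  onV_surjective _ := ⟨S.src x₀, rfl⟩
  onV_eq_iff v w := by
    refine ⟨fun _ => ?_, fun _ => rfl⟩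
    have h1 : S.IsPath (S.src x₀) [x₀] (S.tgt x₀) := ⟨rfl, rfl⟩
    have h2 : S.IsPath (S.tgt x₀) [S.inv x₀] (S.src x₀) := ⟨rfl, S.tgt_inv _⟩
    rcases hV v with rfl | rfl <;> rcases hV w with rfl | rfl
    · exact ⟨[], by simp, rfl⟩
    · exact ⟨_, by simp, h1⟩
    · exact ⟨_, by simp, h2⟩
    · exact ⟨[], by simp, rfl⟩
  src_onE _ := rfl
  inv_onE e f h := Subtype.ext h.symm

open Classical in
/-- The tree paths for the collapse of a single edge. -/
noncomputable def contractTreePaths (hne : S.src x₀ ≠ S.tgt x₀)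
    (hV : ∀ v, v = S.src x₀ ∨ v = S.tgt x₀) : (contractCollapse hne hV).TreePaths (S.tgt x₀) where
  path v := if v = S.tgt x₀ then [] else [S.inv x₀]
  isPath v := by
    rcases hV v with rfl | rfl
    · rw [if_neg hne]; exact ⟨rfl, S.tgt_inv _⟩
    · rw [if_pos rfl]; rfl
  mem_forest v e he := by
    split_ifs at he
    · simp at he
    · exact Or.inr (List.mem_singleton.1 he)
  word_mul_edge := by
    rintro e (rfl | rfl)
    · rw [if_neg hne, if_pos rfl]; simp [edge_inv]
    · have h1 : S.src (S.inv x₀) = S.tgt x₀ := rfl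
      rw [S.tgt_inv, h1, if_neg hne, if_pos rfl]; simp
  path_base := if_pos rfl

end Contract

end FinGraph

namespace MarkedGraph

open FinGraph

variable {n : ℕ}

section ContractMarked

variable (S : MarkedGraph n) (x₀ : S.E) (hne : S.src x₀ ≠ S.tgt x₀)
  (hV : ∀ v, v = S.src x₀ ∨ v = S.tgt x₀) (hb : S.base = S.tgt x₀)
  (hcard : 3 ≤ Nat.card {x : S.E // x ≠ x₀ ∧ x ≠ S.inv x₀})

/-- The rose obtained from a marked graph with two vertices by collapsing an edge. -/
noncomputable def contract : MarkedGraph n :=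
  { S.toFinGraph.contract x₀ with
    connected := fun _ _ => ⟨[], rfl⟩
    no_separating := fun _ => ⟨[], by simp, rfl⟩
    valence := fun v => by
      refine hcard.trans (le_of_eq ?_)
      exact Nat.card_congr (Equiv.subtypeUnivEquiv (p := fun x : (S.toFinGraph.contract x₀).E =>
        (S.toFinGraph.contract x₀).src x = v) fun _ => rfl).symm
    base := ()
    marking := S.marking.trans ((MulEquiv.subgroupCongr (by rw [hb])).trans
      ((contractTreePaths hne hV).pi1Equiv ())) }

theorem contract_isRose : (S.contract x₀ hne hV hb hcard).IsRose :=
  inferInstanceAs (Subsingleton Unit)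

theorem contract_marking (x : F n) : (contractCollapse hne hV).map (S.marking x) =
    ((S.contract x₀ hne hV hb hcard).marking x).1 := rfl

theorem collapsesTo_contract : S.CollapsesTo (S.contract x₀ hne hV hb hcard) :=
  ⟨contractCollapse hne hV, [], rfl, fun x => by
    rw [word_nil, one_mul, inv_one, mul_one]; exact S.contract_marking x₀ hne hV hb hcard x⟩

theorem label_contract (x : {x : S.E // x ≠ x₀ ∧ x ≠ S.inv x₀}) :
    (S.contract x₀ hne hV hb hcard).label x = S.label x.1 := by
  have := label_onE (Γ := S) (Δ := S.contract x₀ hne hV hb hcard)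
    (c := contractCollapse hne hV) (l := []) (fun y => by
    rw [word_nil, one_mul, inv_one, mul_one]; exact S.contract_marking x₀ hne hV hb hcard y)
    ⟨x.1, by rintro (h | h); exacts [x.2.1 h, x.2.2 h]⟩
  exact this

end ContractMarked

/-! ### Descending sets of oriented petals -/

/-- The sum of the labels of a set of oriented edges. -/
noncomputable def labelSum (Γ : MarkedGraph n) (α : Set Γ.E) : Fin n → ℤ :=
  ∑ h ∈ (Set.toFinite α).toFinset, Γ.label h

open Classical in
theorem labelSum_eq (Γ : MarkedGraph n) [Fintype Γ.E] (α : Set Γ.E) :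
    Γ.labelSum α = ∑ h, if h ∈ α then Γ.label h else 0 := by
  rw [labelSum, ← Finset.sum_filter]
  refine Finset.sum_congr ?_ fun _ _ => rfl
  ext; simp

theorem label_eq_labelSum_cut {Γ Δ : MarkedGraph n} {c : Γ.toFinGraph.Collapse Δ.toFinGraph}
    {l : List Δ.E} (hΔ : Δ.IsRose)
    (hx : ∀ x, c.map (Γ.marking x) = Δ.word l * Δ.marking x * (Δ.word l)⁻¹)
    {e₀ : Γ.E} (he₀ : e₀ ∈ c.forest) : Γ.label e₀ = Δ.labelSum (c.cut e₀) := by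
  have := Fintype.ofFinite Δ.E
  rw [label_eq_sum_cut hΔ hx he₀, labelSum_eq]

theorem sum_label (Γ : MarkedGraph n) [Fintype Γ.E] : ∑ h, Γ.label h = 0 := by
  have h1 : ∑ h, Γ.label h = ∑ h, Γ.label (Γ.inv h) :=
    (Equiv.sum_comp (Function.Involutive.toPerm Γ.inv Γ.inv_inv) Γ.label).symm
  simp only [label_inv, Finset.sum_neg_distrib] at h1
  exact self_eq_neg.1 h1

/-- The labels of a petal and its inverse cancel, so the sum over all oriented petals is zero. A set
and its complement describe one ideal edge with its two orientations. -/
theorem labelSum_compl (Γ : MarkedGraph n) (α : Set Γ.E) :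
    Γ.labelSum αᶜ = - Γ.labelSum α := by
  classical
  have := Fintype.ofFinite Γ.E
  rw [eq_neg_iff_add_eq_zero, labelSum_eq, labelSum_eq, ← Finset.sum_add_distrib]
  refine Eq.trans (Finset.sum_congr rfl fun h _ => ?_) Γ.sum_label
  by_cases hh : h ∈ α <;> simp [hh]

/-- A set of oriented petals is descending if the label of the corresponding ideal edge is
smaller than that of some petal which is separated by it. -/
def IsDescending (Γ : MarkedGraph n) (α : Set Γ.E) : Prop :=
  ∃ h ∈ α, Γ.inv h ∉ α ∧ vecNorm (Γ.labelSum α) < vecNorm (Γ.label h)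

namespace IsDescending

variable {Γ : MarkedGraph n} {α β : Set Γ.E}

theorem compl (hα : Γ.IsDescending α) : Γ.IsDescending αᶜ := by
  obtain ⟨h, h1, h2, h3⟩ := hα
  refine ⟨Γ.inv h, h2, fun h4 => h4 (by rwa [Γ.inv_inv]), ?_⟩
  rwa [labelSum_compl, label_inv, vecNorm_neg, vecNorm_neg]

/-- A singleton has the label of its own petal as sum, which is not smaller. This supplies the
valence condition in blow-ups. -/
theorem two_le_card (hα : Γ.IsDescending α) : 2 ≤ Nat.card α := by
  obtain ⟨h, h1, -, h3⟩ := hα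
  by_contra! hlt
  have h4 : (Set.toFinite α).toFinset = {h} := by
    have h5 : (Set.toFinite α).toFinset.card ≤ 1 := by
      rw [← Set.ncard_eq_toFinset_card α, ← Nat.card_coe_set_eq]; omega
    exact Finset.eq_singleton_iff_unique_mem.2 ⟨by simpa using h1, fun x hx =>
      Finset.card_le_one.1 h5 x hx h (by simpa using h1)⟩
  rw [labelSum, h4, Finset.sum_singleton] at h3
  exact lt_irrefl _ h3

theorem isValidStar {K : Type} [Finite K] {g : Γ.E → Option K}
    (hg : ∀ k, Γ.IsDescending {h | g h = some k})
    (h3 : 3 ≤ Nat.card K + Nat.card {h // g h = none}) : Γ.IsValidStar K g where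
  two_le k := (hg k).two_le_card
  three_le := h3
  exists_crossing k := by
    obtain ⟨h, h1, h2, -⟩ := hg k
    exact ⟨h, h1, h2⟩

theorem isValidStar_sideMap (hα : Γ.IsDescending α) : Γ.IsValidStar Unit (sideMap α) := by
  refine isValidStar (fun k => ?_) ?_
  · have : {h | sideMap α h = some k} = α := by ext h; exact sideMap_eq_some
    rwa [this]
  · have h1 := hα.compl.two_le_card
    have h2 : Nat.card {h // sideMap α h = none} = Nat.card (αᶜ : Set Γ.E) :=
      Nat.card_congr (Equiv.subtypeEquivRight fun h => sideMap_eq_none)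
    rw [h2, Nat.card_unique]
    omega

/-- The blow-up of a rose with one descending edge. -/
noncomputable def split (hα : Γ.IsDescending α) (hΓ : Γ.IsRose) : MarkedGraph n :=
  Γ.star hΓ hα.isValidStar_sideMap

theorem split_collapsesTo (hα : Γ.IsDescending α) (hΓ : Γ.IsRose) :
    (hα.split hΓ).CollapsesTo Γ := Γ.star_collapsesTo hΓ _

theorem label_star_inl {K : Type} [Finite K] {g : Γ.E → Option K} (hΓ : Γ.IsRose)
    (hg : Γ.IsValidStar K g) (h : Γ.E) : (Γ.star hΓ hg).label (Sum.inl h) = Γ.label h := by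
  have : Subsingleton Γ.V := hΓ
  have := label_onE (Γ := Γ.star hΓ hg) (Δ := Γ) (l := [])
    (c := starCollapse Γ.toFinGraph K g Γ.base) (fun x => by
      rw [word_nil, one_mul, inv_one, mul_one]
      exact (starTreePaths Γ.toFinGraph K g Γ.base).map_pi1Equiv_symm Γ.base (Γ.marking x))
    ⟨Sum.inl h, inl_notMem _ _ _ _ h⟩
  exact this.symm.trans (congrArg Γ.label (starCollapse_onE Γ.toFinGraph K g Γ.base h _))

theorem side_star {R : FinGraph} [Subsingleton R.V] {K : Type} [Finite K] (g : R.E → Option K)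
    (r : R.V) (k : K) : (starCollapse R K g r).side (Sum.inr (k, true)) = {some k} := by
  ext v
  constructor
  · rintro ⟨l, hl, hp⟩
    cases l with
    | nil => exact hp.symm
    | cons e l =>
      obtain ⟨⟨⟨k', b⟩, rfl⟩, h1, h2⟩ := hl e (by simp)
      have h3 : (starGraph R K g).src (Sum.inr (k', b)) = some k := hp.1
      cases b
      · simp at h3 h2; exact absurd h3 h2
      · simp at h3
  · rintro rfl
    exact Collapse.tgt_mem_side

theorem cut_star {R : FinGraph} [Subsingleton R.V] {K : Type} [Finite K] (g : R.E → Option K)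
    (r : R.V) (k : K) :
    (starCollapse R K g r).cut (Sum.inr (k, true)) = {h | g h = some k} := by
  ext h
  rw [Collapse.cut, side_star, Set.mem_ofPred_eq, starCollapse_onE_symm]
  rfl

theorem label_star_inr {K : Type} [Finite K] {g : Γ.E → Option K} (hΓ : Γ.IsRose)
    (hg : Γ.IsValidStar K g) (k : K) :
    (Γ.star hΓ hg).label (Sum.inr (k, true)) = Γ.labelSum {h | g h = some k} := by
  have : Subsingleton Γ.V := hΓ
  have := label_eq_labelSum_cut (Γ := Γ.star hΓ hg) (Δ := Γ) (l := []) hΓ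
    (c := starCollapse Γ.toFinGraph K g Γ.base) (fun x => by
      rw [word_nil, one_mul, inv_one, mul_one]
      exact (starTreePaths Γ.toFinGraph K g Γ.base).map_pi1Equiv_symm Γ.base (Γ.marking x))
    (e₀ := Sum.inr (k, true)) ⟨_, rfl⟩
  exact this.trans (congrArg Γ.labelSum (cut_star g Γ.base k))

/-- The crossing petal `h` joins the two vertices of the blow-up, so it may be collapsed instead of
the new edge. The labels of the resulting rose are those of Γ with that of `h` replaced by the
smaller sum over α. -/
theorem exists_normLT (hα : Γ.IsDescending α) (hΓ : Γ.IsRose) :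
    ∃ Δ : MarkedGraph n, Δ.IsRose ∧ (hα.split hΓ).CollapsesTo Δ ∧ Δ.NormLT Γ := by
  classical
  obtain ⟨h, h1, h2, h3⟩ := id hα
  let S := hα.split hΓ
  have hsrc : S.src (Sum.inl h) = some () := sideMap_eq_some.2 h1
  have htgt : S.tgt (Sum.inl h) = none := sideMap_eq_none.2 h2
  have hne : S.src (Sum.inl h) ≠ S.tgt (Sum.inl h) := by
    rw [hsrc, htgt]; exact Option.some_ne_none _
  have hV : ∀ v, v = S.src (Sum.inl h) ∨ v = S.tgt (Sum.inl h) := by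
    rw [hsrc, htgt]
    rintro (_ | ⟨⟩)
    · exact Or.inr rfl
    · exact Or.inl rfl
  have hcard : 3 ≤ Nat.card {x : S.E // x ≠ Sum.inl h ∧ x ≠ S.inv (Sum.inl h)} := by
    refine (Γ.valence Γ.base).trans ?_
    -- The two orientations of the new edge take the places of `h` and its inverse, so the valence
    -- of the rose does not drop.
    have hinj : Function.Injective fun e : Γ.E => (if e = h then Sum.inr ((), true)
        else if e = Γ.inv h then Sum.inr ((), false) else Sum.inl e : Γ.E ⊕ Unit × Bool) := by
      intro e f hef
      simp only at hef
      split_ifs at hef <;> simp_all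
    refine Nat.card_le_card_of_injective (fun e =>
      (⟨if e.1 = h then Sum.inr ((), true) else if e.1 = Γ.inv h then Sum.inr ((), false)
        else Sum.inl e.1, ?_⟩ : {x : Γ.E ⊕ Unit × Bool // x ≠ Sum.inl h ∧ x ≠ Sum.inl (Γ.inv h)})) ?_
    · split_ifs with h4 h5 <;> simp_all
    · rintro ⟨e, he⟩ ⟨f, hf⟩ hef
      exact Subtype.ext (hinj (congrArg Subtype.val hef))
  let Δ := S.contract (Sum.inl h) hne hV htgt.symm hcard
  have hΔ : Δ.IsRose := S.contract_isRose _ _ _ _ _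
  have hlab := S.label_contract (Sum.inl h) hne hV htgt.symm hcard
  have hinl : ∀ e : Γ.E, S.label (Sum.inl e) = Γ.label e := label_star_inl hΓ _
  have hinr : S.label (Sum.inr ((), true)) = Γ.labelSum α := by
    have := label_star_inr hΓ hα.isValidStar_sideMap ()
    simp only [sideMap_eq_some] at this
    exact this
  have hinr' : vecNorm (S.label (Sum.inr ((), false))) = vecNorm (Γ.labelSum α) := by
    have : S.label (Sum.inr ((), false)) = - Γ.labelSum α := by
      rw [← hinr]; exact S.label_inv (Sum.inr ((), true))
    rw [this, vecNorm_neg]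
  have hmem : ∀ e : Γ.E, e ≠ h → e ≠ Γ.inv h →
      (Sum.inl e : Γ.E ⊕ Unit × Bool) ≠ Sum.inl h ∧
      (Sum.inl e : Γ.E ⊕ Unit × Bool) ≠ Sum.inl (Γ.inv h) := by
    intro e h4 h5; simp [h4, h5]
  let xt : Δ.E := (⟨Sum.inr ((), true), by constructor <;> exact Sum.inr_ne_inl⟩ :
    {x : S.E // x ≠ Sum.inl h ∧ x ≠ S.inv (Sum.inl h)})
  have hlt : ∀ e : Γ.E, vecNorm (Γ.label e) ≤ vecNorm (Γ.labelSum α) → e ≠ h ∧ e ≠ Γ.inv h := by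
    intro e he
    constructor
    · rintro rfl; exact absurd h3 he.not_gt
    · rintro rfl
      rw [label_inv, vecNorm_neg] at he
      exact absurd h3 he.not_gt
  refine ⟨Δ, hΔ, S.collapsesTo_contract _ _ _ _ _,
    normLT_of_normSet hΔ hΓ (w := vecNorm (Γ.labelSum α)) ⟨xt, ?_⟩ ?_ ?_⟩
  · simp only
    rw [← hinr]
    exact congrArg vecNorm (hlab ⟨Sum.inr ((), true), xt.2⟩)
  · rintro ⟨e, he⟩
    simp only at he
    obtain ⟨h4, h5⟩ := hlt e he.le
    let xe : Δ.E := (⟨Sum.inl e, hmem e h4 h5⟩ :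
      {x : S.E // x ≠ Sum.inl h ∧ x ≠ S.inv (Sum.inl h)})
    -- If the new norm already occurred in Γ, the petal carrying it would survive in Δ next to the
    -- new edge, and two different petals of Δ would have equal norm.
    have h6 : vecNorm (Δ.label xe) = vecNorm (Δ.label xt) := by
      have h7 : Δ.label xe = Γ.label e := (hlab ⟨Sum.inl e, hmem e h4 h5⟩).trans (hinl e)
      have h8 : Δ.label xt = Γ.labelSum α := (hlab ⟨Sum.inr ((), true), xt.2⟩).trans hinr
      rw [h7, h8, he]
    rcases Δ.eq_or_eq_inv_of_vecNorm_label_eq hΔ h6 with h7 | h7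
    · exact Sum.inl_ne_inr (congrArg Subtype.val h7)
    · exact Sum.inl_ne_inr (congrArg Subtype.val h7)
  · intro u hu
    constructor
    · rintro ⟨⟨e | ⟨⟨⟩, b⟩, hx⟩, rfl⟩
      · exact ⟨e, congrArg vecNorm ((hlab ⟨Sum.inl e, hx⟩).trans (hinl e)).symm⟩
      · exfalso
        refine hu.ne ((congrArg vecNorm (hlab ⟨Sum.inr ((), b), hx⟩)).trans ?_)
        cases b
        · exact hinr'
        · exact congrArg vecNorm hinr
    · rintro ⟨e, rfl⟩
      obtain ⟨h4, h5⟩ := hlt e hu.le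
      exact ⟨(⟨Sum.inl e, hmem e h4 h5⟩ :
        {x : S.E // x ≠ Sum.inl h ∧ x ≠ S.inv (Sum.inl h)}),
        congrArg vecNorm ((hlab ⟨Sum.inl e, hmem e h4 h5⟩).trans (hinl e))⟩

end IsDescending

end MarkedGraph

/-! ### Descending forest edges and common blow-ups. -/

namespace MarkedGraph

open FinGraph

variable {n : ℕ}

theorem labelSum_eq_zero (Γ : MarkedGraph n) {α : Set Γ.E} (h : ∀ e ∈ α, Γ.inv e ∈ α) :
    Γ.labelSum α = 0 := by
  refine Finset.sum_involution (fun e _ => Γ.inv e) (fun e _ => ?_) (fun e _ _ => Γ.inv_ne e)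
    (fun e he => ?_) fun e _ => Γ.inv_inv e
  · rw [label_inv, add_neg_cancel]
  · rw [Set.Finite.mem_toFinset] at he ⊢
    exact h e he

theorem labelSum_union (Γ : MarkedGraph n) {α β : Set Γ.E} (h : Disjoint α β) :
    Γ.labelSum (α ∪ β) = Γ.labelSum α + Γ.labelSum β := by
  classical
  have := Fintype.ofFinite Γ.E
  rw [labelSum_eq, labelSum_eq, labelSum_eq, ← Finset.sum_add_distrib]
  refine Finset.sum_congr rfl fun e _ => ?_
  have : e ∈ α → e ∉ β := fun h1 => Set.disjoint_left.1 h h1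
  by_cases h1 : e ∈ α
  · simp [h1, this h1]
  · simp [h1]

/-- The petals with exactly one end in `α`, oriented so as to start in `α`. -/
def crossing (Γ : MarkedGraph n) (α : Set Γ.E) : Set Γ.E := {e | e ∈ α ∧ Γ.inv e ∉ α}

/-- A petal with both ends in α contributes its label and the negative of it. -/
theorem labelSum_crossing (Γ : MarkedGraph n) (α : Set Γ.E) :
    Γ.labelSum (Γ.crossing α) = Γ.labelSum α := by
  have h1 : α = Γ.crossing α ∪ {e | e ∈ α ∧ Γ.inv e ∈ α} := by
    ext e; simp only [crossing, Set.mem_union, Set.mem_ofPred_eq]; tauto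
  have h2 : Disjoint (Γ.crossing α) {e | e ∈ α ∧ Γ.inv e ∈ α} :=
    Set.disjoint_left.2 fun e h h' => h.2 h'.2
  conv_rhs => rw [h1, Γ.labelSum_union h2, Γ.labelSum_eq_zero
    (α := {e | e ∈ α ∧ Γ.inv e ∈ α}) fun e h => ⟨h.2, by rw [Γ.inv_inv]; exact h.1⟩, add_zero]

theorem IsDescending.crossing {Γ : MarkedGraph n} {α : Set Γ.E} (hα : Γ.IsDescending α) :
    Γ.IsDescending (Γ.crossing α) := by
  obtain ⟨h, h1, h2, h3⟩ := hα
  exact ⟨h, ⟨h1, h2⟩, fun h4 => h2 h4.1, by rwa [labelSum_crossing]⟩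

/-- If no forest edge descends, every label of `A`, hence every label of Δ, lies in the span of the
labels of Γ of no larger norm. Then the small rows for Δ are too many to be independent. -/
theorem exists_isDescending_cut {A Γ Δ : MarkedGraph n} (hΓ : Γ.IsRose) (hΔ : Δ.IsRose)
    {c : A.toFinGraph.Collapse Γ.toFinGraph} {l : List Γ.E}
    (hx : ∀ x, c.map (A.marking x) = Γ.word l * Γ.marking x * (Γ.word l)⁻¹)
    (hAΔ : A.CollapsesTo Δ) (hlt : Δ.NormLT Γ) :
    ∃ e₀ ∈ c.forest, Γ.IsDescending (c.cut e₀) := by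
  by_contra! hcon
  have key : ∀ d : A.E, A.label d ∈
      Submodule.span ℤ (Γ.label '' {h | vecNorm (Γ.label h) ≤ vecNorm (A.label d)}) := by
    intro d
    by_cases hd : d ∈ c.forest
    · have h1 : A.label d = Γ.labelSum (c.cut d) := label_eq_labelSum_cut hΓ hx hd
      rw [h1, ← labelSum_crossing]
      refine Submodule.sum_mem _ fun h hh => Submodule.subset_span ⟨h, ?_, rfl⟩
      rw [Set.Finite.mem_toFinset] at hh
      by_contra! h2
      exact hcon d hd ⟨h, hh.1, hh.2, by rw [← labelSum_crossing]; exact lt_of_not_ge h2⟩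
    · have h1 : Γ.label (c.onE ⟨d, hd⟩) = A.label d := label_onE hx ⟨d, hd⟩
      exact Submodule.subset_span ⟨c.onE ⟨d, hd⟩, by simp [h1], h1⟩
  obtain ⟨M, N, ⟨b, hb, hM⟩, hMs, ⟨a, ha, hN⟩, hNs, hMN⟩ := hlt
  -- At this index the `i + 1` smallest rows of `M` all have norm below the corresponding row of
  -- `N`, so they lie in the span of only `i` rows of `N`.
  obtain ⟨i, -, hi⟩ := matNorm_lt_iff.1 hMN
  have hMu : IsUnit M := by
    have := Δ.label_mul_petalMatrix hΔ hb
    have h1 : (Matrix.of fun i => Δ.label (b i)) = M := by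
      ext i j; simp [hM]
    rw [h1] at this
    exact IsUnit.of_mul_eq_one _ this
  have hind : LinearIndependent ℤ (fun j : Fin n => M j) := Matrix.linearIndependent_rows_of_isUnit hMu
  have hind' : LinearIndependent ℤ (fun j : Finset.Iic i => M j.1.rev) :=
    hind.comp (fun j : Finset.Iic i => j.1.rev) fun j k h => Subtype.ext (Fin.rev_injective h)
  have hspan : Set.range (fun j : Finset.Iic i => M j.1.rev) ≤ Submodule.span ℤ
      (((Finset.Iio i).image fun k => N k.rev : Finset (Fin n → ℤ)) : Set (Fin n → ℤ)) := by
    rintro _ ⟨⟨j, hj⟩, rfl⟩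
    have hj' : vecNorm (M j.rev) < vecNorm (N i.rev) :=
      lt_of_le_of_lt (hMs.strictMono.monotone (Finset.mem_Iic.1 hj)) hi
    obtain ⟨d, hd⟩ := hAΔ.range_label ⟨b j.rev, rfl⟩
    rw [← hM] at hd
    have h1 := key d
    rw [hd] at h1
    refine Submodule.span_le.2 ?_ h1
    rintro _ ⟨h, hh, rfl⟩
    have h2 : vecNorm (Γ.label h) < vecNorm (N i.rev) := lt_of_le_of_lt hh hj'
    have h3 : ∀ k, vecNorm (Γ.label h) = vecNorm (N k) → k.rev < i := by
      intro k hk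
      rw [hk] at h2
      have := hMs; have := hNs.lt_iff_gt.1 h2
      exact Fin.rev_lt_iff.1 (by simpa using this)
    obtain ⟨k, rfl | rfl⟩ := IsEnumeration.exists_eq ha h
    · refine Submodule.subset_span ?_
      rw [Finset.coe_image]
      exact ⟨k.rev, by simpa using h3 k (by rw [hN]), by simp [hN]⟩
    · rw [label_inv]
      refine Submodule.neg_mem _ (Submodule.subset_span ?_)
      rw [Finset.coe_image]
      exact ⟨k.rev, by simpa using h3 k (by rw [hN, label_inv, vecNorm_neg]), by simp [hN]⟩
  have hcard := linearIndependent_le_span' _ hind' _ hspan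
  simp only [Cardinal.mk_fintype, Nat.cast_le, Fintype.card_coe, Finset.coe_sort_coe,
    Fin.card_Iic] at hcard
  have := Finset.card_image_le (s := Finset.Iio i) (f := fun k => N k.rev)
  rw [Fin.card_Iio] at this
  omega

theorem collapsesTo_split {A Γ : MarkedGraph n} (hΓ : Γ.IsRose)
    {c : A.toFinGraph.Collapse Γ.toFinGraph} {l : List Γ.E}
    (hl : Γ.IsPath (c.onV A.base) l Γ.base)
    (hx : ∀ x, c.map (A.marking x) = Γ.word l * Γ.marking x * (Γ.word l)⁻¹)
    {e₀ : A.E} (he₀ : e₀ ∈ c.forest) {α : Set Γ.E} (hα : Γ.IsDescending α)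
    (hc : c.cut e₀ = α) : A.CollapsesTo (hα.split hΓ) := by
  subst hc
  exact collapsesTo_star hΓ hl hx he₀ _

namespace IsDescending

variable {Γ : MarkedGraph n} {α β : Set Γ.E}

theorem star_collapsesTo_split {K : Type} [Finite K] {g : Γ.E → Option K} (hΓ : Γ.IsRose)
    (hg : Γ.IsValidStar K g) (k : K) (hα : Γ.IsDescending α) (h : {h | g h = some k} = α) :
    (Γ.star hΓ hg).CollapsesTo (hα.split hΓ) := by
  have : Subsingleton Γ.V := hΓ
  refine collapsesTo_split (A := Γ.star hΓ hg) hΓ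
    (c := starCollapse Γ.toFinGraph K g Γ.base) (l := []) rfl
    (fun x => ?_) (e₀ := Sum.inr (k, true)) ⟨_, rfl⟩ hα (Eq.trans (cut_star g Γ.base k) h)
  rw [word_nil, one_mul, inv_one, mul_one]
  exact (starTreePaths Γ.toFinGraph K g Γ.base).map_pi1Equiv_symm Γ.base (Γ.marking x)

theorem side_star_false {R : FinGraph} [Subsingleton R.V] (g : R.E → Option Unit) (r : R.V) :
    (starCollapse R Unit g r).side (Sum.inr ((), false)) = {none} := by
  ext v
  constructor
  · rintro ⟨l, hl, hp⟩
    cases l with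
    | nil => exact hp.symm
    | cons e l =>
      obtain ⟨⟨⟨⟨⟩, b⟩, rfl⟩, h1, h2⟩ := hl e (by simp)
      cases b <;> simp at h1 h2
  · rintro rfl
    exact Collapse.tgt_mem_side

/-- Reversing the new edge exchanges the two sides of its cut. -/
theorem split_collapsesTo_compl (hα : Γ.IsDescending α) (hΓ : Γ.IsRose) :
    (hα.split hΓ).CollapsesTo (hα.compl.split hΓ) := by
  have : Subsingleton Γ.V := hΓ
  refine collapsesTo_split (A := hα.split hΓ) hΓ
    (c := starCollapse Γ.toFinGraph Unit (sideMap α) Γ.base)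
    (l := []) rfl (fun x => ?_) (e₀ := Sum.inr ((), false)) ⟨_, rfl⟩ hα.compl ?_
  · rw [word_nil, one_mul, inv_one, mul_one]
    exact (starTreePaths Γ.toFinGraph Unit (sideMap α) Γ.base).map_pi1Equiv_symm Γ.base (Γ.marking x)
  · ext h
    refine Iff.trans (Set.ext_iff.1 (side_star_false (sideMap α) Γ.base) _) ?_
    exact sideMap_eq_none

/-- Two descending edges given by disjoint sets have a common blow-up, or coincide. -/
theorem exists_collapsesTo (hα : Γ.IsDescending α) (hβ : Γ.IsDescending β) (hΓ : Γ.IsRose)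
    (h : Disjoint α β) :
    ∃ A : MarkedGraph n, A.CollapsesTo (hα.split hΓ) ∧ A.CollapsesTo (hβ.split hΓ) := by
  classical
  by_cases hu : α ∪ β = Set.univ
  · have hβα : αᶜ = β := by
      ext e
      have h1 : e ∈ α → e ∉ β := fun h1 => Set.disjoint_left.1 h h1
      have h2 : e ∈ α ∪ β := hu ▸ Set.mem_univ e
      constructor
      · exact fun h3 => h2.resolve_left h3
      · exact fun h3 h4 => h1 h4 h3
    subst hβα
    exact ⟨hα.split hΓ, (Equivalent.refl _).collapsesTo, hα.split_collapsesTo_compl hΓ⟩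
  · obtain ⟨e, he⟩ := (Set.ne_univ_iff_exists_notMem _).1 hu
    -- A star with two leaves, carrying α and β; a petal end outside both gives the centre its third
    -- incident edge.
    let g : Γ.E → Option Bool := fun h =>
      if h ∈ α then some true else if h ∈ β then some false else none
    have h1 : {h | g h = some true} = α := by
      ext h; simp only [g, Set.mem_ofPred_eq]; split_ifs <;> simp_all
    have h2 : {h | g h = some false} = β := by
      ext x
      have : x ∈ α → x ∉ β := fun h1 => Set.disjoint_left.1 h h1
      simp only [g, Set.mem_ofPred_eq]; split_ifs <;> simp_all
    have hne : Nonempty {h // g h = none} := ⟨e, by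
      simp only [Set.mem_union, not_or] at he
      simp [g, he]⟩
    have hg : Γ.IsValidStar Bool g := by
      refine isValidStar ?_ ?_
      · rintro (_ | _)
        · rwa [h2]
        · rwa [h1]
      · have := Nat.card_pos (α := {h // g h = none})
        simp only [Nat.card_eq_fintype_card, Fintype.card_bool] at this ⊢
        omega
    exact ⟨Γ.star hΓ hg, star_collapsesTo_split hΓ hg true hα h1,
      star_collapsesTo_split hΓ hg false hβ h2⟩

end IsDescending

end MarkedGraph

/-! ### The descending link, upstairs -/

namespace Spine

variable {n : ℕ}

/-- The topology is final for these inclusions. Only their continuity is needed: it turns straight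
segments into connected sets. -/
theorem continuous_closedSimplex {s : Finset (Vertex n)} (hs : IsSimplex (s : Set (Vertex n))) :
    letI : TopologicalSpace (closedSimplex s) :=
      TopologicalSpace.induced (fun x A => x.1.coord A : closedSimplex s → Vertex n → ℝ) inferInstance
    Continuous (fun x : closedSimplex s => x.1) := by
  let _ : TopologicalSpace (closedSimplex s) :=
      TopologicalSpace.induced (fun x A => x.1.coord A : closedSimplex s → Vertex n → ℝ) inferInstance
  exact continuous_iff_coinduced_le.2 (le_iSup (fun s : {s : Finset (Vertex n) //
    IsSimplex (s : Set (Vertex n))} => TopologicalSpace.coinduced (fun x : closedSimplex s.1 => x.1)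
      (TopologicalSpace.induced (fun x A => x.1.coord A : closedSimplex s.1 → Vertex n → ℝ)
        inferInstance)) ⟨s, hs⟩)

/-- The point of a simplex with given barycentric coordinates. -/
noncomputable def segment {s : Finset (Vertex n)} (hs : IsSimplex (s : Set (Vertex n)))
    (x y : closedSimplex s) (t : unitInterval) : closedSimplex s :=
  have hsub : ((1 - (t : ℝ)) • x.1.coord + (t : ℝ) • y.1.coord).support ⊆ s := by
    classical
    refine Finsupp.support_add.trans (Finset.union_subset ?_ ?_)
    · exact Finsupp.support_smul.trans x.2
    · exact Finsupp.support_smul.trans y.2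
  ⟨{ coord := (1 - (t : ℝ)) • x.1.coord + (t : ℝ) • y.1.coord
     nonneg := fun A => by
      have h1 := x.1.nonneg A
      have h2 := y.1.nonneg A
      have h3 := t.2.1
      have h4 : 0 ≤ 1 - (t : ℝ) := sub_nonneg.2 t.2.2
      simp only [Finsupp.add_apply, Finsupp.smul_apply, smul_eq_mul]
      positivity
     sum_eq_one := by
      have hx := x.1.sum_eq_one
      have hy := y.1.sum_eq_one
      rw [Finsupp.sum_add_index' (fun _ => rfl) (fun _ _ _ => rfl),
        Finsupp.sum_smul_index' (fun _ => rfl), Finsupp.sum_smul_index' (fun _ => rfl)]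
      simp only [Finsupp.sum, smul_eq_mul, ← Finset.mul_sum] at hx hy ⊢
      rw [hx, hy]; ring
     isSimplex := hs.mono hsub }, hsub⟩

theorem isPreconnected_closedSimplex {s : Finset (Vertex n)}
    (hs : IsSimplex (s : Set (Vertex n))) : IsPreconnected (closedSimplex s) := by
  let _ : TopologicalSpace (closedSimplex s) :=
      TopologicalSpace.induced (fun x A => x.1.coord A : closedSimplex s → Vertex n → ℝ) inferInstance
  refine isPreconnected_of_forall_pair fun x hx y hy => ?_
  refine ⟨Set.range fun t => (segment hs ⟨x, hx⟩ ⟨y, hy⟩ t).1, ?_, ⟨0, ?_⟩, ⟨1, ?_⟩, ?_⟩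
  · rintro _ ⟨t, rfl⟩
    exact (segment hs ⟨x, hx⟩ ⟨y, hy⟩ t).2
  · ext A; simp [segment]
  · ext A; simp [segment]
  · refine isPreconnected_range ((continuous_closedSimplex hs).comp (continuous_induced_rng.2 ?_))
    refine continuous_pi fun A => ?_
    change Continuous fun t : unitInterval => (1 - (t : ℝ)) * x.coord A + (t : ℝ) * y.coord A
    fun_prop

/-- The points all of whose vertices collapse both to the rose `Γ` and to one rose of smaller
norm. -/
def descending (Γ : MarkedGraph n) : Set (Spine n) :=
  {x | ∃ Δ : MarkedGraph n, Δ.IsRose ∧ Δ.NormLT Γ ∧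
    ∀ A ∈ x.coord.support, A.CollapsesTo ⟦Γ⟧ ∧ A.CollapsesTo ⟦Δ⟧}

/-- Two points lie in a common connected part of the descending link. -/
def Joined (Γ : MarkedGraph n) (x y : Spine n) : Prop :=
  ∃ t ⊆ descending Γ, x ∈ t ∧ y ∈ t ∧ IsPreconnected t

theorem Joined.symm {Γ : MarkedGraph n} {x y : Spine n} (h : Joined Γ x y) : Joined Γ y x := by
  obtain ⟨t, h1, h2, h3, h4⟩ := h
  exact ⟨t, h1, h3, h2, h4⟩

theorem Joined.trans {Γ : MarkedGraph n} {x y z : Spine n} (h : Joined Γ x y)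
    (h' : Joined Γ y z) : Joined Γ x z := by
  obtain ⟨t, h1, h2, h3, h4⟩ := h
  obtain ⟨t', h1', h2', h3', h4'⟩ := h'
  exact ⟨t ∪ t', Set.union_subset h1 h1', Or.inl h2, Or.inr h3', h4.union y h3 h2' h4'⟩

theorem joined_of_isSimplex {Γ Δ : MarkedGraph n} (hΔ : Δ.IsRose) (hlt : Δ.NormLT Γ)
    {s : Finset (Vertex n)} (hs : IsSimplex (s : Set (Vertex n)))
    (h : ∀ A ∈ s, A.CollapsesTo ⟦Γ⟧ ∧ A.CollapsesTo ⟦Δ⟧) {x y : Spine n}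
    (hx : x ∈ closedSimplex s) (hy : y ∈ closedSimplex s) : Joined Γ x y :=
  ⟨closedSimplex s, fun _ hz => ⟨Δ, hΔ, hlt, fun A hA => h A (hz hA)⟩, hx, hy,
    isPreconnected_closedSimplex hs⟩

theorem ofVertex_mem_closedSimplex {s : Finset (Vertex n)} {A : Vertex n} (hA : A ∈ s) :
    ofVertex A ∈ closedSimplex s :=
  Finsupp.support_single_subset.trans (Finset.singleton_subset_iff.2 hA)

theorem exists_mem_support (x : Spine n) : ∃ A, A ∈ x.coord.support := by
  by_contra! h
  have h1 : x.coord = 0 := Finsupp.support_eq_empty.1 (Finset.eq_empty_of_forall_notMem h)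
  have := x.sum_eq_one
  rw [h1, Finsupp.sum_zero_index] at this
  exact zero_ne_one this

theorem joined_of_collapsesTo {Γ Δ : MarkedGraph n} (hΔ : Δ.IsRose) (hlt : Δ.NormLT Γ)
    {A B : Vertex n} (hAB : A.CollapsesTo B) (hΓ : B.CollapsesTo ⟦Γ⟧) (hBΔ : B.CollapsesTo ⟦Δ⟧) :
    Joined Γ (ofVertex A) (ofVertex B) := by
  classical
  refine joined_of_isSimplex hΔ hlt (s := {A, B}) ?_ ?_
    (ofVertex_mem_closedSimplex (by simp)) (ofVertex_mem_closedSimplex (by simp))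
  · intro C hC D hD hne
    simp only [Finset.coe_insert, Finset.coe_singleton, Set.mem_insert_iff,
      Set.mem_singleton_iff] at hC hD
    rcases hC with rfl | rfl <;> rcases hD with rfl | rfl
    · exact absurd rfl hne
    · exact Or.inl hAB
    · exact Or.inr hAB
    · exact absurd rfl hne
  · intro C hC
    simp only [Finset.mem_insert, Finset.mem_singleton] at hC
    rcases hC with rfl | rfl
    · exact ⟨hAB.trans hΓ, hAB.trans hBΔ⟩
    · exact ⟨hΓ, hBΔ⟩

open MarkedGraph in
theorem joined_split_of_collapsesTo {Γ A : MarkedGraph n} {α : Set Γ.E} (hΓ : Γ.IsRose)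
    (hα : Γ.IsDescending α) (h : A.CollapsesTo (hα.split hΓ)) :
    Joined Γ (ofVertex ⟦A⟧) (ofVertex ⟦hα.split hΓ⟧) := by
  obtain ⟨Δ, hΔ, h1, h2⟩ := hα.exists_normLT hΓ
  exact joined_of_collapsesTo hΔ h2 (Vertex.collapsesTo_mk.2 h)
    (Vertex.collapsesTo_mk.2 (hα.split_collapsesTo hΓ)) (Vertex.collapsesTo_mk.2 h1)

-- The two blow-ups are joined by a path of edges through a common blow-up `A`. On each of the two
-- edges the second rose of smaller norm is one to which the respective split collapses.
open MarkedGraph in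
theorem joined_split_of_disjoint {Γ : MarkedGraph n} {α β : Set Γ.E} (hΓ : Γ.IsRose)
    (hα : Γ.IsDescending α) (hβ : Γ.IsDescending β) (h : Disjoint α β) :
    Joined Γ (ofVertex ⟦hα.split hΓ⟧) (ofVertex ⟦hβ.split hΓ⟧) := by
  obtain ⟨A, h1, h2⟩ := hα.exists_collapsesTo hβ hΓ h
  exact (joined_split_of_collapsesTo hΓ hα h1).symm.trans (joined_split_of_collapsesTo hΓ hβ h2)

open MarkedGraph in
theorem exists_joined_split {Γ : MarkedGraph n} (hΓ : Γ.IsRose) {x : Spine n}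
    (hx : x ∈ descending Γ) : ∃ (α : Set Γ.E) (hα : Γ.IsDescending α),
      Joined Γ x (ofVertex ⟦hα.split hΓ⟧) := by
  obtain ⟨Δ, hΔ, hlt, h⟩ := hx
  obtain ⟨A, hA⟩ := x.exists_mem_support
  have h1 : Joined Γ x (ofVertex A) :=
    joined_of_isSimplex hΔ hlt x.isSimplex h (Finset.Subset.refl _) (ofVertex_mem_closedSimplex hA)
  obtain ⟨hAΓ, hAΔ⟩ := h A hA
  induction A using Quotient.inductionOn with | _ A
  obtain ⟨c, l, hl, hx⟩ := Vertex.collapsesTo_mk.1 hAΓ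
  obtain ⟨e₀, he₀, hα⟩ := exists_isDescending_cut hΓ hΔ hx (Vertex.collapsesTo_mk.1 hAΔ) hlt
  exact ⟨_, hα, h1.trans (joined_split_of_collapsesTo hΓ hα
    (collapsesTo_split hΓ hl hx he₀ hα rfl))⟩

end Spine

/-! ### Opposite pairs of rows -/

section LinearAlgebra

variable {n : ℕ} {M : Matrix (Fin n) (Fin n) ℤ}

/-- The vectors `M p` and `σ • M q` have entries of opposite signs in the first column
in which none of the two vectors has only zeros so far. -/
def IsOpposite (M : Matrix (Fin n) (Fin n) ℤ) (p q : Fin n) (σ : ℤ) : Prop :=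
  p ≠ q ∧ (σ = 1 ∨ σ = -1) ∧
    ∃ m, σ * (M p m * M q m) < 0 ∧ ((∀ c < m, M p c = 0) ∨ ∀ c < m, M q c = 0)

/-- The sum of `M p` and `σ • M q` is smaller than one of them. -/
def PairDescends (M : Matrix (Fin n) (Fin n) ℤ) (p q : Fin n) (σ : ℤ) : Prop :=
  vecNorm (M p + σ • M q) < vecNorm (M p) ∨ vecNorm (M p + σ • M q) < vecNorm (M q)

/-- The column `m` is forced: both rows are nonzero there and one of them vanishes before, so it is
the later of the two leading columns. -/
theorem IsOpposite.sign_unique {p q : Fin n} {σ τ : ℤ} (h : IsOpposite M p q σ)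
    (h' : IsOpposite M p q τ) : σ = τ := by
  obtain ⟨-, hσ, m, h1, h2⟩ := h
  obtain ⟨-, hτ, m', h1', h2'⟩ := h'
  have hm : M p m ≠ 0 ∧ M q m ≠ 0 :=
    ⟨fun h => by simp [h] at h1, fun h => by simp [h] at h1⟩
  have hm' : M p m' ≠ 0 ∧ M q m' ≠ 0 :=
    ⟨fun h => by simp [h] at h1', fun h => by simp [h] at h1'⟩
  have : m = m' := by
    rcases lt_trichotomy m m' with h | h | h
    · rcases h2' with h3 | h3
      · exact absurd (h3 m h) hm.1
      · exact absurd (h3 m h) hm.2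
    · exact h
    · rcases h2 with h3 | h3
      · exact absurd (h3 m' h) hm'.1
      · exact absurd (h3 m' h) hm'.2
  subst this
  rcases hσ with rfl | rfl <;> rcases hτ with rfl | rfl <;> first | rfl | omega

theorem IsOpposite.symm {p q : Fin n} {σ : ℤ} (h : IsOpposite M p q σ) : IsOpposite M q p σ := by
  obtain ⟨h1, h2, m, h3, h4⟩ := h
  exact ⟨h1.symm, h2, m, by rwa [mul_comm (M q m)], h4.symm⟩

/-- Adding a number of opposite sign and absolute value less than `2|x|` to `x` decreases `|x|`; the
columns before `m` are unchanged. -/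
theorem vecNorm_add_lt {p q m : Fin n} {σ : ℤ} (hσ : σ = 1 ∨ σ = -1)
    (h : σ * (M p m * M q m) < 0) (hq : ∀ c < m, M q c = 0)
    (hlt : (M q m).natAbs < 2 * (M p m).natAbs) : vecNorm (M p + σ • M q) < vecNorm (M p) := by
  refine vecNorm_lt_iff.2 ⟨m, fun c hc => by simp [hq c hc], ?_⟩
  rw [Pi.add_apply, Pi.smul_apply, smul_eq_mul]
  rcases hσ with rfl | rfl
  · rw [one_mul, mul_neg_iff] at h
    omega
  · have h' : 0 < M p m * M q m := by linarith
    rw [mul_pos_iff] at h'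
    omega

/-- Whichever row has the larger absolute entry in column `m` is decreased by the other one. -/
theorem pairDescends_of_zero {p q m : Fin n} {σ : ℤ} (hσ : σ = 1 ∨ σ = -1)
    (h : σ * (M p m * M q m) < 0) (hp : ∀ c < m, M p c = 0) (hq : ∀ c < m, M q c = 0) :
    PairDescends M p q σ := by
  have hp0 : M p m ≠ 0 := fun h' => by simp [h'] at h
  rcases le_total (M q m).natAbs (M p m).natAbs with hle | hle
  · exact Or.inl (vecNorm_add_lt hσ h hq (by omega))
  · right
    have h1 : M p + σ • M q = σ • (M q + σ • M p) := by
      rcases hσ with rfl | rfl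
      · simp [add_comm]
      · simp [add_comm]
    have h2 : ∀ v : Fin n → ℤ, vecNorm (σ • v) = vecNorm v := by
      intro v
      rcases hσ with rfl | rfl
      · simp
      · rw [neg_one_smul, vecNorm_neg]
    rw [h1, h2]
    refine vecNorm_add_lt hσ (by rwa [mul_comm (M q m)]) hp ?_
    have hq0 : M q m ≠ 0 := fun h' => by simp [h'] at h
    omega

/-- `lead i` is the first column in which the row `i` is nonzero. -/
def IsLead (M : Matrix (Fin n) (Fin n) ℤ) (lead : Fin n → Fin n) : Prop :=
  ∀ i, M i (lead i) ≠ 0 ∧ ∀ c < lead i, M i c = 0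

theorem exists_isLead {X : Matrix (Fin n) (Fin n) ℤ} (h : M * X = 1) : ∃ lead, IsLead M lead := by
  have key : ∀ i, ∃ l, M i l ≠ 0 ∧ ∀ c < l, M i c = 0 := by
    intro i
    have hne : (Finset.univ.filter fun l => M i l ≠ 0).Nonempty := by
      by_contra hemp
      rw [Finset.not_nonempty_iff_eq_empty, Finset.filter_eq_empty_iff] at hemp
      have h1 := congrFun (congrFun h i) i
      rw [Matrix.mul_apply, Matrix.one_apply_eq, Finset.sum_eq_zero] at h1
      · exact zero_ne_one h1
      · intro l _
        have := hemp (Finset.mem_univ l)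
        rw [not_not] at this
        rw [this, zero_mul]
    obtain ⟨l, hl, hmin⟩ := Finset.exists_min_image _ id hne
    refine ⟨l, (Finset.mem_filter.1 hl).2, fun c hc => ?_⟩
    by_contra h0
    exact absurd hc (not_lt.2 (hmin c (by simp [h0])))
  choose lead hlead using key
  exact ⟨lead, hlead⟩

variable {X : Matrix (Fin n) (Fin n) ℤ} {lead : Fin n → Fin n}

theorem IsLead.zero_of_lt (hL : IsLead M lead) {i c : Fin n} (h : c < lead i) : M i c = 0 :=
  (hL i).2 c h

/-- The basis vector at `l` is a combination of rows of `M`. Among the rows occurring in it, one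
with the earliest leading column has no competitor there, so that column is `l`, and its coefficient
times its entry is 1. -/
theorem IsLead.exists_unit (hL : IsLead M lead) (hMX : M * X = 1) (l : Fin n)
    (h : ∀ a b, a ≠ b → lead a = lead b → l < lead a) :
    ∃ j, lead j = l ∧ (M j l = 1 ∨ M j l = -1) := by
  have hXM : X * M = 1 := mul_eq_one_comm.1 hMX
  have hcol : ∀ c, ∑ i, X l i * M i c = if l = c then 1 else 0 := by
    intro c
    have := congrFun (congrFun hXM l) c
    rwa [Matrix.mul_apply, Matrix.one_apply] at this
  have hne : (Finset.univ.filter fun i => X l i ≠ 0).Nonempty := by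
    by_contra hemp
    rw [Finset.not_nonempty_iff_eq_empty, Finset.filter_eq_empty_iff] at hemp
    have h1 := hcol l
    rw [if_pos rfl, Finset.sum_eq_zero] at h1
    · exact zero_ne_one h1
    · intro i _
      have := hemp (Finset.mem_univ i)
      rw [not_not] at this
      rw [this, zero_mul]
  obtain ⟨i, hi, hmin⟩ := Finset.exists_min_image _ lead hne
  have hi0 : X l i ≠ 0 := (Finset.mem_filter.1 hi).2
  have hmin' : ∀ j, X l j ≠ 0 → lead i ≤ lead j := fun j hj => hmin j (by simp [hj])
  rcases lt_or_ge l (lead i) with hlt | hle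
  · have h1 := hcol l
    rw [if_pos rfl, Finset.sum_eq_zero] at h1
    · exact absurd h1 zero_ne_one
    · intro j _
      by_cases hj : X l j = 0
      · rw [hj, zero_mul]
      · rw [hL.zero_of_lt (hlt.trans_le (hmin' j hj)), mul_zero]
  · have h1 := hcol (lead i)
    rw [Finset.sum_eq_single i] at h1
    · have h2 : X l i * M i (lead i) ≠ 0 := mul_ne_zero hi0 (hL i).1
      have h3 : l = lead i := by
        by_contra h3
        rw [if_neg h3] at h1
        exact h2 h1
      refine ⟨i, h3.symm, ?_⟩
      rw [if_pos h3, ← h3, mul_comm] at h1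
      exact Int.isUnit_iff.1 (IsUnit.of_mul_eq_one _ h1)
    · intro j _ hj
      by_cases hj0 : X l j = 0
      · rw [hj0, zero_mul]
      · rw [hL.zero_of_lt, mul_zero]
        refine lt_of_le_of_ne (hmin' j hj0) fun h4 => ?_
        exact absurd (h i j hj.symm h4) (not_lt.2 hle)
    · simp

theorem natAbs_le_of_vecNorm_lt {v w : Fin n → ℤ} (h : vecNorm v < vecNorm w) {m : Fin n}
    (hm : ∀ c < m, (v c).natAbs = (w c).natAbs) : (v m).natAbs ≤ (w m).natAbs := by
  obtain ⟨i, hi, hlt⟩ := vecNorm_lt_iff.1 h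
  rcases lt_trichotomy m i with h1 | rfl | h1
  · exact (hi m h1).le
  · exact hlt.le
  · exact absurd (hm i h1) hlt.ne

theorem natAbs_sign_mul {e x : ℤ} (he : e = 1 ∨ e = -1) : (e * x).natAbs = x.natAbs := by
  rcases he with rfl | rfl <;> simp

theorem sign_mul_sign {e f : ℤ} (he : e = 1 ∨ e = -1) (hf : f = 1 ∨ f = -1) :
    e * f = 1 ∨ e * f = -1 := by
  rcases he with rfl | rfl <;> rcases hf with rfl | rfl <;> simp

/-- A unit step fails to increase `|x|` only if it goes towards zero from a nonzero `x`. -/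
theorem mul_neg_of_natAbs_add_le {e f x y : ℤ} (he : e = 1 ∨ e = -1) (hf : f = 1 ∨ f = -1)
    (hy : y = 1 ∨ y = -1) (h : (e * x + f * y).natAbs ≤ x.natAbs) : e * f * (x * y) < 0 := by
  rcases he with rfl | rfl <;> rcases hf with rfl | rfl <;> rcases hy with rfl | rfl <;> omega

/-- The case in which the leading columns are disjoint as far as needed. -/
theorem exists_opposite_of_unit (hL : IsLead M lead) (hMX : M * X = 1) {ε : Fin n → ℤ}
    (hε : ∀ i, ε i ≠ 0 → ε i = 1 ∨ ε i = -1) {i j : Fin n} (hi : ε i ≠ 0) (hj : ε j ≠ 0)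
    (hij : j ≠ i) (hlt : vecNorm (∑ i, ε i • M i) < vecNorm (M i)) (hle : lead i ≤ lead j)
    (hmin : ∀ x, x ≠ i → ε x ≠ 0 → lead j ≤ lead x)
    (hpair : ∀ a b, a ≠ b → lead a = lead b → lead j < lead a) :
    ∃ p q σ, IsOpposite M p q σ ∧ PairDescends M p q σ ∧ ε p * ε q = σ := by
  have hlt' : lead i < lead j := lt_of_le_of_ne hle fun h =>
    absurd (hpair i j hij.symm h) (not_lt.2 hle)
  have hcol : ∀ c, (∑ i, ε i • M i) c = ∑ i, ε i * M i c := fun c => by simp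
  obtain ⟨j', hj', hu⟩ := hL.exists_unit hMX (lead j) hpair
  obtain rfl : j' = j := by
    by_contra h
    exact absurd (hpair j' j h hj') (by rw [hj']; exact lt_irrefl _)
  -- Before this column only row `i` contributes, so the sum agrees there with row `i` up to sign.
  -- In this column the only further contribution is the unit from `j'`.
  have h1 : ((∑ i, ε i • M i) (lead j')).natAbs ≤ (M i (lead j')).natAbs := by
    refine natAbs_le_of_vecNorm_lt hlt fun c hc => ?_
    rw [hcol, Finset.sum_eq_single i, natAbs_sign_mul (hε i hi)]
    · intro x _ hx
      by_cases hx0 : ε x = 0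
      · rw [hx0, zero_mul]
      · rw [hL.zero_of_lt (hc.trans_le (hmin x hx hx0)), mul_zero]
    · simp
  rw [hcol, Fintype.sum_eq_add i j' hij.symm] at h1
  · have h2 : ε i * ε j' * (M i (lead j') * M j' (lead j')) < 0 :=
      mul_neg_of_natAbs_add_le (hε i hi) (hε j' hj) hu h1
    refine ⟨i, j', ε i * ε j', ⟨hij.symm, sign_mul_sign (hε i hi) (hε j' hj), lead j', h2,
      Or.inr (hL j').2⟩, Or.inl (vecNorm_add_lt (sign_mul_sign (hε i hi) (hε j' hj)) h2
        (hL j').2 ?_), rfl⟩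
    have : M i (lead j') ≠ 0 := fun h => by simp [h] at h2
    omega
  · rintro x ⟨hxi, hxj⟩
    by_cases hx0 : ε x = 0
    · rw [hx0, zero_mul]
    · rw [hL.zero_of_lt, mul_zero]
      refine lt_of_le_of_ne (hmin x hxi hx0) fun h => ?_
      exact absurd (hpair j' x (Ne.symm hxj) h) (lt_irrefl _)

/-- The case in which two rows with the same leading column occur with the same sign. -/
theorem exists_opposite_of_eq (hL : IsLead M lead) {ε : Fin n → ℤ}
    (hε : ∀ i, ε i ≠ 0 → ε i = 1 ∨ ε i = -1) {i a b : Fin n} (hi : ε i ≠ 0) (ha : ε a ≠ 0)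
    (hb : ε b ≠ 0) (hab : a ≠ b) (hk : lead b = lead a)
    (hlt : vecNorm (∑ i, ε i • M i) < vecNorm (M i)) (hle : lead i ≤ lead a)
    (hmin : ∀ x, x ≠ i → ε x ≠ 0 → lead a ≤ lead x) :
    ∃ p q σ, IsOpposite M p q σ ∧ PairDescends M p q σ ∧ ε p * ε q = σ := by
  by_cases hopp : ∃ p q, p ≠ q ∧ ε p ≠ 0 ∧ ε q ≠ 0 ∧ lead p = lead a ∧ lead q = lead a ∧
      (ε p * M p (lead a)) * (ε q * M q (lead a)) < 0
  · obtain ⟨p, q, hpq, hp, hq, hlp, hlq, h⟩ := hopp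
    have h' : ε p * ε q * (M p (lead a) * M q (lead a)) < 0 := by
      rwa [mul_mul_mul_comm] at h
    have hs := sign_mul_sign (hε p hp) (hε q hq)
    have hzp : ∀ c < lead a, M p c = 0 := fun c hc => hL.zero_of_lt (hlp ▸ hc)
    have hzq : ∀ c < lead a, M q c = 0 := fun c hc => hL.zero_of_lt (hlq ▸ hc)
    exact ⟨p, q, ε p * ε q, ⟨hpq, hs, lead a, h', Or.inl hzp⟩,
      pairDescends_of_zero hs h' hzp hzq, rfl⟩
  -- Now all signed entries `ε x * M x` of rows leading in this column share one sign, called `s`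
  -- below.
  · push Not at hopp
    have hcol : ∀ c, (∑ i, ε i • M i) c = ∑ i, ε i * M i c := fun c => by simp
    have hf : ∀ x, ε x ≠ 0 → lead x = lead a → ε x * M x (lead a) ≠ 0 :=
      fun x hx hxl => mul_ne_zero hx (hxl ▸ (hL x).1)
    have h1 : ((∑ i, ε i • M i) (lead a)).natAbs ≤ (M i (lead a)).natAbs := by
      refine natAbs_le_of_vecNorm_lt hlt fun c hc => ?_
      rw [hcol, Finset.sum_eq_single i, natAbs_sign_mul (hε i hi)]
      · intro x _ hx
        by_cases hx0 : ε x = 0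
        · rw [hx0, zero_mul]
        · rw [hL.zero_of_lt (hc.trans_le (hmin x hx hx0)), mul_zero]
      · simp
    rw [hcol, ← natAbs_sign_mul (x := M i (lead a)) (hε i hi)] at h1
    obtain ⟨s, hs, hsa⟩ : ∃ s : ℤ, (s = 1 ∨ s = -1) ∧ 0 < s * (ε a * M a (lead a)) := by
      rcases lt_or_gt_of_ne (hf a ha rfl) with h | h
      · exact ⟨-1, by simp, by linarith⟩
      · exact ⟨1, by simp, by linarith⟩
    have hpos : ∀ x, ε x ≠ 0 → lead x = lead a → 0 < s * (ε x * M x (lead a)) := by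
      intro x hx hxl
      by_cases hxa : x = a
      · rw [hxa]; exact hsa
      · have h2 := hopp x a hxa hx ha hxl rfl
        have h3 := hf x hx hxl
        rcases hs with rfl | rfl
        · rw [one_mul] at *
          exact lt_of_le_of_ne (nonneg_of_mul_nonneg_left h2 hsa) h3.symm
        · have h4 : ε a * M a (lead a) < 0 := by linarith
          have h5 : ε x * M x (lead a) ≤ 0 := by
            by_contra! h6
            exact absurd h2 (not_le.2 (mul_neg_of_pos_of_neg h6 h4))
          have := lt_of_le_of_ne h5 h3
          linarith
    have hnonneg : ∀ x, x ≠ i → 0 ≤ s * (ε x * M x (lead a)) := by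
      intro x hx
      by_cases hx0 : ε x = 0
      · simp [hx0]
      · rcases (hmin x hx hx0).eq_or_lt with h | h
        · exact (hpos x hx0 h.symm).le
        · rw [hL.zero_of_lt h]; simp
    rw [← natAbs_sign_mul hs, Finset.mul_sum, ← natAbs_sign_mul (x := ε i * _) hs] at h1
    -- Every term other than that of `i` is nonnegative after multiplication by `s`. If row `i`
    -- leads here too, the sum is strictly larger than its own entry, a contradiction. Otherwise the
    -- entry of `i` has the opposite sign, and twice its size is at least the sum of the entries of
    -- `a` and `b`, hence exceeds that of `a`.
    rcases hle.eq_or_lt with hia | hia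
    · exfalso
      have hgi := hpos i hi hia
      obtain ⟨y, hyi, hy⟩ : ∃ y, y ≠ i ∧ 0 < s * (ε y * M y (lead a)) := by
        by_cases h : a = i
        · exact ⟨b, fun h' => hab (h.trans h'.symm), hpos b hb hk⟩
        · exact ⟨a, h, hsa⟩
      have h2 : s * (ε i * M i (lead a)) + s * (ε y * M y (lead a)) ≤
          ∑ x, s * (ε x * M x (lead a)) := by
        rw [← Finset.sum_pair hyi.symm (f := fun x => s * (ε x * M x (lead a)))]
        refine Finset.sum_le_sum_of_subset_of_nonneg (Finset.subset_univ _) fun x _ hx => ?_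
        exact hnonneg x fun h => hx (by simp [h])
      omega
    · have hai : a ≠ i := fun h => by rw [h] at hia; exact lt_irrefl _ hia
      have hbi : b ≠ i := fun h => by rw [← hk, h] at hia; exact lt_irrefl _ hia
      have hgb := hpos b hb hk
      have h2 : s * (ε i * M i (lead a)) + (s * (ε a * M a (lead a)) +
          s * (ε b * M b (lead a))) ≤ ∑ x, s * (ε x * M x (lead a)) := by
        rw [← Finset.sum_pair hab (f := fun x => s * (ε x * M x (lead a))),
          ← Finset.sum_insert (f := fun x => s * (ε x * M x (lead a))) (a := i)
          (by simp [hai.symm, hbi.symm])]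
        refine Finset.sum_le_sum_of_subset_of_nonneg (Finset.subset_univ _) fun x _ hx => ?_
        exact hnonneg x fun h => hx (by simp [h])
      have h3 : s * (ε i * M i (lead a)) < 0 := by omega
      have h4 : (M a (lead a)).natAbs < 2 * (M i (lead a)).natAbs := by
        rw [← natAbs_sign_mul (x := M i (lead a)) (hε i hi),
          ← natAbs_sign_mul (x := M a (lead a)) (hε a ha),
          ← natAbs_sign_mul (x := ε i * _) hs, ← natAbs_sign_mul (x := ε a * _) hs]
        omega
      have h5 : ε i * ε a * (M i (lead a) * M a (lead a)) < 0 := by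
        have h6 := mul_neg_of_neg_of_pos h3 hsa
        have h7 : s * (ε i * M i (lead a)) * (s * (ε a * M a (lead a))) =
            s * s * (ε i * ε a * (M i (lead a) * M a (lead a))) := by ring
        have h8 : s * s = 1 := by rcases hs with rfl | rfl <;> simp
        rwa [h7, h8, one_mul] at h6
      have hs' := sign_mul_sign (hε i hi) (hε a ha)
      exact ⟨i, a, ε i * ε a, ⟨hai.symm, hs', lead a, h5, Or.inr (hL a).2⟩,
        Or.inl (vecNorm_add_lt hs' h5 (hL a).2 h4), rfl⟩

theorem exists_opposite_of_lead_eq (hL : IsLead M lead) {a b : Fin n} (hab : a ≠ b)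
    (hk : lead a = lead b) : ∃ σ, IsOpposite M a b σ ∧ PairDescends M a b σ := by
  have hza := (hL a).2
  have hzb : ∀ c < lead a, M b c = 0 := fun c hc => hL.zero_of_lt (hk ▸ hc)
  have h0 : M a (lead a) * M b (lead a) ≠ 0 := mul_ne_zero (hL a).1 (hk ▸ (hL b).1)
  rcases lt_or_gt_of_ne h0 with h | h
  · have h1 : (1 : ℤ) * (M a (lead a) * M b (lead a)) < 0 := by linarith
    exact ⟨1, ⟨hab, by simp, lead a, h1, Or.inl hza⟩, pairDescends_of_zero (by simp) h1 hza hzb⟩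
  · have h1 : (-1 : ℤ) * (M a (lead a) * M b (lead a)) < 0 := by linarith
    exact ⟨-1, ⟨hab, by simp, lead a, h1, Or.inl hza⟩, pairDescends_of_zero (by simp) h1 hza hzb⟩

/-- Every descending combination of rows is compatible with some descending opposite pair. -/
theorem exists_opposite (hMX : M * X = 1) {ε : Fin n → ℤ}
    (hε : ∀ i, ε i ≠ 0 → ε i = 1 ∨ ε i = -1) {j₀ : Fin n} (hj₀ : ε j₀ ≠ 0)
    (hlt₀ : vecNorm (∑ i, ε i • M i) < vecNorm (M j₀)) :
    ∃ p q σ, IsOpposite M p q σ ∧ PairDescends M p q σ ∧ (ε p * ε q = 0 ∨ ε p * ε q = σ) := by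
  classical
  obtain ⟨lead, hL⟩ := exists_isLead hMX
  -- A row of largest norm in the support has the earliest leading column there, and it still
  -- exceeds the combination.
  obtain ⟨i, hi, hmax⟩ := Finset.exists_max_image (Finset.univ.filter fun i => ε i ≠ 0)
    (fun i => vecNorm (M i)) ⟨j₀, by simp [hj₀]⟩
  replace hi : ε i ≠ 0 := (Finset.mem_filter.1 hi).2
  replace hmax : ∀ j, ε j ≠ 0 → vecNorm (M j) ≤ vecNorm (M i) := fun j hj => hmax j (by simp [hj])
  have hlt := hlt₀.trans_le (hmax j₀ hj₀)
  have hle : ∀ j, ε j ≠ 0 → lead i ≤ lead j := by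
    intro j hj
    by_contra! h
    refine absurd (hmax j hj) (not_le.2 (vecNorm_lt_iff.2 ⟨lead j, fun c hc => ?_, ?_⟩))
    · rw [hL.zero_of_lt hc, hL.zero_of_lt (hc.trans h)]
    · rw [hL.zero_of_lt h]
      exact Int.natAbs_pos.2 (hL j).1
  have hrest : (Finset.univ.filter fun j => j ≠ i ∧ ε j ≠ 0).Nonempty := by
    by_contra hemp
    rw [Finset.not_nonempty_iff_eq_empty, Finset.filter_eq_empty_iff] at hemp
    rw [Finset.sum_eq_single i] at hlt
    · rcases hε i hi with h | h
      · rw [h, one_smul] at hlt; exact lt_irrefl _ hlt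
      · rw [h, neg_one_smul, vecNorm_neg] at hlt; exact lt_irrefl _ hlt
    · intro j _ hj
      have := hemp (Finset.mem_univ j)
      rw [not_and, not_not] at this
      rw [this hj, zero_smul]
    · simp
  obtain ⟨j, hj, hmin⟩ := Finset.exists_min_image _ lead hrest
  obtain ⟨hji, hj0⟩ := (Finset.mem_filter.1 hj).2
  replace hmin : ∀ x, x ≠ i → ε x ≠ 0 → lead j ≤ lead x := fun x h1 h2 => hmin x (by simp [h1, h2])
  -- Two rows with a common leading column always give a descending opposite pair. The pair with the
  -- earliest such column is tried; if it is incompatible with ε, both of its rows lie in the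
  -- support.
  by_cases hpairs : (Finset.univ.filter fun x : Fin n × Fin n =>
      x.1 ≠ x.2 ∧ lead x.1 = lead x.2).Nonempty
  · obtain ⟨⟨a, b⟩, hab, hpmin⟩ := Finset.exists_min_image _ (fun x => lead x.1) hpairs
    obtain ⟨hne, hk⟩ := (Finset.mem_filter.1 hab).2
    simp only at hne hk hpmin
    replace hpmin : ∀ x y, x ≠ y → lead x = lead y → lead a ≤ lead x :=
      fun x y h1 h2 => hpmin (x, y) (by simp [h1, h2])
    obtain ⟨σ, hσ, hσd⟩ := exists_opposite_of_lead_eq hL hne hk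
    by_cases hc : ε a * ε b = 0 ∨ ε a * ε b = σ
    · exact ⟨a, b, σ, hσ, hσd, hc⟩
    · rw [not_or] at hc
      have ha : ε a ≠ 0 := left_ne_zero_of_mul hc.1
      have hb : ε b ≠ 0 := right_ne_zero_of_mul hc.1
      have hja : lead j ≤ lead a := by
        by_cases h : a = i
        · rw [hk]; exact hmin b (fun h' => hne (h.trans h'.symm)) hb
        · exact hmin a h ha
      -- Equality is the case of two supported rows leading together right after `i`; otherwise no
      -- leading columns coincide up to that of `j`, and unit leading entries are available.
      rcases hja.eq_or_lt with h | h
      · obtain ⟨p, q, σ, h1, h2, h3⟩ := exists_opposite_of_eq hL hε hi ha hb hne hk.symm hlt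
          (hle a ha) (h ▸ hmin)
        exact ⟨p, q, σ, h1, h2, Or.inr h3⟩
      · obtain ⟨p, q, σ, h1, h2, h3⟩ := exists_opposite_of_unit hL hMX hε hi hj0 hji hlt
          (hle j hj0) hmin fun x y hxy hl => h.trans_le (hpmin x y hxy hl)
        exact ⟨p, q, σ, h1, h2, Or.inr h3⟩
  · rw [Finset.not_nonempty_iff_eq_empty, Finset.filter_eq_empty_iff] at hpairs
    obtain ⟨p, q, σ, h1, h2, h3⟩ := exists_opposite_of_unit hL hMX hε hi hj0 hji hlt
      (hle j hj0) hmin fun x y hxy hl => absurd ⟨hxy, hl⟩ (hpairs (Finset.mem_univ (x, y)))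
    exact ⟨p, q, σ, h1, h2, Or.inr h3⟩

/-- A matrix without descending opposite pairs is a signed permutation matrix. -/
theorem exists_row_eq_single (hMX : M * X = 1)
    (h : ∀ p q σ, IsOpposite M p q σ → ¬ PairDescends M p q σ) (l : Fin n) :
    ∃ i, M i = Pi.single l 1 ∨ M i = - Pi.single l 1 := by
  obtain ⟨lead, hL⟩ := exists_isLead hMX
  have hinj : ∀ a b, a ≠ b → lead a ≠ lead b := fun a b hab hk => by
    obtain ⟨σ, h1, h2⟩ := exists_opposite_of_lead_eq hL hab hk
    exact h a b σ h1 h2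
  have hunit : ∀ l, ∃ j, lead j = l ∧ (M j l = 1 ∨ M j l = -1) := fun l =>
    hL.exists_unit hMX l fun a b hab hk => absurd hk (hinj a b hab)
  obtain ⟨i, rfl, hi⟩ := hunit l
  have hzero : ∀ c, c ≠ lead i → M i c = 0 := by
    intro c hc
    by_contra h0
    rcases lt_or_gt_of_ne hc with hlt | hlt
    · exact h0 (hL.zero_of_lt hlt)
    · obtain ⟨j, rfl, hj⟩ := hunit c
      have hij : i ≠ j := fun h => by rw [h] at hlt; exact lt_irrefl _ hlt
      obtain ⟨σ, hσ, hneg⟩ : ∃ σ : ℤ, (σ = 1 ∨ σ = -1) ∧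
          σ * (M i (lead j) * M j (lead j)) < 0 := by
        rcases lt_or_gt_of_ne (mul_ne_zero h0 (hL j).1) with h1 | h1
        · exact ⟨1, by simp, by linarith⟩
        · exact ⟨-1, by simp, by linarith⟩
      -- A nonzero entry of row `i` beyond its leading column could be reduced by the row whose
      -- leading entry there is a unit.
      exact h i j σ ⟨hij, hσ, lead j, hneg, Or.inr (hL j).2⟩
        (Or.inl (vecNorm_add_lt hσ hneg (hL j).2 (by omega)))
  refine ⟨i, ?_⟩
  rcases hi with hi | hi
  · left
    ext c
    by_cases hc : c = lead i
    · rw [hc, hi, Pi.single_eq_same]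
    · rw [hzero c hc, Pi.single_eq_of_ne hc]
  · right
    ext c
    by_cases hc : c = lead i
    · rw [hc, hi, Pi.neg_apply, Pi.single_eq_same]
    · rw [hzero c hc, Pi.neg_apply, Pi.single_eq_of_ne hc, neg_zero]

end LinearAlgebra

/-! ### Sign vectors as sets of oriented petals. -/

namespace MarkedGraph

open FinGraph

variable {n : ℕ} {Γ : MarkedGraph n} {a : Fin n → Γ.E}

/-- The set of oriented petals given by a vector of signs. -/
def signSet (a : Fin n → Γ.E) (ε : Fin n → ℤ) : Set Γ.E :=
  {h | ∃ i, (h = a i ∧ ε i = 1) ∨ (h = Γ.inv (a i) ∧ ε i = -1)}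

/-- All entries of the vector are `0`, `1` or `-1`. -/
def IsSign (ε : Fin n → ℤ) : Prop := ∀ i, ε i ≠ 0 → ε i = 1 ∨ ε i = -1

theorem mem_signSet (ha : Γ.IsEnumeration a) {ε : Fin n → ℤ} {i : Fin n} :
    a i ∈ signSet a ε ↔ ε i = 1 := by
  constructor
  · rintro ⟨j, ⟨h1, h2⟩ | ⟨h1, -⟩⟩
    · rwa [ha.eq_iff.1 h1]
    · exact absurd h1 (ha.ne_inv i j)
  · exact fun h => ⟨i, Or.inl ⟨rfl, h⟩⟩

theorem inv_mem_signSet (ha : Γ.IsEnumeration a) {ε : Fin n → ℤ} {i : Fin n} :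
    Γ.inv (a i) ∈ signSet a ε ↔ ε i = -1 := by
  constructor
  · rintro ⟨j, ⟨h1, -⟩ | ⟨h1, h2⟩⟩
    · exact absurd h1.symm (ha.ne_inv j i)
    · rwa [ha.eq_iff.1 (Γ.inv_injective h1)]
  · exact fun h => ⟨i, Or.inr ⟨rfl, h⟩⟩

theorem labelSum_signSet (ha : Γ.IsEnumeration a) {ε : Fin n → ℤ} (hε : IsSign ε) :
    Γ.labelSum (signSet a ε) = ∑ i, ε i • Γ.label (a i) := by
  classical
  have := Fintype.ofFinite Γ.E
  rw [labelSum_eq, ← Function.Bijective.sum_comp ha, Fintype.sum_prod_type]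
  refine Finset.sum_congr rfl fun i _ => ?_
  rw [Fintype.sum_bool]
  simp only [if_true, Bool.false_eq_true, if_false, mem_signSet ha,
    inv_mem_signSet ha, label_inv]
  by_cases h0 : ε i = 0
  · simp [h0]
  · rcases hε i h0 with h | h <;> simp [h]

theorem isDescending_signSet (ha : Γ.IsEnumeration a) {ε : Fin n → ℤ} (hε : IsSign ε)
    {j : Fin n} (hj : ε j ≠ 0)
    (h : vecNorm (∑ i, ε i • Γ.label (a i)) < vecNorm (Γ.label (a j))) :
    Γ.IsDescending (signSet a ε) := by
  rw [← labelSum_signSet ha hε] at h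
  rcases hε j hj with h1 | h1
  · exact ⟨a j, (mem_signSet ha).2 h1, fun h2 => by
      rw [inv_mem_signSet ha, h1] at h2; omega, h⟩
  · refine ⟨Γ.inv (a j), (inv_mem_signSet ha).2 h1, fun h2 => ?_, ?_⟩
    · rw [Γ.inv_inv, mem_signSet ha, h1] at h2; omega
    · rwa [label_inv, vecNorm_neg]

theorem IsDescending.exists_sign (ha : Γ.IsEnumeration a) {ε : Fin n → ℤ} (hε : IsSign ε)
    (h : Γ.IsDescending (signSet a ε)) :
    ∃ j, ε j ≠ 0 ∧ vecNorm (∑ i, ε i • Γ.label (a i)) < vecNorm (Γ.label (a j)) := by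
  obtain ⟨e, ⟨j, ⟨rfl, h1⟩ | ⟨rfl, h1⟩⟩, -, h3⟩ := h
  · exact ⟨j, by omega, by rwa [← labelSum_signSet ha hε]⟩
  · rw [label_inv, vecNorm_neg] at h3
    exact ⟨j, by omega, by rwa [← labelSum_signSet ha hε]⟩

/-- A crossing set contains at most one orientation of each petal, so a sign or zero records it. -/
theorem exists_crossing_eq_signSet (ha : Γ.IsEnumeration a) (α : Set Γ.E) :
    ∃ ε : Fin n → ℤ, IsSign ε ∧ Γ.crossing α = signSet a ε := by
  classical
  let ε : Fin n → ℤ := fun i =>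
    if a i ∈ Γ.crossing α then 1 else if Γ.inv (a i) ∈ Γ.crossing α then -1 else 0
  refine ⟨ε, fun i hi => ?_, ?_⟩
  · simp only [ε] at hi ⊢
    split_ifs at hi ⊢ <;> simp_all
  · have hex : ∀ e, e ∈ Γ.crossing α → Γ.inv e ∉ Γ.crossing α := fun e h h' => h.2 h'.1
    ext e
    obtain ⟨i, rfl | rfl⟩ := ha.exists_eq e
    · rw [mem_signSet ha]
      simp only [ε]
      split_ifs <;> simp_all
    · rw [inv_mem_signSet ha]
      have := hex (a i)
      simp only [ε]
      split_ifs <;> simp_all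

/-- The sign vector of a pair of petals. -/
def pairSign (p q : Fin n) (σ : ℤ) : Fin n → ℤ :=
  fun i => if i = p then 1 else if i = q then σ else 0

theorem isSign_pairSign {p q : Fin n} {σ : ℤ} (hσ : σ = 1 ∨ σ = -1) :
    IsSign (pairSign p q σ) := by
  intro i hi
  unfold pairSign at hi ⊢
  split_ifs at hi ⊢ <;> simp_all

theorem sum_pairSign {p q : Fin n} (hpq : p ≠ q) (σ : ℤ) (M : Fin n → Fin n → ℤ) :
    ∑ i, pairSign p q σ i • M i = M p + σ • M q := by
  rw [Fintype.sum_eq_add p q hpq]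
  · simp [pairSign, hpq.symm]
  · rintro x ⟨h1, h2⟩
    simp [pairSign, h1, h2]

theorem isDescending_pairSign (ha : Γ.IsEnumeration a) {p q : Fin n} {σ : ℤ}
    (h : IsOpposite (Matrix.of fun i => Γ.label (a i)) p q σ)
    (hd : PairDescends (Matrix.of fun i => Γ.label (a i)) p q σ) :
    Γ.IsDescending (signSet a (pairSign p q σ)) := by
  have hσ : σ ≠ 0 := by rcases h.2.1 with h | h <;> omega
  have hsum := sum_pairSign h.1 σ fun i => Γ.label (a i)
  rcases hd with hd | hd
  · refine isDescending_signSet ha (isSign_pairSign h.2.1) (j := p) (by simp [pairSign]) ?_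
    rw [hsum]; exact hd
  · refine isDescending_signSet ha (isSign_pairSign h.2.1) (j := q)
      (by simp [pairSign, h.1.symm, hσ]) ?_
    rw [hsum]; exact hd

end MarkedGraph

/-! ### Connecting the descending set through opposite pairs. -/

namespace Spine

open MarkedGraph

variable {n : ℕ} {Γ : MarkedGraph n} {a : Fin n → Γ.E}

/-- If no product is 1, the two sets of oriented petals are disjoint. Otherwise no product is -1,
and `-δ`, which descends as well, is disjoint from both. -/
theorem joined_signSet (hΓ : Γ.IsRose) (ha : Γ.IsEnumeration a) {ε δ : Fin n → ℤ}
    (hδ : IsSign δ)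
    (hcomp : ¬ ∃ i j, ε i * δ i = 1 ∧ ε j * δ j = -1)
    (hα : Γ.IsDescending (signSet a ε)) (hβ : Γ.IsDescending (signSet a δ)) :
    Joined Γ (ofVertex ⟦hα.split hΓ⟧) (ofVertex ⟦hβ.split hΓ⟧) := by
  have hdisj : ∀ ε δ : Fin n → ℤ, (∀ i, ε i * δ i ≠ 1) →
      Disjoint (signSet a ε) (signSet a δ) := by
    intro ε δ h
    refine Set.disjoint_left.2 fun e h1 h2 => ?_
    obtain ⟨i, rfl | rfl⟩ := ha.exists_eq e
    · rw [mem_signSet ha] at h1 h2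
      exact h i (by rw [h1, h2]; rfl)
    · rw [inv_mem_signSet ha] at h1 h2
      exact h i (by rw [h1, h2]; rfl)
  by_cases h1 : ∃ i, ε i * δ i = 1
  · obtain ⟨i, hi⟩ := h1
    have hnδ : IsSign (-δ) := by
      intro j hj
      rw [Pi.neg_apply] at hj ⊢
      have := hδ j (by omega)
      omega
    have hγ : Γ.IsDescending (signSet a (-δ)) := by
      obtain ⟨j, hj, hlt⟩ := hβ.exists_sign ha hδ
      refine isDescending_signSet ha hnδ (j := j) (by simpa using hj) ?_
      have : ∑ i, (-δ) i • Γ.label (a i) = - ∑ i, δ i • Γ.label (a i) := by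
        rw [← Finset.sum_neg_distrib]
        exact Finset.sum_congr rfl fun i _ => by rw [Pi.neg_apply, neg_smul]
      rw [this, vecNorm_neg]; exact hlt
    refine (joined_split_of_disjoint hΓ hα hγ (hdisj _ _ fun j hj => ?_)).trans
      (joined_split_of_disjoint hΓ hγ hβ (hdisj _ _ fun j hj => ?_))
    · refine hcomp ⟨i, j, hi, ?_⟩
      rw [Pi.neg_apply] at hj
      linarith
    · rw [Pi.neg_apply] at hj
      nlinarith [sq_nonneg (δ j)]
  · push Not at h1
    exact joined_split_of_disjoint hΓ hα hβ (hdisj _ _ h1)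

theorem not_incompatible_pairSign {ε : Fin n → ℤ} {p q : Fin n} {σ : ℤ}
    (hσ : σ = 1 ∨ σ = -1) (h : ε p * ε q = 0 ∨ ε p * ε q = σ) :
    ¬ ∃ i j, ε i * pairSign p q σ i = 1 ∧ ε j * pairSign p q σ j = -1 := by
  rintro ⟨i, j, hi, hj⟩
  have hcases : ∀ i, ε i * pairSign p q σ i ≠ 0 → i = p ∨ i = q := by
    intro i hi
    by_contra! h
    exact hi (by simp [pairSign, h.1, h.2])
  have hp : pairSign p q σ p = 1 := by simp [pairSign]
  by_cases hpq : q = p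
  · subst hpq
    rcases hcases i (by omega) with rfl | rfl <;> rcases hcases j (by omega) with rfl | rfl <;>
      omega
  have hq : pairSign p q σ q = σ := by simp [pairSign, hpq]
  rcases hcases i (by omega) with rfl | rfl <;> rcases hcases j (by omega) with rfl | rfl
  · omega
  · rw [hp, mul_one] at hi
    rw [hq] at hj
    rw [hi, one_mul] at h
    rcases hσ with rfl | rfl <;> omega
  · rw [hp, mul_one] at hj
    rw [hq] at hi
    rw [hj] at h
    rcases hσ with rfl | rfl <;> omega
  · omega

/-- Every point of the descending link is joined to a descending opposite pair. -/
theorem exists_joined_pair (hΓ : Γ.IsRose) (ha : Γ.IsEnumeration a) {x : Spine n}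
    (hx : x ∈ descending Γ) :
    ∃ p q σ, IsOpposite (Matrix.of fun i => Γ.label (a i)) p q σ ∧
      ∃ hα : Γ.IsDescending (signSet a (pairSign p q σ)),
        Joined Γ x (ofVertex ⟦hα.split hΓ⟧) := by
  obtain ⟨α, hα, h1⟩ := exists_joined_split hΓ hx
  -- The set α is not disjoint from its crossing part, so the route goes through the complement.
  have h2 := joined_split_of_disjoint hΓ hα hα.compl disjoint_compl_right
  have h3 := joined_split_of_disjoint hΓ hα.compl hα.crossing
    (Set.disjoint_left.2 fun e he he' => he he'.1)
  have h4 := (h1.trans h2).trans h3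
  obtain ⟨ε, hε, hc⟩ := Γ.exists_crossing_eq_signSet ha α
  -- The blow-up depends on its set through a proof, so the proof is generalised before the set is
  -- rewritten.
  generalize_proofs hcr at h4
  revert hcr
  rw [hc]
  intro hcr h4
  obtain ⟨j, hj, hlt⟩ := hcr.exists_sign ha hε
  obtain ⟨p, q, σ, hopp, hd, hpq⟩ := exists_opposite (Γ.label_mul_petalMatrix hΓ ha) hε hj hlt
  refine ⟨p, q, σ, hopp, isDescending_pairSign ha hopp hd, h4.trans ?_⟩
  exact joined_signSet hΓ ha (isSign_pairSign hopp.2.1)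
    (not_incompatible_pairSign hopp.2.1 hpq) hcr _

theorem isPreconnected_descending (hΓ : Γ.IsRose) : IsPreconnected (descending Γ) := by
  obtain ⟨a, ha, -⟩ := Γ.exists_standard hΓ
  suffices h : ∀ x ∈ descending Γ, ∀ y ∈ descending Γ, Joined Γ x y by
    refine isPreconnected_of_forall_pair fun x hx y hy => ?_
    obtain ⟨t, h1, h2, h3, h4⟩ := h x hx y hy
    exact ⟨t, h1, h2, h3, h4⟩
  intro x hx y hy
  obtain ⟨p, q, σ, hopp, hα, h1⟩ := exists_joined_pair hΓ ha hx
  obtain ⟨p', q', σ', hopp', hα', h2⟩ := exists_joined_pair hΓ ha hy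
  refine (h1.trans (joined_signSet hΓ ha (isSign_pairSign hopp'.2.1)
    (not_incompatible_pairSign hopp'.2.1 ?_) hα hα')).trans h2.symm
  -- If the product is nonzero, both pairs consist of the same two rows, and the sign of an opposite
  -- pair is unique.
  by_cases h0 : pairSign p q σ p' * pairSign p q σ q' = 0
  · exact Or.inl h0
  right
  have hcases : ∀ i, pairSign p q σ i ≠ 0 → i = p ∨ i = q := by
    intro i hi
    by_contra! h
    exact hi (by simp [pairSign, h.1, h.2])
  have hp : pairSign p q σ p = 1 := by simp [pairSign]
  have hq : pairSign p q σ q = σ := by simp [pairSign, hopp.1.symm]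
  rcases hcases p' (left_ne_zero_of_mul h0) with rfl | rfl <;>
    rcases hcases q' (right_ne_zero_of_mul h0) with rfl | rfl
  · exact absurd rfl hopp'.1
  · rw [hp, hq, one_mul]; exact hopp.sign_unique hopp'
  · rw [hp, hq, mul_one]; exact hopp.symm.sign_unique hopp'
  · exact absurd rfl hopp'.1

theorem descending_nonempty_of_isDescending (hΓ : Γ.IsRose) {α : Set Γ.E}
    (hα : Γ.IsDescending α) : (descending Γ).Nonempty := by
  obtain ⟨t, h1, h2, -⟩ := joined_split_of_collapsesTo hΓ hα (Equivalent.refl _).collapsesTo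
  exact ⟨_, h1 h2⟩

end Spine

variable {n : ℕ}

/-! ### Passing to the quotient -/

namespace Spine

theorem mem_support_smul (g : (Out n)ᵐᵒᵖ) (x : Spine n) (A : Vertex n) :
    A ∈ (g • x).coord.support ↔ g⁻¹ • A ∈ x.coord.support := by
  change A ∈ (Finsupp.equivMapDomain (MulAction.toPerm g) x.coord).support ↔ _
  simp [Finsupp.equivMapDomain_apply]

theorem smul_ofVertex (g : (Out n)ᵐᵒᵖ) (A : Vertex n) :
    g • ofVertex A = ofVertex (g • A) := by
  apply Spine.ext
  exact Finsupp.equivMapDomain_single (MulAction.toPerm g) A 1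

theorem ofVertex_injective : Function.Injective (ofVertex (n := n)) := fun _ _ h =>
  (Finsupp.single_left_inj one_ne_zero).1 (congrArg Spine.coord h)

/-- A rose collapses only to itself, so it is the last vertex of any chain containing it. -/
theorem mem_star_iff {Γ : MarkedGraph n} (hΓ : Γ.IsRose) {x : Spine n} :
    x ∈ star ⟦Γ⟧ ↔ ∀ A ∈ x.coord.support, A.CollapsesTo ⟦Γ⟧ := by
  classical
  constructor
  · intro hx A hA
    simp only [star, Set.mem_iUnion] at hx
    obtain ⟨s, hs, hΓs, hxs⟩ := hx
    by_cases h : A = ⟦Γ⟧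
    · rw [h]; exact Vertex.CollapsesTo.refl _
    rcases hs (Finset.mem_coe.2 (hxs hA)) (Finset.mem_coe.2 hΓs) h with h1 | h1
    · exact h1
    · induction A using Quotient.inductionOn with | _ A
      exact absurd (Quotient.sound ((Vertex.collapsesTo_mk.1 h1).equivalent_of_isRose hΓ)).symm h
  · intro h
    simp only [star, Set.mem_iUnion]
    refine ⟨insert ⟦Γ⟧ x.coord.support, ?_, Finset.mem_insert_self _ _,
      Finset.subset_insert _ _⟩
    rw [Finset.coe_insert]
    exact x.isSimplex.insert fun B hB _ => Or.inr (h B hB)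

end Spine

theorem Y.mk_eq_iff {x y : Spine n} :
    Y.mk x = Y.mk y ↔ ∃ g ∈ (Torelli n).op, g • y = x := by
  constructor
  · intro h
    obtain ⟨g, hg⟩ := Quotient.exact h
    exact ⟨g.1, g.2, hg⟩
  · rintro ⟨g, hg, h⟩
    exact Quotient.sound ⟨⟨g, hg⟩, h⟩

theorem Y.ofGraph_eq_iff {Γ Δ : MarkedGraph n} :
    Y.ofGraph Γ = Y.ofGraph Δ ↔ ∃ g ∈ (Torelli n).op, g • (⟦Δ⟧ : Vertex n) = ⟦Γ⟧ := by
  rw [Y.ofGraph, Y.ofGraph, Y.mk_eq_iff]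
  simp only [Spine.smul_ofVertex, Spine.ofVertex_injective.eq_iff]

theorem exists_smul_eq_act {g : (Out n)ᵐᵒᵖ} (hg : g ∈ (Torelli n).op) (Γ : MarkedGraph n) :
    ∃ φ : MulAut (F n), autAb n φ = 1 ∧ g • (⟦Γ⟧ : Vertex n) = ⟦Γ.act φ⟧ := by
  obtain ⟨φ, hφ⟩ := QuotientGroup.mk_surjective g.unop
  refine ⟨φ, ?_, ?_⟩
  · have h1 : outAb n g.unop = 1 := hg
    rw [← hφ] at h1
    exact h1
  · obtain rfl : g = MulOpposite.op (φ : Out n) := by rw [hφ]; rfl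
    rfl

theorem normSet_eq_of_ofGraph_eq {Γ Δ : MarkedGraph n} (h : Y.ofGraph Γ = Y.ofGraph Δ) :
    Γ.normSet = Δ.normSet := by
  obtain ⟨g, hg, h⟩ := Y.ofGraph_eq_iff.1 h
  obtain ⟨φ, hφ, h'⟩ := exists_smul_eq_act hg Δ
  have h1 := (Quotient.exact (h.symm.trans h')).range_label
  have h2 : Set.range (Δ.act φ).label = Set.range Δ.label := by rw [Δ.label_act hφ]; rfl
  have h3 : ∀ Γ : MarkedGraph n, Γ.normSet = vecNorm '' Set.range Γ.label := fun Γ =>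
    Set.range_comp vecNorm Γ.label
  rw [h3, h3, h1, h2]

namespace Rose

theorem HasNorm.exists_matrix {ρ : Rose n} {N} (h : ρ.HasNorm N) {Γ : MarkedGraph n}
    (hΓ : Γ.IsRose) (hΓρ : Y.ofGraph Γ = ρ.point) :
    ∃ M, Γ.IsMarkingMatrix M ∧ IsStandard M ∧ matNorm M = N := by
  obtain ⟨Γ', M', -, h2, h3, h4, rfl⟩ := h
  obtain ⟨a, ha, has⟩ := Γ.exists_standard hΓ
  have hM : Γ.IsMarkingMatrix (Matrix.of fun i => Γ.label (a i)) := ⟨a, ha, fun _ => rfl⟩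
  refine ⟨_, hM, has, has.matNorm_eq h4 ?_⟩
  rw [hM.range_vecNorm, h3.range_vecNorm, normSet_eq_of_ofGraph_eq (hΓρ.trans h2.symm)]

theorem normLT_iff {σ ρ : Rose n} {Δ Γ : MarkedGraph n} (hΔ : Δ.IsRose) (hΓ : Γ.IsRose)
    (hΔσ : Y.ofGraph Δ = σ.point) (hΓρ : Y.ofGraph Γ = ρ.point) :
    σ.NormLT ρ ↔ Δ.NormLT Γ := by
  constructor
  · rintro ⟨N, N', h, h', hlt⟩
    obtain ⟨M, h1, h2, rfl⟩ := h.exists_matrix hΔ hΔσ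
    obtain ⟨M', h1', h2', rfl⟩ := h'.exists_matrix hΓ hΓρ
    exact ⟨M, M', h1, h2, h1', h2', hlt⟩
  · rintro ⟨M, M', h1, h2, h1', h2', hlt⟩
    exact ⟨_, _, ⟨Δ, M, hΔ, hΔσ, h1, h2, rfl⟩, ⟨Γ, M', hΓ, hΓρ, h1', h2', rfl⟩, hlt⟩

/-- A point of the link lifts to a point near some rose over `ρ` and to a point near some smaller
rose. Torelli translations make these lifts equal and the first rose equal to Γ, without affecting
norms. -/
theorem descendingLink_eq {ρ : Rose n} {Γ : MarkedGraph n} (hΓ : Γ.IsRose)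
    (hΓρ : Y.ofGraph Γ = ρ.point) : ρ.descendingLink = Y.mk '' Spine.descending Γ := by
  ext y
  constructor
  · rintro ⟨h1, h2⟩
    simp only [star, Set.mem_iUnion] at h1 h2
    obtain ⟨Γ', ⟨hΓ', hΓ'ρ⟩, x, hx, rfl⟩ := h1
    obtain ⟨σ, hσ, Δ', ⟨hΔ', hΔ'σ⟩, x', hx', hxx'⟩ := h2
    obtain ⟨g, hg, hgΓ⟩ := Y.ofGraph_eq_iff.1 (hΓρ.trans hΓ'ρ.symm)
    have hz : Y.mk (g • x) = Y.mk x := Y.mk_eq_iff.2 ⟨g, hg, rfl⟩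
    obtain ⟨k, hk, hkx⟩ := Y.mk_eq_iff.1 (hz.trans hxx'.symm)
    obtain ⟨φ, hφ, hkΔ⟩ := exists_smul_eq_act hk Δ'
    have hΔ : (Δ'.act φ).IsRose := hΔ'
    refine ⟨g • x, ⟨Δ'.act φ, hΔ, ?_, fun A hA => ⟨?_, ?_⟩⟩, hz⟩
    · refine (normLT_iff hΔ hΓ ?_ hΓρ).1 hσ
      rw [← hΔ'σ, Y.ofGraph_eq_iff]
      exact ⟨k, hk, hkΔ⟩
    · rw [Spine.mem_support_smul] at hA
      have := ((Spine.mem_star_iff hΓ').1 hx _ hA).smul g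
      rwa [smul_inv_smul, hgΓ] at this
    · rw [← hkx, Spine.mem_support_smul] at hA
      have := ((Spine.mem_star_iff hΔ').1 hx' _ hA).smul k
      rwa [smul_inv_smul, hkΔ] at this
  · rintro ⟨x, ⟨Δ, hΔ, hlt, h⟩, rfl⟩
    refine ⟨?_, ?_⟩
    · simp only [star, Set.mem_iUnion]
      exact ⟨Γ, ⟨hΓ, hΓρ⟩, x, (Spine.mem_star_iff hΓ).2 fun A hA => (h A hA).1, rfl⟩
    · simp only [star, Set.mem_iUnion]
      exact ⟨⟨Y.ofGraph Δ, Δ, hΔ, rfl⟩, (normLT_iff hΔ hΓ rfl hΓρ).2 hlt, Δ, ⟨hΔ, rfl⟩, x,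
        (Spine.mem_star_iff hΔ).2 fun A hA => (h A hA).2, rfl⟩

end Rose

/-! ### The rose with the identity marking -/

namespace MarkedGraph

open FinGraph

theorem idGraph_isRose (hn : 2 ≤ n) : (idGraph n hn).IsRose :=
  (inferInstance : Subsingleton Unit)

theorem idGraph_marking_of (hn : 2 ≤ n) (i : Fin n) :
    ((idGraph n hn).marking (FreeGroup.of i)).1 = (stdGraph n).edge (i, true) := by
  change stdPathEquiv n (FreeGroup.of i) = _
  simp [stdPathEquiv]

theorem label_idGraph (hn : 2 ≤ n) (i : Fin n) :
    (idGraph n hn).label ((i, true) : Fin n × Bool) = Pi.single i 1 := by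
  funext c
  refine (congrArg ((stdGraph n).cnt (i, true)) (idGraph_marking_of hn c)).trans ?_
  refine ((stdGraph n).cnt_edge (i, true) (c, true)).trans ?_
  simp [Pi.single_apply]

theorem not_isDescending_idGraph (hn : 2 ≤ n) (α : Set (idGraph n hn).E) :
    ¬ (idGraph n hn).IsDescending α := by
  intro hα
  let a : Fin n → (idGraph n hn).E := fun i => ((i, true) : Fin n × Bool)
  have ha : (idGraph n hn).IsEnumeration a := by
    have h : (fun p : Fin n × Bool => if p.2 then a p.1 else (idGraph n hn).inv (a p.1)) =
        (id : Fin n × Bool → Fin n × Bool) := by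
      funext ⟨i, b⟩
      cases b <;> rfl
    exact (congrArg (Function.Bijective (α := Fin n × Bool) (β := Fin n × Bool)) h).mpr
      Function.bijective_id
  obtain ⟨ε, hε, hc⟩ := exists_crossing_eq_signSet ha α
  have hα' := hα.crossing
  rw [hc] at hα'
  obtain ⟨j, hj, hlt⟩ := hα'.exists_sign ha hε
  have hlab : ∀ i, (idGraph n hn).label (a i) = Pi.single i 1 := label_idGraph hn
  simp only [hlab] at hlt
  have hsum : ∑ i, ε i • (Pi.single i 1 : Fin n → ℤ) = ε := by
    funext c
    simp [Finset.sum_apply, Pi.single_apply]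
  obtain ⟨m, -, hm⟩ := vecNorm_lt_iff.1 hlt
  -- The first place where ε is smaller than the basis vector at `j` must be `j`, and it would force
  -- `ε j = 0`.
  rw [show (∑ i, ε i • (Pi.single i 1 : Fin n → ℤ)) m = ε m from congrFun hsum m] at hm
  obtain rfl : m = j := by
    by_contra h
    rw [Pi.single_eq_of_ne h] at hm
    simp at hm
  rw [Pi.single_eq_same] at hm
  omega

/-- A rose whose labels are the standard basis vectors up to sign is the identity rose. -/
theorem ofGraph_eq_idGraph (hn : 2 ≤ n) {Γ : MarkedGraph n} (hΓ : Γ.IsRose) {e : Fin n → Γ.E}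
    (he : ∀ l, Γ.label (e l) = Pi.single l 1) : Y.ofGraph Γ = Y.ofGraph (idGraph n hn) := by
  have : Subsingleton Γ.V := hΓ
  obtain ⟨a, ha, -⟩ := Γ.exists_standard hΓ
  have hinj : Function.Injective fun p : Fin n × Bool => if p.2 then e p.1 else Γ.inv (e p.1) := by
    rintro ⟨i, b⟩ ⟨j, b'⟩ h
    have h1 := congrFun (congrArg Γ.label h) i
    cases b <;> cases b' <;>
      simp [label_inv, he, Pi.single_apply] at h1 ⊢ <;>
      first | exact h1 | (split_ifs at h1 <;> simp_all)
  have hcard : Nat.card Γ.E ≤ Nat.card (Fin n × Bool) :=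
    (Nat.card_congr (Equiv.ofBijective _ ha)).ge
  have hbij := hinj.bijective_of_nat_card_le hcard
  let k : (stdGraph n).Iso Γ.toFinGraph :=
    { onV := ⟨fun _ => Γ.base, fun _ => (), fun _ => rfl, fun _ => Subsingleton.elim _ _⟩
      onE := Equiv.ofBijective _ hbij
      src_onE := fun _ => Subsingleton.elim _ _
      inv_onE := by
        rintro ⟨i, b⟩
        cases b
        · exact Γ.inv_inv _
        · rfl }
  let K : (stdGraph n).PathGroup ≃* Γ.PathGroup :=
    { toFun := k.map
      invFun := k.symm.map
      left_inv := k.map_symm_map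
      right_inv := k.symm.map_symm_map
      map_mul' := map_mul k.map }
  -- The marking of Γ read in the standard rose through the identification `k` of petals; the
  -- hypothesis on labels says that it preserves all exponent sums.
  let φ : MulAut (F n) := (Γ.pathEquiv hΓ).trans (K.symm.trans (stdPathEquiv n).symm)
  have hφ : ∀ x, k.map (stdPathEquiv n (φ x)) = Γ.marking x := by
    intro x
    change K (stdPathEquiv n ((stdPathEquiv n).symm (K.symm (Γ.pathEquiv hΓ x)))) = _
    rw [MulEquiv.apply_symm_apply, MulEquiv.apply_symm_apply]
    rfl
  have hexpo : ∀ l y, expo l y = (stdGraph n).cnt (l, true) (stdPathEquiv n y) := by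
    intro l y
    have := (idGraph n hn).cnt_marking (l, true) y
    rw [label_idGraph] at this
    refine Eq.trans ?_ this.symm
    simp [Pi.single_apply]
  have hab : autAb n φ = 1 := by
    refine MulEquiv.ext fun y => ?_
    obtain ⟨x, rfl⟩ := QuotientGroup.mk_surjective y
    refine abelianization_eq_of_expo (x := φ x) (y := x) fun l => ?_
    have h1 := k.toCollapse.cnt_map ⟨(l, true), fun h => h⟩ (stdPathEquiv n (φ x))
    rw [k.toCollapse_map, hφ] at h1
    have h2 : Γ.cnt (e l) (Γ.marking x) = expo l x := by
      rw [cnt_marking, he]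
      simp [Pi.single_apply]
    rw [hexpo l (φ x), ← h2]
    exact h1.symm
  have heq : ((idGraph n hn).act φ).Equivalent Γ := ⟨k, [], Subsingleton.elim _ _, fun x => by
    rw [word_nil, one_mul, inv_one, mul_one]; exact hφ x⟩
  rw [Y.ofGraph_eq_iff]
  exact ⟨MulOpposite.op (φ : Out n), hab, Quotient.sound heq⟩

theorem ofGraph_eq_idGraph_of_not_isDescending (hn : 2 ≤ n) {Γ : MarkedGraph n}
    (hΓ : Γ.IsRose) (h : ∀ α, ¬ Γ.IsDescending α) : Y.ofGraph Γ = Y.ofGraph (idGraph n hn) := by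
  obtain ⟨a, ha, -⟩ := Γ.exists_standard hΓ
  have key : ∀ l, ∃ e, Γ.label e = Pi.single l 1 := by
    intro l
    obtain ⟨i, hi | hi⟩ := exists_row_eq_single (Γ.label_mul_petalMatrix hΓ ha)
      (fun p q σ h1 h2 => h _ (isDescending_pairSign ha h1 h2)) l
    · exact ⟨a i, hi⟩
    · refine ⟨Γ.inv (a i), ?_⟩
      have hi' : Γ.label (a i) = - Pi.single l 1 := hi
      rw [label_inv, hi', neg_neg]
  choose e he using key
  exact ofGraph_eq_idGraph hn hΓ he

end MarkedGraph

end TorelliSpine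

theorem mainTheorem5 (n : ℕ) (hn : 2 ≤ n) :
    (∀ ρ : TorelliSpine.Rose n,
      ρ.descendingLink.Nonempty ↔ ρ ≠ TorelliSpine.idRose n hn) ∧
    (∀ ρ : TorelliSpine.Rose n, IsPreconnected ρ.descendingLink) := by
  open TorelliSpine in
  refine ⟨fun ρ => ⟨?_, fun hne => ?_⟩, fun ρ => ?_⟩
  · rintro h rfl
    rw [Rose.descendingLink_eq (MarkedGraph.idGraph_isRose hn) rfl, Set.image_nonempty] at h
    obtain ⟨x, hx⟩ := h
    obtain ⟨α, hα, -⟩ := Spine.exists_joined_split (MarkedGraph.idGraph_isRose hn) hx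
    exact MarkedGraph.not_isDescending_idGraph hn α hα
  · obtain ⟨p, Γ, hΓ, hp⟩ := ρ
    rw [Rose.descendingLink_eq hΓ hp, Set.image_nonempty]
    by_contra hemp
    refine hne ?_
    have := MarkedGraph.ofGraph_eq_idGraph_of_not_isDescending hn hΓ fun α hα =>
      hemp (Spine.descending_nonempty_of_isDescending hΓ hα)
    subst hp
    simp only [idRose, this]
  · obtain ⟨Γ, hΓ, hp⟩ := ρ.isRose
    rw [Rose.descendingLink_eq hΓ hp]
    exact (Spine.isPreconnected_descending hΓ).image _ continuous_quotient_mk'.continuousOn
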